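/- Let $n\in\mathbb{N}$ and $s\in(\tfrac12,\tfrac n2)$ (so $n\ge 2$). Write $\widehat f(\xi)=\int_{\mathbb{R}^n}f(x)e^{-ix\cdot\xi}\,\mathrm{d}x$ for the Fourier transform, extended to tempered distributions. Let $\dot H^s(\mathbb{R}^n)$ be the space of complex tempered distributions $f$ such that $\widehat f$ is a locally integrable function and $$\|f\|_{\dot H^s(\mathbb{R}^n)}^2=\frac{1}{(2\pi)^n}\int_{\mathbb{R}^n}|\xi|^{2s}|\widehat f(\xi)|^2\,\mathrm{d}\xi<\infty .$$ There is a unique bounded linear operator $\mathcal{R}:\dot H^s(\mathbb{R}^n)\to L^2(\mathbb{S}^{n-1})$ (with the surface measure on $\mathbb{S}^{n-1}$) that maps each Schwartz function to its restriction to $\mathbb{S}^{n-1}$. Let $\|\mathcal{R}\|$ be its operator norm and let $$M(\mathcal{R})=\{f\in\dot H^s(\mathbb{R}^n)\setminus\{0\}:\ \|\mathcal{R}f\|_{L^2(\mathbb{S}^{n-1})}=\|\mathcal{R}\|\,\|f\|_{\dot H^s(\mathbb{R}^n)}\}$$ be its set of extremisers. Then $M(\mathcal{R})\neq\emptyset$,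 and the inequality $$\|\mathcal{R}\|^2\|f\|_{\dot H^s(\mathbb{R}^n)}^2-\|\mathcal{R}f\|_{L^2(\mathbb{S}^{n-1})}^2\ \ge\ C\inf_{f_\ast\in M(\mathcal{R})}\|f-f_\ast\|_{\dot H^s(\mathbb{R}^n)}^2$$ holds for every $f\in\dot H^s(\mathbb{R}^n)$ with $$C=2^{1-2s}\frac{\Gamma(2s-1)}{\Gamma(s)^2}\left(\frac{\Gamma(\frac{n-2s}{2})}{\Gamma(\frac{n+2s-2}{2})}-\frac{\Gamma(\frac{n-2s+2}{2})}{\Gamma(\frac{n+2s}{2})}\right).$$ This constant is optimal: the inequality fails for some $f\in\dot H^s(\mathbb{R}^n)$ if $C$ is replaced by any larger number. Moreover, for $f\in\dot H^s(\mathbb{R}^n)$, equality holds (with this $C$) if and only if there exist $c\in\mathbb{C}$ and $Y_1\in H_1$ such that $$|\xi|^{\frac{n-2}{2}+2s}\,\widehat f(\xi)=c\,J_{\frac{n-2}{2}}(|\xi|)+Y_1(\xi')\,J_{\frac n2}(|\xi|)\qquad\text{for almost every }\xi\in\mathbb{R}^n,$$ where $\xi'=\xi/|\xi|$, $J_\nu$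 is the Bessel function of the first kind of order $\nu$, and $H_1$ is the space of spherical harmonics of degree $1$, i.e. the restrictions to $\mathbb{S}^{n-1}$ of the (complex) homogeneous harmonic polynomials of degree $1$ on $\mathbb{R}^n$. -/

import Mathlib

open MeasureTheory
open scoped SchwartzMap FourierTransform

noncomputable section

namespace SphereTrace

/-- The Euclidean space `ℝⁿ`. -/
abbrev Eucl (n : ℕ) : Type := EuclideanSpace ℝ (Fin n)

/-- The unit sphere `S^{n-1}` of `ℝⁿ`. -/
abbrev Sph (n : ℕ) : Type := Metric.sphere (0 : Eucl n) 1

/-- The (unnormalised) surface measure `dσ` on `S^{n-1}`. -/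
abbrev surfaceMeasure (n : ℕ) : Measure (Sph n) := (volume : Measure (Eucl n)).toSphere

/-! ### The Fourier transform -/

/-- The dilation `ξ ↦ (2π)⁻¹ ξ` of `ℝⁿ`. -/
def dilation (n : ℕ) : Eucl n ≃L[ℝ] Eucl n :=
  ContinuousLinearEquiv.smulLeft (Units.mk0 ((2 * Real.pi)⁻¹) (by positivity))

theorem dilation_apply (n : ℕ) (ξ : Eucl n) : dilation n ξ = (2 * Real.pi)⁻¹ • ξ := rfl

/-- The Fourier transform `φ̂(ξ) = ∫ φ(x) e^{-i x·ξ} dx` on Schwartz functions. It is Mathlib's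
transform, which has the kernel `e^{-2πi x·ξ}`, followed by a dilation;
see `schwartzFourier_apply`. -/
def schwartzFourier (n : ℕ) : 𝓢(Eucl n, ℂ) →L[ℂ] 𝓢(Eucl n, ℂ) :=
  SchwartzMap.compCLMOfContinuousLinearEquiv ℂ (dilation n) ∘L
    FourierTransform.fourierCLM ℂ 𝓢(Eucl n, ℂ)

theorem schwartzFourier_apply (n : ℕ) (φ : 𝓢(Eucl n, ℂ)) (ξ : Eucl n) :
    schwartzFourier n φ ξ =
      ∫ x : Eucl n, φ x * Complex.exp (-Complex.I * ((inner ℝ x ξ : ℝ) : ℂ)) := by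
  have h : schwartzFourier n φ ξ = 𝓕 (φ : Eucl n → ℂ) ((2 * Real.pi)⁻¹ • ξ) := by
    simp [schwartzFourier, SchwartzMap.fourier_coe, dilation_apply]
  rw [h, Real.fourier_eq']
  refine integral_congr_ae (Filter.Eventually.of_forall fun x => ?_)
  simp only [smul_eq_mul, inner_smul_right]
  rw [mul_comm]
  congr 2
  push_cast
  have : (Real.pi : ℂ) ≠ 0 := by exact_mod_cast Real.pi_ne_zero
  field_simp

theorem schwartzFourier_surjective (n : ℕ) : Function.Surjective (schwartzFourier n) := by
  intro ψ
  refine ⟨𝓕⁻ (SchwartzMap.compCLMOfContinuousLinearEquiv ℂ (dilation n).symm ψ), ?_⟩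
  ext ξ
  simp [schwartzFourier]

/-- The Fourier transform of the tempered distribution `f` (that is, `⟨f̂, φ⟩ = ⟨f, φ̂⟩` for
Schwartz `φ`) is given by the locally integrable function `F`. -/
def HasFourier {n : ℕ} (f : 𝓢'(Eucl n, ℂ)) (F : Eucl n → ℂ) : Prop :=
  LocallyIntegrable F volume ∧
    ∀ φ : 𝓢(Eucl n, ℂ), Integrable (fun ξ => φ ξ * F ξ) volume ∧
      f (schwartzFourier n φ) = ∫ ξ, φ ξ * F ξ

theorem HasFourier.unique {n : ℕ} {f : 𝓢'(Eucl n, ℂ)} {F G : Eucl n → ℂ}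
    (hF : HasFourier f F) (hG : HasFourier f G) : F =ᵐ[volume] G := by
  refine ae_eq_of_integral_contDiff_smul_eq hF.1 hG.1 fun g hg hc => ?_
  have hg₁ : HasCompactSupport (Complex.ofRealCLM ∘ g) := hc.comp_left rfl
  have hg₂ : ContDiff ℝ (⊤ : ℕ∞) (Complex.ofRealCLM ∘ g) := by fun_prop
  have h := ((hF.2 (hg₁.toSchwartzMap hg₂)).2).symm.trans (hG.2 (hg₁.toSchwartzMap hg₂)).2
  simpa using h

theorem HasFourier.add {n : ℕ} {f g : 𝓢'(Eucl n, ℂ)} {F G : Eucl n → ℂ}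
    (hF : HasFourier f F) (hG : HasFourier g G) : HasFourier (f + g) (F + G) := by
  refine ⟨hF.1.add hG.1, fun φ => ?_⟩
  have h : (fun ξ => φ ξ * (F + G) ξ) = fun ξ => φ ξ * F ξ + φ ξ * G ξ := by
    ext ξ; simp [mul_add]
  rw [h]
  refine ⟨(hF.2 φ).1.add (hG.2 φ).1, ?_⟩
  rw [integral_add (hF.2 φ).1 (hG.2 φ).1, ← (hF.2 φ).2, ← (hG.2 φ).2]
  rfl

theorem HasFourier.smul {n : ℕ} {f : 𝓢'(Eucl n, ℂ)} {F : Eucl n → ℂ} (c : ℂ)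
    (hF : HasFourier f F) : HasFourier (c • f) (c • F) := by
  refine ⟨hF.1.smul c, fun φ => ?_⟩
  have h : (fun ξ => φ ξ * (c • F) ξ) = fun ξ => c * (φ ξ * F ξ) := by
    ext ξ; simp only [Pi.smul_apply, smul_eq_mul]; ring
  rw [h]
  refine ⟨(hF.2 φ).1.const_mul c, ?_⟩
  rw [integral_const_mul, ← (hF.2 φ).2]
  rfl

theorem HasFourier.zero {n : ℕ} : HasFourier (0 : 𝓢'(Eucl n, ℂ)) 0 := by
  refine ⟨locallyIntegrable_zero, fun φ => ⟨by simp, by simp⟩⟩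

theorem HasFourier.eq_zero {n : ℕ} {f : 𝓢'(Eucl n, ℂ)} {F : Eucl n → ℂ}
    (hF : HasFourier f F) (h : F =ᵐ[volume] 0) : f = 0 := by
  ext φ
  obtain ⟨ψ, rfl⟩ := schwartzFourier_surjective n φ
  rw [(hF.2 ψ).2, integral_eq_zero_of_ae]
  · rfl
  · filter_upwards [h] with ξ hξ
    simp [hξ]

/-! ### The homogeneous Sobolev space -/

/-- The tempered distributions `f` on `ℝⁿ` whose Fourier transform is a locally integrable
function with `|ξ|^s f̂ ∈ L²(ℝⁿ)`. -/
def homSobolevSubmodule (n : ℕ) (s : ℝ) : Submodule ℂ 𝓢'(Eucl n, ℂ) where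
  carrier := {f | ∃ F : Eucl n → ℂ, HasFourier f F ∧
    MemLp (fun ξ => ((‖ξ‖ ^ s : ℝ) : ℂ) * F ξ) 2 volume}
  add_mem' := by
    rintro f g ⟨F, hF, hF'⟩ ⟨G, hG, hG'⟩
    refine ⟨F + G, hF.add hG, ?_⟩
    have h := hF'.add hG'
    convert h using 1
    ext ξ; simp [mul_add]
  zero_mem' := ⟨0, HasFourier.zero, by simp⟩
  smul_mem' := by
    rintro c f ⟨F, hF, hF'⟩
    refine ⟨c • F, hF.smul c, ?_⟩
    have h := hF'.const_smul c
    convert h using 1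
    ext ξ; simp only [Pi.smul_apply, smul_eq_mul]; ring

/-- The homogeneous Sobolev space `Ḣ^s(ℝⁿ)`. It is a copy of `homSobolevSubmodule n s`, on which
the Sobolev norm (and not the topology of distributions) is installed below. -/
def HomSobolev (n : ℕ) (s : ℝ) : Type := homSobolevSubmodule n s

namespace HomSobolev

variable {n : ℕ} {s : ℝ}

instance : AddCommGroup (HomSobolev n s) := inferInstanceAs (AddCommGroup (homSobolevSubmodule n s))

instance : Module ℂ (HomSobolev n s) := inferInstanceAs (Module ℂ (homSobolevSubmodule n s))

/-- The tempered distribution underlying an element of `Ḣ^s(ℝⁿ)`. -/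
def toDistribution : HomSobolev n s →ₗ[ℂ] 𝓢'(Eucl n, ℂ) := (homSobolevSubmodule n s).subtype

theorem toDistribution_injective :
    Function.Injective (toDistribution : HomSobolev n s →ₗ[ℂ] 𝓢'(Eucl n, ℂ)) :=
  Subtype.val_injective

/-- The function `f̂` (determined almost everywhere). -/
def fourier (f : HomSobolev n s) : Eucl n → ℂ := f.2.choose

theorem hasFourier (f : HomSobolev n s) : HasFourier (toDistribution f) (fourier f) :=
  f.2.choose_spec.1

theorem memLp (f : HomSobolev n s) :
    MemLp (fun ξ => ((‖ξ‖ ^ s : ℝ) : ℂ) * fourier f ξ) 2 volume :=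
  f.2.choose_spec.2

theorem fourier_add (f g : HomSobolev n s) : fourier (f + g) =ᵐ[volume] fourier f + fourier g :=
  (hasFourier (f + g)).unique (by rw [map_add]; exact (hasFourier f).add (hasFourier g))

theorem fourier_smul (c : ℂ) (f : HomSobolev n s) : fourier (c • f) =ᵐ[volume] c • fourier f :=
  (hasFourier (c • f)).unique (by rw [map_smul]; exact (hasFourier f).smul c)

/-- The linear map `f ↦ (2π)^{-n/2} |ξ|^s f̂` from `Ḣ^s(ℝⁿ)` to `L²(ℝⁿ)`. By Plancherel's theorem
the norm of its value is the `L²` norm of `(-Δ)^{s/2} f`. -/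
def toL2 : HomSobolev n s →ₗ[ℂ] Lp ℂ 2 (volume : Measure (Eucl n)) where
  toFun f := (((2 * Real.pi) ^ (-(n : ℝ) / 2) : ℝ) : ℂ) • (memLp f).toLp _
  map_add' f g := by
    rw [← smul_add, ← MemLp.toLp_add]
    congr 1
    refine MemLp.toLp_congr _ _ ?_
    filter_upwards [fourier_add f g] with ξ hξ
    simp [hξ, mul_add]
  map_smul' c f := by
    rw [RingHom.id_apply, smul_comm c]
    congr 1
    rw [← MemLp.toLp_const_smul]
    refine MemLp.toLp_congr _ _ ?_
    filter_upwards [fourier_smul c f] with ξ hξ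
    simp only [hξ, Pi.smul_apply, smul_eq_mul]
    ring

theorem norm_toL2_sq (f : HomSobolev n s) :
    ‖toL2 f‖ ^ 2 = (2 * Real.pi) ^ (-(n : ℝ)) * ∫ ξ, ‖ξ‖ ^ (2 * s) * ‖fourier f ξ‖ ^ 2 := by
  have h1 : ‖toL2 f‖ = (2 * Real.pi) ^ (-(n : ℝ) / 2) * ‖(memLp f).toLp _‖ := by
    change ‖(((2 * Real.pi) ^ (-(n : ℝ) / 2) : ℝ) : ℂ) • (memLp f).toLp _‖ = _
    rw [norm_smul, Complex.norm_real, Real.norm_of_nonneg (by positivity)]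
  have h2 : ‖(memLp f).toLp _‖ ^ 2 = ∫ ξ, ‖ξ‖ ^ (2 * s) * ‖fourier f ξ‖ ^ 2 := by
    rw [← real_inner_self_eq_norm_sq, L2.inner_def]
    refine integral_congr_ae ?_
    filter_upwards [(memLp f).coeFn_toLp] with ξ hξ
    rw [hξ, real_inner_self_eq_norm_sq, norm_mul, Complex.norm_real,
      Real.norm_of_nonneg (by positivity), mul_pow, ← Real.rpow_mul_natCast (norm_nonneg _)]
    norm_num [mul_comm]
  rw [h1, mul_pow, h2, ← Real.rpow_mul_natCast (by positivity)]
  norm_num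

theorem toL2_injective [NeZero n] :
    Function.Injective (toL2 : HomSobolev n s →ₗ[ℂ] Lp ℂ 2 (volume : Measure (Eucl n))) := by
  rw [injective_iff_map_eq_zero]
  intro f hf
  have hc : (((2 * Real.pi) ^ (-(n : ℝ) / 2) : ℝ) : ℂ) ≠ 0 := by
    have : (0 : ℝ) < (2 * Real.pi) ^ (-(n : ℝ) / 2) := by positivity
    exact_mod_cast this.ne'
  have h0 : (memLp f).toLp _ = 0 := (smul_eq_zero.mp hf).resolve_left hc
  have h1 := (MemLp.toLp_eq_toLp_iff (memLp f) (MemLp.zero (ε := ℂ) (p := 2))).mp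
    (h0.trans (MemLp.toLp_zero _).symm)
  apply toDistribution_injective
  rw [map_zero]
  refine (hasFourier f).eq_zero ?_
  have hne : ∀ᵐ ξ : Eucl n, ξ ≠ 0 := by simp [ae_iff]
  filter_upwards [h1, hne] with ξ hξ h2
  have h3 : (0 : ℝ) < ‖ξ‖ ^ s := Real.rpow_pos_of_pos (norm_pos_iff.mpr h2) s
  simpa [h3.ne', Complex.ofReal_eq_zero] using hξ

/-- The norm `‖f‖ = ‖(-Δ)^{s/2} f‖_{L²} = (2π)^{-n/2} ‖|ξ|^s f̂‖_{L²}` of `Ḣ^s(ℝⁿ)`;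
see `norm_sq_eq`. -/
instance [NeZero n] : NormedAddCommGroup (HomSobolev n s) :=
  NormedAddCommGroup.induced _ _ (toL2 (n := n) (s := s)) toL2_injective

instance [NeZero n] : NormedSpace ℂ (HomSobolev n s) :=
  NormedSpace.induced ℂ _ _ (toL2 (n := n) (s := s))

theorem norm_eq [NeZero n] (f : HomSobolev n s) : ‖f‖ = ‖toL2 f‖ := rfl

theorem norm_sq_eq [NeZero n] (f : HomSobolev n s) :
    ‖f‖ ^ 2 = (2 * Real.pi) ^ (-(n : ℝ)) * ∫ ξ, ‖ξ‖ ^ (2 * s) * ‖fourier f ξ‖ ^ 2 :=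
  norm_toL2_sq f

end HomSobolev

/-! ### The restriction to the sphere -/

/-- `R` is the operator of restriction to `S^{n-1}`: a bounded linear operator from `Ḣ^s(ℝⁿ)` to
`L²(S^{n-1})` which maps every Schwartz function to its restriction. -/
def IsRestriction {n : ℕ} [NeZero n] {s : ℝ}
    (R : HomSobolev n s →L[ℂ] Lp ℂ 2 (surfaceMeasure n)) : Prop :=
  ∀ (φ : 𝓢(Eucl n, ℂ)) (f : HomSobolev n s),
    HomSobolev.toDistribution f = (φ : 𝓢'(Eucl n, ℂ)) →
      R f =ᵐ[surfaceMeasure n] fun θ => φ (θ : Eucl n)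

/-- The extremisers of `‖R f‖ ≤ ‖R‖ ‖f‖`, i.e. the nontrivial cases of equality. -/
def extremisers {V W : Type*} [NormedAddCommGroup V] [NormedSpace ℂ V] [NormedAddCommGroup W]
    [NormedSpace ℂ W] (R : V →L[ℂ] W) : Set V :=
  {f | f ≠ 0 ∧ ‖R f‖ = ‖R‖ * ‖f‖}

/-! ### Spherical harmonics and Bessel functions -/

/-- The Laplacian `∑ᵢ ∂ᵢ²` on complex polynomials in `n` variables. -/
def polyLaplacian {n : ℕ} (p : MvPolynomial (Fin n) ℂ) : MvPolynomial (Fin n) ℂ :=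
  ∑ i, MvPolynomial.pderiv i (MvPolynomial.pderiv i p)

/-- The space `H_k` of spherical harmonics of degree `k`: the restrictions to `S^{n-1}` of the
homogeneous harmonic polynomials of degree `k`. -/
def sphericalHarmonics (n k : ℕ) : Set (Sph n → ℂ) :=
  {Y | ∃ p : MvPolynomial (Fin n) ℂ, p.IsHomogeneous k ∧ polyLaplacian p = 0 ∧
    ∀ θ : Sph n, Y θ = MvPolynomial.eval (fun i => (((θ : Eucl n) i : ℝ) : ℂ)) p}

/-- The direction `ξ' = ξ / |ξ|` of a nonzero vector `ξ`. -/
def direction {n : ℕ} (ξ : Eucl n) (hξ : ξ ≠ 0) : Sph n :=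
  ⟨‖ξ‖⁻¹ • ξ, by simp [norm_smul, hξ]⟩

/-- The Bessel function of the first kind,
`J_ν(r) = ∑ₘ (-1)^m / (m! Γ(m + ν + 1)) (r/2)^{2m + ν}`, for `ν ≥ 0` and `r ≥ 0`. -/
def besselJ (ν r : ℝ) : ℝ :=
  ∑' m : ℕ, (-1) ^ m / ((m.factorial : ℝ) * Real.Gamma ((m : ℝ) + ν + 1)) *
    (r / 2) ^ (2 * (m : ℝ) + ν)

/-- The stability constant. -/
def stabilityConst (n : ℕ) (s : ℝ) : ℝ :=
  2 ^ (1 - 2 * s) * (Real.Gamma (2 * s - 1) / Real.Gamma s ^ 2) *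
    (Real.Gamma (((n : ℝ) - 2 * s) / 2) / Real.Gamma (((n : ℝ) + 2 * s - 2) / 2) -
      Real.Gamma (((n : ℝ) - 2 * s + 2) / 2) / Real.Gamma (((n : ℝ) + 2 * s) / 2))

end SphereTrace

end

open SphereTrace

/-!
The restriction to the sphere is studied through its adjoint. Plancherel's theorem identifies
`Ḣ^s(ℝⁿ)` with `L²(ℝⁿ)` by the isometry `U f = (2π)^{-n/2} |ξ|^s f̂` (`sobolevIsometry`); it is onto
because for `s < n/2` the function `|ξ|^{-s} G` is locally integrable for every `G ∈ L²`. Fourier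
inversion shows that the restriction operator is `R = T† U`, where
`T h = (2π)^{-n/2} |ξ|^{-s} ĥdσ` is the extension operator from `L²(S^{n-1})` to `L²(ℝⁿ)`
(`extensionOp`, `isRestriction_restrictionOp`). It is the only one since the Schwartz functions are
dense (`IsRestriction.unique`).

The operator `T† T` is diagonal in spherical harmonics, with the eigenvalue
`λ_m = traceEigenvalue n s m` in degree `m`. To see this, `|ξ|^{-2s}` is written as a superposition
of Gaussians, so that `‖T h‖²` becomes a superposition over `u > 0` of the quadratic forms with
the kernels `e^{-|θ - ω|² / 4u}`. Expanded in powers of `θ · ω`, these are sums of the forms with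
the kernels `(θ · ω)^j`. The moments of the surface measure show that such a form acts on
polynomials of degree `m` as a scalar up to polynomials of lower degree; being Hermitian, it is diagonal
(`powerForm_self`). The resulting series for `λ_m` is a hypergeometric series at `1`, and Gauss's
summation evaluates it (`tsum_rieszCoeff_mul_powerEigenvalue`). All terms are nonnegative, so no
convergence question arises, and only Bessel's inequality for the decomposition into harmonics is
used, not its completeness.

The eigenvalues are strictly decreasing in `m`, and `λ_0 - λ_1` is the stability constant. Hence
`‖R‖² = λ_0`, the extremisers are the nonzero `f` with `U f ∈ T H_0`, and if
`U f = T p₀ + T p₁ + G` is the orthogonal decomposition with `p₀ ∈ H_0`, `p₁ ∈ H_1`, then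
`‖R‖² ‖f‖² - ‖R f‖² ≥ (λ_0 - λ_1) ‖T p₁‖² + (λ_0 - λ_2) ‖G‖²`, while the squared distance to the
extremisers is `‖T p₁‖² + ‖G‖²` (`HasTopLevels.stability`). So equality holds exactly for
`U f ∈ T (H_0 + H_1)`. By the Bochner-Hecke formula (`sphereFourier_eq_besselJ`), which follows from
the same moments by comparison of power series, these are the `f` given by the Bessel functions of
orders `(n-2)/2` and `n/2`.
-/

namespace SphereTrace

/-! ### Stability at the top of the spectrum of an operator -/

section Abstract

open scoped InnerProductSpace

variable {X Y : Type*} [NormedAddCommGroup X] [InnerProductSpace ℂ X]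
  [NormedAddCommGroup Y] [InnerProductSpace ℂ Y]

theorem norm_add_smul_sq (a b : X) (w : ℂ) (t : ℝ) :
    ‖a + ((t : ℂ) * w) • b‖ ^ 2 =
      ‖a‖ ^ 2 + 2 * t * ((starRingEnd ℂ w) * ⟪b, a⟫_ℂ).re + t ^ 2 * ‖w‖ ^ 2 * ‖b‖ ^ 2 := by
  rw [@norm_add_sq ℂ, ← inner_conj_symm, inner_smul_left, norm_smul, norm_mul]
  simp only [map_mul, Complex.conj_ofReal, Complex.norm_real, Real.norm_eq_abs, mul_pow, sq_abs]
  simp only [RCLike.re_eq_complex_re, Complex.mul_re, Complex.mul_im, Complex.conj_re,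
    Complex.conj_im, Complex.ofReal_re, Complex.ofReal_im]
  ring

theorem norm_add_sq_of_inner_eq_zero {x y : X} (hxy : ⟪x, y⟫_ℂ = 0) :
    ‖x + y‖ ^ 2 = ‖x‖ ^ 2 + ‖y‖ ^ 2 := by
  have := norm_add_sq_eq_norm_sq_add_norm_sq_of_inner_eq_zero x y hxy
  simpa [sq] using this

/-- A vector at which the quadratic form `h ↦ ‖T h‖ ^ 2` attains its bound `c * ‖h‖ ^ 2` on a
subspace `K` is an eigenvector of the compression of `T† T` to `K`. -/
theorem inner_map_map_of_norm_sq_le (T : X →L[ℂ] Y) {K : Submodule ℂ X} {c : ℝ}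
    (hK : ∀ h ∈ K, ‖T h‖ ^ 2 ≤ c * ‖h‖ ^ 2) {h : X} (hh : h ∈ K)
    (heq : ‖T h‖ ^ 2 = c * ‖h‖ ^ 2) {g : X} (hg : g ∈ K) :
    ⟪T g, T h⟫_ℂ = c * ⟪g, h⟫_ℂ := by
  set w : ℂ := ⟪T g, T h⟫_ℂ - c * ⟪g, h⟫_ℂ with hw
  suffices w = 0 by exact sub_eq_zero.mp this
  -- the bound at `h + t w g`, in which the terms of order zero in `t` cancel
  have key : ∀ t : ℝ, 0 ≤ -2 * t * ‖w‖ ^ 2 + t ^ 2 * (‖w‖ ^ 2 * (c * ‖g‖ ^ 2 - ‖T g‖ ^ 2)) := by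
    intro t
    have h1 := hK (h + ((t : ℂ) * w) • g) (K.add_mem hh (K.smul_mem _ hg))
    rw [map_add, map_smul, norm_add_smul_sq, norm_add_smul_sq, heq] at h1
    have e2 : ((starRingEnd ℂ w) * ⟪T g, T h⟫_ℂ).re = ‖w‖ ^ 2
        + c * ((starRingEnd ℂ w) * ⟪g, h⟫_ℂ).re := by
      have : ⟪T g, T h⟫_ℂ = w + c * ⟪g, h⟫_ℂ := by rw [hw]; ring
      rw [this, mul_add, Complex.add_re, mul_comm _ w, Complex.mul_conj, Complex.ofReal_re,
        Complex.normSq_eq_norm_sq, mul_left_comm, Complex.re_ofReal_mul]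
    rw [e2] at h1
    nlinarith [h1]
  by_contra hne
  have hpos : 0 < ‖w‖ ^ 2 := by positivity
  -- for small `t > 0` the linear term would prevail
  set D := c * ‖g‖ ^ 2 - ‖T g‖ ^ 2 with hD
  have hD0 : 0 ≤ D := sub_nonneg.mpr (hK g hg)
  have h2 := key (1 / (D + 1))
  have h3 : -2 * (1 / (D + 1)) * ‖w‖ ^ 2 + (1 / (D + 1)) ^ 2 * (‖w‖ ^ 2 * D)
      = - ‖w‖ ^ 2 * (D + 2) / (D + 1) ^ 2 := by field_simp; ring
  rw [h3] at h2
  have : 0 < ‖w‖ ^ 2 * (D + 2) / (D + 1) ^ 2 := by positivity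
  have h4 : - ‖w‖ ^ 2 * (D + 2) / (D + 1) ^ 2 = - (‖w‖ ^ 2 * (D + 2) / (D + 1) ^ 2) := by ring
  linarith

/-- The first two levels of `T† T`: it is at most `c₀`, with equality on `E₀`; on the orthogonal
complement of `E₀` it is at most `c₁ < c₀`, with equality on `E₁`; on the complement of both it is
at most `c₂ < c₁`. -/
structure HasTopLevels (T : X →L[ℂ] Y) (E₀ E₁ : Submodule ℂ X) (c₀ c₁ c₂ : ℝ) : Prop where
  le_zero : ∀ h, ‖T h‖ ^ 2 ≤ c₀ * ‖h‖ ^ 2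
  eq_zero : ∀ h ∈ E₀, ‖T h‖ ^ 2 = c₀ * ‖h‖ ^ 2
  le_one : ∀ h ∈ E₀ᗮ, ‖T h‖ ^ 2 ≤ c₁ * ‖h‖ ^ 2
  eq_one : ∀ h ∈ E₁, ‖T h‖ ^ 2 = c₁ * ‖h‖ ^ 2
  le_two : ∀ h ∈ (E₀ ⊔ E₁)ᗮ, ‖T h‖ ^ 2 ≤ c₂ * ‖h‖ ^ 2
  le_orthogonal : E₁ ≤ E₀ᗮ
  nonneg : 0 ≤ c₂
  two_lt : c₂ < c₁
  one_lt : c₁ < c₀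

namespace HasTopLevels

variable {T : X →L[ℂ] Y} {E₀ E₁ : Submodule ℂ X} {c₀ c₁ c₂ : ℝ}

theorem inner_zero (hT : HasTopLevels T E₀ E₁ c₀ c₁ c₂) {h : X} (hh : h ∈ E₀) (g : X) :
    ⟪T g, T h⟫_ℂ = c₀ * ⟪g, h⟫_ℂ :=
  inner_map_map_of_norm_sq_le T (K := ⊤) (fun h _ => hT.le_zero h) trivial (hT.eq_zero h hh) trivial

theorem inner_one [E₀.HasOrthogonalProjection] (hT : HasTopLevels T E₀ E₁ c₀ c₁ c₂) {h : X}
    (hh : h ∈ E₁) (g : X) : ⟪T g, T h⟫_ℂ = c₁ * ⟪g, h⟫_ℂ := by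
  obtain ⟨a, ha, b, hb, rfl⟩ := E₀.exists_add_mem_mem_orthogonal g
  have h1 := inner_map_map_of_norm_sq_le T hT.le_one (hT.le_orthogonal hh) (hT.eq_one h hh) hb
  have h0 : ⟪a, h⟫_ℂ = 0 := hT.le_orthogonal hh a ha
  have h2 : ⟪T a, T h⟫_ℂ = 0 := by
    rw [← inner_conj_symm, hT.inner_zero ha, ← inner_conj_symm, h0]; simp
  rw [map_add, inner_add_left, h1, h2, inner_add_left, h0]; ring

theorem inner_one_zero [E₀.HasOrthogonalProjection] (hT : HasTopLevels T E₀ E₁ c₀ c₁ c₂)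
    {p q : X} (hp : p ∈ E₁) (hq : q ∈ E₀) : ⟪T q, T p⟫_ℂ = 0 := by
  rw [hT.inner_one hp, hT.le_orthogonal hp q hq, mul_zero]

variable [CompleteSpace X] [CompleteSpace Y]

theorem adjoint_map_zero (hT : HasTopLevels T E₀ E₁ c₀ c₁ c₂) {h : X} (hh : h ∈ E₀) :
    T.adjoint (T h) = (c₀ : ℂ) • h :=
  ext_inner_left ℂ fun g => by
    rw [ContinuousLinearMap.adjoint_inner_right, hT.inner_zero hh, inner_smul_right]

theorem adjoint_map_one [E₀.HasOrthogonalProjection] (hT : HasTopLevels T E₀ E₁ c₀ c₁ c₂)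
    {h : X} (hh : h ∈ E₁) : T.adjoint (T h) = (c₁ : ℂ) • h :=
  ext_inner_left ℂ fun g => by
    rw [ContinuousLinearMap.adjoint_inner_right, hT.inner_one hh, inner_smul_right]

variable [FiniteDimensional ℂ E₀] [FiniteDimensional ℂ E₁]

/-- Every vector of `Y` splits orthogonally into `T p₀ + T p₁ + G` with `p₀ ∈ E₀`, `p₁ ∈ E₁`,
and the three parts of its image under `T†` are orthogonal as well. -/
theorem exists_decomposition (hT : HasTopLevels T E₀ E₁ c₀ c₁ c₂) (F : Y) :
    ∃ p₀ ∈ E₀, ∃ p₁ ∈ E₁, ∃ G : Y, F = T p₀ + T p₁ + G ∧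
      (∀ q ∈ E₀, ⟪T q, T p₁ + G⟫_ℂ = 0) ∧
      ‖T p₁ + G‖ ^ 2 = c₁ * ‖p₁‖ ^ 2 + ‖G‖ ^ 2 ∧
      ‖F‖ ^ 2 = c₀ * ‖p₀‖ ^ 2 + c₁ * ‖p₁‖ ^ 2 + ‖G‖ ^ 2 ∧
      ‖T.adjoint F‖ ^ 2 = c₀ ^ 2 * ‖p₀‖ ^ 2 + c₁ ^ 2 * ‖p₁‖ ^ 2 + ‖T.adjoint G‖ ^ 2 ∧
      ‖T.adjoint G‖ ^ 2 ≤ c₂ * ‖G‖ ^ 2 := by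
  obtain ⟨a, ha, G, hG, hF⟩ :=
    ((E₀ ⊔ E₁).map T.toLinearMap).exists_add_mem_mem_orthogonal F
  obtain ⟨p, hp, rfl⟩ := ha
  obtain ⟨p₀, hp₀, p₁, hp₁, rfl⟩ := Submodule.mem_sup.mp hp
  have hGq : ∀ q ∈ E₀ ⊔ E₁, ⟪T q, G⟫_ℂ = 0 := fun q hq => hG _ ⟨q, hq, rfl⟩
  have h01 : ⟪T p₀, T p₁⟫_ℂ = 0 := hT.inner_one_zero hp₁ hp₀
  have h0G : ⟪T p₀, G⟫_ℂ = 0 := hGq _ (Submodule.mem_sup_left hp₀)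
  have h1G : ⟪T p₁, G⟫_ℂ = 0 := hGq _ (Submodule.mem_sup_right hp₁)
  have hTG : T.adjoint G ∈ (E₀ ⊔ E₁)ᗮ := fun q hq => by
    rw [ContinuousLinearMap.adjoint_inner_right]; exact hGq q hq
  refine ⟨p₀, hp₀, p₁, hp₁, G, ?_, ?_, ?_, ?_, ?_, ?_⟩
  · rw [hF]; simp
  · intro q hq
    rw [inner_add_right, hT.inner_one_zero hp₁ hq, hGq q (Submodule.mem_sup_left hq), add_zero]
  · rw [norm_add_sq_of_inner_eq_zero h1G, hT.eq_one _ hp₁]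
  · have : F = T p₀ + (T p₁ + G) := by rw [hF]; simp [add_assoc]
    rw [this, norm_add_sq_of_inner_eq_zero, norm_add_sq_of_inner_eq_zero h1G, hT.eq_one _ hp₁,
      hT.eq_zero _ hp₀, add_assoc]
    rw [inner_add_right, h01, h0G, add_zero]
  · have : T.adjoint F = (c₀ : ℂ) • p₀ + ((c₁ : ℂ) • p₁ + T.adjoint G) := by
      rw [hF]
      simp [hT.adjoint_map_zero hp₀, hT.adjoint_map_one hp₁, add_assoc]
    have o1 : ⟪p₁, T.adjoint G⟫_ℂ = 0 := hTG _ (Submodule.mem_sup_right hp₁)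
    have o0 : ⟪p₀, T.adjoint G⟫_ℂ = 0 := hTG _ (Submodule.mem_sup_left hp₀)
    have o01 : ⟪p₀, p₁⟫_ℂ = 0 := hT.le_orthogonal hp₁ _ hp₀
    rw [this, norm_add_sq_of_inner_eq_zero, norm_add_sq_of_inner_eq_zero, norm_smul, norm_smul]
    · simp only [Complex.norm_real, Real.norm_eq_abs, mul_pow, sq_abs]; ring
    · rw [inner_smul_left, o1, mul_zero]
    · rw [inner_smul_left, inner_add_right, inner_smul_right, o0, o01]; simp
  · -- `‖T† G‖² = ⟪G, T T† G⟫ ≤ ‖G‖ ‖T T† G‖`, and `T† G` is orthogonal to `E₀ ⊔ E₁`.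
    have h1 := hT.le_two _ hTG
    have h2 : ‖T.adjoint G‖ ^ 2 ≤ ‖G‖ * ‖T (T.adjoint G)‖ := by
      have : ((‖T.adjoint G‖ : ℂ)) ^ 2 = ⟪G, T (T.adjoint G)⟫_ℂ := by
        rw [← ContinuousLinearMap.adjoint_inner_left, inner_self_eq_norm_sq_to_K]; simp
      have h3 := norm_inner_le_norm (𝕜 := ℂ) G (T (T.adjoint G))
      rw [← this] at h3
      simpa using h3
    rcases (norm_nonneg (T.adjoint G)).eq_or_lt with h0 | h0
    · rw [← h0]
      have := hT.nonneg
      simp only [ne_eq, OfNat.ofNat_ne_zero, not_false_eq_true, zero_pow]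
      positivity
    · have h4 : (‖T.adjoint G‖ ^ 2) ^ 2 ≤ ‖G‖ ^ 2 * (c₂ * ‖T.adjoint G‖ ^ 2) := by
        calc (‖T.adjoint G‖ ^ 2) ^ 2 ≤ (‖G‖ * ‖T (T.adjoint G)‖) ^ 2 := by gcongr
          _ = ‖G‖ ^ 2 * ‖T (T.adjoint G)‖ ^ 2 := by ring
          _ ≤ _ := by gcongr
      have h5 : 0 < ‖T.adjoint G‖ ^ 2 := by positivity
      nlinarith

variable {H : Type*} [NormedAddCommGroup H] [NormedSpace ℂ H]

theorem norm_sq_eq (hT : HasTopLevels T E₀ E₁ c₀ c₁ c₂) (hE₀ : E₀ ≠ ⊥)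
    (U : H ≃ₗᵢ[ℂ] Y) {R : H →L[ℂ] X} (hR : ∀ f, R f = T.adjoint (U f)) : ‖R‖ ^ 2 = c₀ := by
  have hc₁ : 0 < c₁ := hT.nonneg.trans_lt hT.two_lt
  have hc₀ : 0 < c₀ := hc₁.trans hT.one_lt
  have hle : ∀ f, ‖R f‖ ^ 2 ≤ c₀ * ‖f‖ ^ 2 := by
    intro f
    obtain ⟨p₀, -, p₁, -, G, -, -, -, hF, hA, hG⟩ := hT.exists_decomposition (U f)
    rw [U.norm_map] at hF
    rw [hR, hA, hF]
    have h1 := hT.one_lt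
    have h2 := hT.two_lt
    nlinarith [mul_nonneg (mul_nonneg hc₁.le (sub_nonneg.mpr h1.le)) (sq_nonneg ‖p₁‖),
      mul_nonneg (sub_nonneg.mpr (h2.trans h1).le) (sq_nonneg ‖G‖)]
  have hR1 : ‖R‖ ≤ √c₀ := by
    refine R.opNorm_le_bound (Real.sqrt_nonneg _) fun f => ?_
    rw [← Real.sqrt_sq (norm_nonneg (R f)), ← Real.sqrt_sq (norm_nonneg f), ← Real.sqrt_mul hc₀.le]
    exact Real.sqrt_le_sqrt (by simpa using hle f)
  obtain ⟨e, he, hne⟩ := Submodule.exists_mem_ne_zero_of_ne_bot hE₀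
  have hR2 : √c₀ ≤ ‖R‖ := by
    have h1 := R.le_opNorm (U.symm (T e))
    rw [hR, U.apply_symm_apply, U.symm.norm_map, hT.adjoint_map_zero he, norm_smul,
      Complex.norm_real, Real.norm_of_nonneg hc₀.le] at h1
    have h2 : ‖T e‖ = √c₀ * ‖e‖ := by
      rw [← Real.sqrt_sq (norm_nonneg (T e)), hT.eq_zero e he, Real.sqrt_mul hc₀.le,
        Real.sqrt_sq (norm_nonneg _)]
    rw [h2] at h1
    have h3 : 0 < ‖e‖ := norm_pos_iff.mpr hne
    have h4 : 0 < √c₀ := Real.sqrt_pos.mpr hc₀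
    have h5 : √c₀ * √c₀ = c₀ := Real.mul_self_sqrt hc₀.le
    have : (√c₀ * ‖e‖) * √c₀ ≤ (√c₀ * ‖e‖) * ‖R‖ := by nlinarith
    exact le_of_mul_le_mul_left this (by positivity)
  rw [le_antisymm hR1 hR2, Real.sq_sqrt hc₀.le]

/-- The extremisers are the nonzero elements of the subspace corresponding to `T E₀`. -/
theorem mem_extremisers_iff (hT : HasTopLevels T E₀ E₁ c₀ c₁ c₂) (hE₀ : E₀ ≠ ⊥)
    (U : H ≃ₗᵢ[ℂ] Y) {R : H →L[ℂ] X} (hR : ∀ f, R f = T.adjoint (U f)) (f : H) :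
    f ∈ extremisers R ↔ f ≠ 0 ∧ ∃ p ∈ E₀, U f = T p := by
  have hc₁ : 0 < c₁ := hT.nonneg.trans_lt hT.two_lt
  have hc₀ : 0 < c₀ := hc₁.trans hT.one_lt
  have h1 := hT.one_lt
  have h2 := hT.two_lt
  refine and_congr_right fun _ => ?_
  rw [← sq_eq_sq₀ (norm_nonneg _) (by positivity), mul_pow, hT.norm_sq_eq hE₀ U hR]
  constructor
  · intro heq
    obtain ⟨p₀, hp₀, p₁, -, G, hf, -, hn, hF, hA, hG⟩ := hT.exists_decomposition (U f)
    rw [U.norm_map] at hF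
    rw [hR, hA, hF] at heq
    have hp : 0 ≤ c₁ * ‖p₁‖ ^ 2 := by positivity
    have h3 : c₁ * (c₀ - c₁) * ‖p₁‖ ^ 2 + (c₀ - c₂) * ‖G‖ ^ 2 ≤ 0 := by nlinarith
    have h4 : 0 ≤ c₁ * (c₀ - c₁) * ‖p₁‖ ^ 2 :=
      mul_nonneg (mul_nonneg hc₁.le (sub_nonneg.mpr h1.le)) (sq_nonneg _)
    have h5 : 0 ≤ (c₀ - c₂) * ‖G‖ ^ 2 :=
      mul_nonneg (sub_nonneg.mpr (h2.trans h1).le) (sq_nonneg _)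
    have h6 : ‖p₁‖ ^ 2 = 0 := by
      have : c₁ * (c₀ - c₁) * ‖p₁‖ ^ 2 = 0 := by linarith
      exact (mul_eq_zero.mp this).resolve_left (mul_pos hc₁ (sub_pos.mpr h1)).ne'
    have h7 : ‖G‖ ^ 2 = 0 := by
      have : (c₀ - c₂) * ‖G‖ ^ 2 = 0 := by linarith
      exact (mul_eq_zero.mp this).resolve_left (sub_pos.mpr (h2.trans h1)).ne'
    have h8 : T p₁ + G = 0 := by
      rw [← norm_eq_zero, ← sq_eq_zero_iff, hn, h6, h7]; simp
    exact ⟨p₀, hp₀, by rw [hf, add_assoc, h8, add_zero]⟩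
  · rintro ⟨p, hp, hf⟩
    rw [hR, ← U.norm_map f, hf, hT.adjoint_map_zero hp, norm_smul, hT.eq_zero p hp,
      Complex.norm_real, Real.norm_of_nonneg hc₀.le]
    ring

/-- The squared distance to the set of extremisers is the squared distance to the subspace
`T E₀`: removing the origin from this subspace does not change the infimum. -/
theorem iInf_extremisers (hT : HasTopLevels T E₀ E₁ c₀ c₁ c₂) (hE₀ : E₀ ≠ ⊥)
    (U : H ≃ₗᵢ[ℂ] Y) {R : H →L[ℂ] X} (hR : ∀ f, R f = T.adjoint (U f)) {f : H}
    {p₀ : X} (hp₀ : p₀ ∈ E₀) {F' : Y} (hf : U f = T p₀ + F')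
    (hF' : ∀ q ∈ E₀, ⟪T q, F'⟫_ℂ = 0) :
    ⨅ g : extremisers R, ‖f - (g : H)‖ ^ 2 = ‖F'‖ ^ 2 := by
  have hc₁ : 0 < c₁ := hT.nonneg.trans_lt hT.two_lt
  have hc₀ : 0 < c₀ := hc₁.trans hT.one_lt
  have hdist : ∀ (g : H) (q : X), q ∈ E₀ → U g = T q →
      ‖f - g‖ ^ 2 = c₀ * ‖p₀ - q‖ ^ 2 + ‖F'‖ ^ 2 := by
    intro g q hq hg
    have h1 : U (f - g) = T (p₀ - q) + F' := by rw [map_sub, hf, hg, map_sub]; abel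
    have h2 := norm_add_sq_eq_norm_sq_add_norm_sq_of_inner_eq_zero _ _ (hF' _ (E₀.sub_mem hp₀ hq))
    rw [← U.norm_map, h1, sq, h2, ← sq, ← sq, hT.eq_zero _ (E₀.sub_mem hp₀ hq)]
  have hmk : ∀ q ∈ E₀, q ≠ 0 → U.symm (T q) ∈ extremisers R := by
    intro q hq hne
    rw [hT.mem_extremisers_iff hE₀ U hR]
    refine ⟨fun h0 => ?_, q, hq, U.apply_symm_apply _⟩
    have h1 : T q = 0 := by simpa using h0
    have h2 := hT.eq_zero q hq
    rw [h1, norm_zero] at h2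
    have : 0 < c₀ * ‖q‖ ^ 2 := by
      have := norm_pos_iff.mpr hne
      positivity
    simp at h2
    rcases h2 with h2 | h2
    · exact hc₀.ne' h2
    · exact hne h2
  obtain ⟨e, he, hne⟩ := Submodule.exists_mem_ne_zero_of_ne_bot hE₀
  have : Nonempty (extremisers R) := ⟨⟨_, hmk e he hne⟩⟩
  have hbdd : BddBelow (Set.range fun g : extremisers R => ‖f - (g : H)‖ ^ 2) :=
    ⟨0, by rintro _ ⟨g, rfl⟩; positivity⟩
  apply le_antisymm
  · refine le_of_forall_pos_le_add fun ε hε => ?_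
    obtain ⟨q, hq, hq0, hqe⟩ : ∃ q ∈ E₀, q ≠ 0 ∧ c₀ * ‖p₀ - q‖ ^ 2 ≤ ε := by
      by_cases h0 : p₀ = 0
      · have he' : 0 < ‖e‖ := norm_pos_iff.mpr hne
        set t : ℝ := √(ε / c₀) / ‖e‖ with ht
        have ht0 : 0 < t := by positivity
        refine ⟨(t : ℂ) • e, E₀.smul_mem _ he, smul_ne_zero (by exact_mod_cast ht0.ne') hne, ?_⟩
        rw [h0, zero_sub, norm_neg, norm_smul, Complex.norm_real, Real.norm_of_nonneg ht0.le, ht,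
          div_mul_cancel₀ _ he'.ne', Real.sq_sqrt (by positivity), mul_div_cancel₀ _ hc₀.ne']
      · exact ⟨p₀, hp₀, h0, by simp [hε.le]⟩
    refine (ciInf_le hbdd ⟨_, hmk q hq hq0⟩).trans ?_
    rw [hdist _ q hq (U.apply_symm_apply _)]
    linarith
  · refine le_ciInf fun g => ?_
    obtain ⟨-, q, hq, hg⟩ := (hT.mem_extremisers_iff hE₀ U hR _).mp g.2
    rw [hdist _ q hq hg]
    have : 0 ≤ c₀ * ‖p₀ - q‖ ^ 2 := by positivity
    linarith

/-- The sharp stability of the inequality `‖R f‖ ≤ ‖R‖ ‖f‖` for `R = T† U`. The orthogonal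
decomposition of `U f` into its parts in `T E₀`, in `T E₁` and the rest reduces it to
`c₂ < c₁ < c₀`. -/
theorem stability (hT : HasTopLevels T E₀ E₁ c₀ c₁ c₂) (hE₀ : E₀ ≠ ⊥) (hE₁ : E₁ ≠ ⊥)
    (U : H ≃ₗᵢ[ℂ] Y) {R : H →L[ℂ] X} (hR : ∀ f, R f = T.adjoint (U f)) :
    (extremisers R).Nonempty ∧
    (∀ f, ‖R‖ ^ 2 * ‖f‖ ^ 2 - ‖R f‖ ^ 2 ≥
      (c₀ - c₁) * ⨅ g : extremisers R, ‖f - (g : H)‖ ^ 2) ∧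
    (∀ C : ℝ, (∀ f, ‖R‖ ^ 2 * ‖f‖ ^ 2 - ‖R f‖ ^ 2 ≥
      C * ⨅ g : extremisers R, ‖f - (g : H)‖ ^ 2) → C ≤ c₀ - c₁) ∧
    (∀ f, ‖R‖ ^ 2 * ‖f‖ ^ 2 - ‖R f‖ ^ 2 =
      (c₀ - c₁) * ⨅ g : extremisers R, ‖f - (g : H)‖ ^ 2 ↔
      ∃ p₀ ∈ E₀, ∃ p₁ ∈ E₁, U f = T (p₀ + p₁)) := by
  have hc₁ : 0 < c₁ := hT.nonneg.trans_lt hT.two_lt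
  have hc₀ : 0 < c₀ := hc₁.trans hT.one_lt
  have h1 := hT.one_lt
  have h2 := hT.two_lt
  have htwo : ∀ f p₀ p₁, p₀ ∈ E₀ → p₁ ∈ E₁ → U f = T (p₀ + p₁) →
      ‖R‖ ^ 2 * ‖f‖ ^ 2 - ‖R f‖ ^ 2 = (c₀ - c₁) * (c₁ * ‖p₁‖ ^ 2) ∧
      ⨅ g : extremisers R, ‖f - (g : H)‖ ^ 2 = c₁ * ‖p₁‖ ^ 2 := by
    intro f p₀ p₁ hp₀ hp₁ hf
    have o01 : ⟪p₀, p₁⟫_ℂ = 0 := hT.le_orthogonal hp₁ _ hp₀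
    rw [map_add] at hf
    rw [hT.iInf_extremisers hE₀ U hR hp₀ hf (fun q hq => hT.inner_one_zero hp₁ hq),
      hT.eq_one _ hp₁, hT.norm_sq_eq hE₀ U hR, ← U.norm_map f, hR, hf, map_add,
      hT.adjoint_map_zero hp₀, hT.adjoint_map_one hp₁]
    have e1 := norm_add_sq_eq_norm_sq_add_norm_sq_of_inner_eq_zero _ _ (hT.inner_one_zero hp₁ hp₀)
    have e2 := norm_add_sq_eq_norm_sq_add_norm_sq_of_inner_eq_zero ((c₀ : ℂ) • p₀) ((c₁ : ℂ) • p₁)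
      (by rw [inner_smul_left, inner_smul_right, o01]; simp)
    simp only [← sq] at e1 e2
    rw [e1, e2, hT.eq_one _ hp₁, hT.eq_zero _ hp₀, norm_smul, norm_smul, Complex.norm_real,
      Complex.norm_real, Real.norm_of_nonneg hc₀.le, Real.norm_of_nonneg hc₁.le]
    exact ⟨by ring, rfl⟩
  have hgen : ∀ f, ∃ p₀ ∈ E₀, ∃ p₁ ∈ E₁, ∃ G : Y, U f = T (p₀ + p₁) + G ∧
      (c₀ - c₁) * (⨅ g : extremisers R, ‖f - (g : H)‖ ^ 2) + (c₁ - c₂) * ‖G‖ ^ 2 ≤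
      ‖R‖ ^ 2 * ‖f‖ ^ 2 - ‖R f‖ ^ 2 := by
    intro f
    obtain ⟨p₀, hp₀, p₁, hp₁, G, hf, ho, hn, hF, hA, hG⟩ := hT.exists_decomposition (U f)
    refine ⟨p₀, hp₀, p₁, hp₁, G, by rw [hf, map_add], ?_⟩
    rw [hT.iInf_extremisers hE₀ U hR hp₀ (hf.trans (add_assoc _ _ _)) ho, hn,
      hT.norm_sq_eq hE₀ U hR, ← U.norm_map f, hF, hR, hA]
    nlinarith
  refine ⟨?_, fun f => ?_, fun C hC => ?_, fun f => ⟨fun heq => ?_, ?_⟩⟩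
  · obtain ⟨e, he, hne⟩ := Submodule.exists_mem_ne_zero_of_ne_bot hE₀
    refine ⟨U.symm (T e), (hT.mem_extremisers_iff hE₀ U hR _).mpr
      ⟨fun h0 => hne ?_, e, he, U.apply_symm_apply _⟩⟩
    have h3 := hT.eq_zero e he
    rw [show T e = 0 by simpa using h0] at h3
    simpa [hc₀.ne'] using h3
  · obtain ⟨p₀, -, p₁, -, G, -, h⟩ := hgen f
    have : 0 ≤ (c₁ - c₂) * ‖G‖ ^ 2 := mul_nonneg (sub_nonneg.mpr h2.le) (sq_nonneg _)
    linarith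
  · -- on `T E₁` the inequality with the constant `c₀ - c₁` is an equality between nonzero numbers
    obtain ⟨e, he, hne⟩ := Submodule.exists_mem_ne_zero_of_ne_bot hE₁
    obtain ⟨h3, h4⟩ := htwo (U.symm (T e)) 0 e E₀.zero_mem he (by simp)
    have h5 := hC (U.symm (T e))
    rw [h3, h4] at h5
    have : 0 < c₁ * ‖e‖ ^ 2 := by
      have := norm_pos_iff.mpr hne
      positivity
    exact le_of_mul_le_mul_right h5 this
  · obtain ⟨p₀, hp₀, p₁, hp₁, G, hf, h⟩ := hgen f
    have h3 : (c₁ - c₂) * ‖G‖ ^ 2 ≤ 0 := by linarith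
    have h4 : ‖G‖ ^ 2 ≤ 0 := nonpos_of_mul_nonpos_right h3 (sub_pos.mpr h2)
    have h5 : G = 0 := by
      have : ‖G‖ ^ 2 = 0 := le_antisymm h4 (sq_nonneg _)
      simpa using this
    exact ⟨p₀, hp₀, p₁, hp₁, by rw [hf, h5, add_zero]⟩
  · rintro ⟨p₀, hp₀, p₁, hp₁, hf⟩
    obtain ⟨h3, h4⟩ := htwo f p₀ p₁ hp₀ hp₁ hf
    rw [h3, h4]

end HasTopLevels

end Abstract

/-! ### The eigenvalues as sums of Gamma quotients -/

theorem lintegral_rpow_mul_exp_neg_mul {p r : ℝ} (hp : 0 < p) (hr : 0 < r) :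
    ∫⁻ v in Set.Ioi (0 : ℝ), ENNReal.ofReal (v ^ (p - 1) * Real.exp (-(r * v))) =
      ENNReal.ofReal (r ^ (-p) * Real.Gamma p) := by
  have h := Real.integral_rpow_mul_exp_neg_mul_Ioi hp hr
  have hi : Integrable (fun v => v ^ (p - 1) * Real.exp (-(r * v)))
      (volume.restrict (Set.Ioi (0 : ℝ))) := by
    have := integrableOn_rpow_mul_exp_neg_mul_rpow (p := 1) (s := p - 1) (by linarith) one_pos hr
    simpa [IntegrableOn] using this
  rw [← ofReal_integral_eq_lintegral_ofReal hi, h, one_div, Real.inv_rpow hr.le,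
    Real.rpow_neg hr.le]
  filter_upwards [ae_restrict_mem measurableSet_Ioi] with v hv
  have : 0 < v := hv
  positivity

theorem tsum_ofReal_pow_div_factorial {x : ℝ} (hx : 0 ≤ x) :
    ∑' i : ℕ, ENNReal.ofReal (x ^ i / (i.factorial : ℝ)) = ENNReal.ofReal (Real.exp x) := by
  have h := NormedSpace.expSeries_div_hasSum_exp x
  rw [← Real.exp_eq_exp_ℝ] at h
  rw [← ENNReal.ofReal_tsum_of_nonneg (fun i => by positivity) h.summable, h.tsum_eq]

/-- The binomial series, with the coefficients written as Gamma integrals. -/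
theorem tsum_Gamma_add_mul_pow {α t : ℝ} (hα : 0 < α) (ht : 0 ≤ t) (ht' : t < 1) :
    ∑' i : ℕ, ENNReal.ofReal (Real.Gamma (α + i) / (i.factorial : ℝ) * t ^ i) =
      ENNReal.ofReal (Real.Gamma α * (1 - t) ^ (-α)) := by
  have h1 : ∀ i : ℕ, ENNReal.ofReal (Real.Gamma (α + i) / (i.factorial : ℝ) * t ^ i) =
      ∫⁻ v in Set.Ioi (0 : ℝ), ENNReal.ofReal (v ^ (α - 1) * Real.exp (-v)) *
        ENNReal.ofReal ((t * v) ^ i / (i.factorial : ℝ)) := by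
    intro i
    have h2 := lintegral_rpow_mul_exp_neg_mul (p := α + i) (r := 1) (by positivity) one_pos
    rw [Real.one_rpow, one_mul] at h2
    have : Real.Gamma (α + i) / (i.factorial : ℝ) * t ^ i =
      (t ^ i / (i.factorial : ℝ)) * Real.Gamma (α + i) := by ring
    rw [this, ENNReal.ofReal_mul (by positivity), ← h2, ← lintegral_const_mul' _ _ (by simp)]
    refine setLIntegral_congr_fun measurableSet_Ioi fun v hv => ?_
    have hv : 0 < v := hv
    rw [← ENNReal.ofReal_mul (by positivity), ← ENNReal.ofReal_mul (by positivity), one_mul,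
      show α + i - 1 = (α - 1) + i by ring, Real.rpow_add hv, Real.rpow_natCast, mul_pow]
    congr 1
    ring
  simp_rw [h1]
  rw [← lintegral_tsum (fun i => by fun_prop)]
  rw [mul_comm, ← lintegral_rpow_mul_exp_neg_mul hα (sub_pos.mpr ht')]
  refine setLIntegral_congr_fun measurableSet_Ioi fun v hv => ?_
  have hv : 0 < v := hv
  rw [ENNReal.tsum_mul_left, tsum_ofReal_pow_div_factorial (by positivity),
    ← ENNReal.ofReal_mul (by positivity), mul_assoc, ← Real.exp_add]
  congr 3
  ring

theorem lintegral_rpow_mul_one_sub_rpow {α β : ℝ} (hα : 0 < α) (hβ : 0 < β) :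
    ∫⁻ t in Set.Ioo (0 : ℝ) 1, ENNReal.ofReal (t ^ (α - 1) * (1 - t) ^ (β - 1)) =
      ENNReal.ofReal (ProbabilityTheory.beta α β) := by
  have h := ProbabilityTheory.lintegral_betaPDF_eq_one hα hβ
  have hb := ProbabilityTheory.beta_pos hα hβ
  rw [ProbabilityTheory.lintegral_betaPDF] at h
  have h1 : ∀ t : ℝ, ENNReal.ofReal (1 / ProbabilityTheory.beta α β * t ^ (α - 1) *
      (1 - t) ^ (β - 1)) = ENNReal.ofReal (1 / ProbabilityTheory.beta α β) *
        ENNReal.ofReal (t ^ (α - 1) * (1 - t) ^ (β - 1)) := fun t => by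
    rw [← ENNReal.ofReal_mul (by positivity), mul_assoc]
  simp_rw [h1] at h
  rw [lintegral_const_mul' _ _ (by simp)] at h
  calc _ = ENNReal.ofReal (ProbabilityTheory.beta α β) *
        (ENNReal.ofReal (1 / ProbabilityTheory.beta α β) *
          ∫⁻ t in Set.Ioo (0 : ℝ) 1, ENNReal.ofReal (t ^ (α - 1) * (1 - t) ^ (β - 1))) := by
        rw [← mul_assoc, ← ENNReal.ofReal_mul hb.le, mul_one_div_cancel hb.ne', ENNReal.ofReal_one,
          one_mul]
    _ = _ := by rw [h, mul_one]

/-- Gauss's summation of the hypergeometric series `₂F₁(α, β; γ; 1)`. -/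
theorem tsum_Gamma_mul_Gamma_div {α β γ : ℝ} (hα : 0 < α) (hβ : 0 < β) (hγ : α + β < γ) :
    ∑' i : ℕ, ENNReal.ofReal (Real.Gamma (α + i) * Real.Gamma (β + i) /
        ((i.factorial : ℝ) * Real.Gamma (γ + i))) =
      ENNReal.ofReal (Real.Gamma α * Real.Gamma β * Real.Gamma (γ - α - β) /
        (Real.Gamma (γ - α) * Real.Gamma (γ - β))) := by
  have hδ : 0 < γ - β := by linarith
  have hγ' : 0 < γ := by linarith
  have hG := Real.Gamma_pos_of_pos hδ
  have h1 : ∀ i : ℕ, ENNReal.ofReal (Real.Gamma (α + i) * Real.Gamma (β + i) /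
        ((i.factorial : ℝ) * Real.Gamma (γ + i))) =
      ∫⁻ t in Set.Ioo (0 : ℝ) 1, ENNReal.ofReal ((Real.Gamma (γ - β))⁻¹ *
        (t ^ (β - 1) * (1 - t) ^ (γ - β - 1))) *
        ENNReal.ofReal (Real.Gamma (α + i) / (i.factorial : ℝ) * t ^ i) := by
    intro i
    have hGi := Real.Gamma_pos_of_pos (show 0 < α + i by positivity)
    have h2 := lintegral_rpow_mul_one_sub_rpow (show 0 < β + i by positivity) hδ
    have : Real.Gamma (α + i) * Real.Gamma (β + i) / ((i.factorial : ℝ) * Real.Gamma (γ + i)) =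
        ((Real.Gamma (γ - β))⁻¹ * (Real.Gamma (α + i) / (i.factorial : ℝ))) *
          ProbabilityTheory.beta (β + i) (γ - β) := by
      rw [ProbabilityTheory.beta, show β + i + (γ - β) = γ + i by ring]
      field_simp
    rw [this, ENNReal.ofReal_mul (by positivity), ← h2, ← lintegral_const_mul' _ _ (by simp)]
    refine setLIntegral_congr_fun measurableSet_Ioo fun t ht => ?_
    have ht0 : 0 < t := ht.1
    have ht1 : 0 < 1 - t := sub_pos.mpr ht.2
    rw [← ENNReal.ofReal_mul (by positivity), ← ENNReal.ofReal_mul (by positivity),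
      show β + i - 1 = (β - 1) + i by ring, Real.rpow_add ht0, Real.rpow_natCast]
    congr 1
    ring
  simp_rw [h1]
  rw [← lintegral_tsum (fun i => by fun_prop)]
  have hGα := Real.Gamma_pos_of_pos hα
  have h3 : Real.Gamma α * Real.Gamma β * Real.Gamma (γ - α - β) /
        (Real.Gamma (γ - α) * Real.Gamma (γ - β)) =
      ((Real.Gamma (γ - β))⁻¹ * Real.Gamma α) * ProbabilityTheory.beta β (γ - α - β) := by
    rw [ProbabilityTheory.beta, show β + (γ - α - β) = γ - α by ring]
    field_simp
  rw [h3, ENNReal.ofReal_mul (by positivity),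
    ← lintegral_rpow_mul_one_sub_rpow hβ (by linarith), ← lintegral_const_mul' _ _ (by simp)]
  refine setLIntegral_congr_fun measurableSet_Ioo fun t ht => ?_
  have ht0 : 0 < t := ht.1
  have ht1 : 0 < 1 - t := sub_pos.mpr ht.2
  rw [ENNReal.tsum_mul_left, tsum_Gamma_add_mul_pow hα ht0.le ht.2,
    ← ENNReal.ofReal_mul (by positivity), ← ENNReal.ofReal_mul (by positivity),
    show γ - α - β - 1 = (γ - β - 1) + (-α) by ring, Real.rpow_add ht1]
  congr 1
  ring

/-- The moment `∫ (e · ω)^{2N} dσ(ω)` of the surface measure, for a unit vector `e`;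
see `integral_inner_pow`. -/
noncomputable def sphereMoment (n N : ℕ) : ℝ :=
  2 * Real.pi ^ ((n : ℝ) / 2) * (2 * N).factorial / (4 ^ N * N.factorial * Real.Gamma (N + n / 2))

/-- The eigenvalue on spherical harmonics of degree `m` of the operator on `L²(S^{n-1})` with the
kernel `(θ · ω)^j`. It vanishes unless `j - m` is even and nonnegative, and the quotient is the one
that comes out of comparing coefficients in `exists_integral_inner_pow_mul_inner_pow`. -/
noncomputable def powerEigenvalue (n m j : ℕ) : ℝ :=
  if Even (j + m) then
    sphereMoment n ((j + m) / 2) * 2 ^ m * ((j + m) / 2).choose m / (j + m).choose m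
  else 0

/-- The coefficient of `(θ · ω)^j` in the kernel (to be read as the corresponding superposition of
Gaussian integrals)
`(2π)⁻ⁿ ∫ |ξ|^{-2s} e^{i (θ - ω) · ξ} dξ` on `S^{n-1} × S^{n-1}`. -/
noncomputable def rieszCoeff (n : ℕ) (s : ℝ) (j : ℕ) : ℝ :=
  (2 * Real.pi) ^ (-(n : ℝ)) * (Real.pi ^ ((n : ℝ) / 2) * 2 ^ (((n : ℝ) - 2 * s) / 2) *
    Real.Gamma (((n : ℝ) - 2 * s) / 2 + j) / (Real.Gamma s * j.factorial))

/-- The eigenvalue on spherical harmonics of degree `m` of the composition of the restriction to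
the sphere with its adjoint. -/
noncomputable def traceEigenvalue (n : ℕ) (s : ℝ) (m : ℕ) : ℝ :=
  2 ^ (1 - 2 * s) * (Real.Gamma (2 * s - 1) / Real.Gamma s ^ 2) *
    (Real.Gamma (((n : ℝ) - 2 * s) / 2 + m) / Real.Gamma (((n : ℝ) + 2 * s - 2) / 2 + m))

theorem sphereMoment_pos (n N : ℕ) [NeZero n] : 0 < sphereMoment n N := by
  have : 0 < (n : ℝ) := by exact_mod_cast NeZero.pos n
  have := Real.Gamma_pos_of_pos (show 0 < (N : ℝ) + n / 2 by positivity)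
  unfold sphereMoment
  positivity

theorem powerEigenvalue_nonneg (n m j : ℕ) [NeZero n] : 0 ≤ powerEigenvalue n m j := by
  have := sphereMoment_pos n ((j + m) / 2)
  unfold powerEigenvalue
  split_ifs <;> positivity

theorem powerEigenvalue_add_two_mul (n m i : ℕ) : powerEigenvalue n m (m + 2 * i) =
    2 * Real.pi ^ ((n : ℝ) / 2) * 2 ^ m * (m + 2 * i).factorial /
      (4 ^ (m + i) * i.factorial * Real.Gamma ((m : ℝ) + i + n / 2)) := by
  have h1 : m + 2 * i + m = 2 * (m + i) := by ring
  rw [powerEigenvalue, h1, if_pos (even_two_mul _), Nat.mul_div_cancel_left _ two_pos, sphereMoment,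
    Nat.cast_choose ℝ (show m ≤ m + i by omega), Nat.cast_choose ℝ (show m ≤ 2 * (m + i) by omega),
    show m + i - m = i by omega, show 2 * (m + i) - m = m + 2 * i by omega]
  have := (Nat.factorial_pos (2 * (m + i))).ne'
  have := (Nat.factorial_pos (m + 2 * i)).ne'
  have := (Nat.factorial_pos (m + i)).ne'
  push_cast
  field_simp

theorem powerEigenvalue_eq_zero_of_lt {n m j : ℕ} (h : j < m) : powerEigenvalue n m j = 0 := by
  rw [powerEigenvalue]
  split_ifs
  · rw [Nat.choose_eq_zero_of_lt (by omega)]; simp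
  · rfl

theorem rieszCoeff_nonneg {n : ℕ} {s : ℝ} (hs : 0 < s) (hs' : s < n / 2) (j : ℕ) :
    0 ≤ rieszCoeff n s j := by
  have := Real.Gamma_pos_of_pos (show 0 < ((n : ℝ) - 2 * s) / 2 + j by
    have : 0 < (n : ℝ) - 2 * s := by linarith
    positivity)
  have := Real.Gamma_pos_of_pos hs
  unfold rieszCoeff
  positivity

/-- The eigenvalue in degree `m` as a series. The duplication formula turns its terms into those of
a hypergeometric series at `1`; Gauss's condition for convergence amounts to `1 / 2 < s`. -/
theorem tsum_rieszCoeff_mul_powerEigenvalue {n : ℕ} {s : ℝ} (hs : 1 / 2 < s) (hs' : s < n / 2)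
    (m : ℕ) : ∑' j, ENNReal.ofReal (rieszCoeff n s j * powerEigenvalue n m j) =
      ENNReal.ofReal (traceEigenvalue n s m) := by
  set a : ℝ := ((n : ℝ) - 2 * s) / 2 with ha
  have ha0 : 0 < a := by rw [ha]; linarith
  have hinj : Function.Injective fun i : ℕ => m + 2 * i := fun i j h => by
    simp only at h; omega
  rw [← hinj.tsum_eq]
  swap
  · intro j hj
    by_contra hne
    apply hj
    rcases lt_or_ge j m with h | h
    · simp [powerEigenvalue_eq_zero_of_lt h]
    · have : ¬ Even (j + m) := fun ⟨k, hk⟩ => hne ⟨k - m, by simp only; omega⟩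
      simp [powerEigenvalue, this]
  set K : ℝ := 2 ^ (2 * a - n) / (Real.Gamma s * √Real.pi) with hK
  have hGs := Real.Gamma_pos_of_pos (show 0 < s by linarith)
  have hpi := Real.pi_pos
  have h1 : ∀ i : ℕ, rieszCoeff n s (m + 2 * i) * powerEigenvalue n m (m + 2 * i) =
      K * (Real.Gamma ((a + m) / 2 + i) * Real.Gamma ((a + m) / 2 + 1 / 2 + i) /
        (i.factorial * Real.Gamma ((n : ℝ) / 2 + m + i))) := by
    intro i
    have hd := Real.Gamma_mul_Gamma_add_half ((a + m) / 2 + i)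
    rw [show (a + m) / 2 + 1 / 2 + i = (a + m) / 2 + i + 1 / 2 by ring, hd,
      powerEigenvalue_add_two_mul, rieszCoeff, ← ha, hK,
      show 2 * ((a + m) / 2 + (i : ℝ)) = a + ((m + 2 * i : ℕ) : ℝ) by push_cast; ring,
      show (n : ℝ) / 2 + m + i = (m : ℝ) + i + n / 2 by ring]
    have hG := Real.Gamma_pos_of_pos (show 0 < (m : ℝ) + i + n / 2 by
      have : 0 < (n : ℝ) := by linarith
      positivity)
    have e1 : (2 * Real.pi) ^ (-(n : ℝ)) = 2 ^ (-(n : ℝ)) * (Real.pi ^ ((n : ℝ) / 2) *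
        Real.pi ^ ((n : ℝ) / 2))⁻¹ := by
      rw [Real.mul_rpow (by norm_num) hpi.le, ← Real.rpow_add hpi, add_halves, Real.rpow_neg hpi.le]
    have e2 : (2 : ℝ) ^ (1 - (a + ((m + 2 * i : ℕ) : ℝ))) = 2 * (2 ^ a)⁻¹ * (2 ^ m * 4 ^ i)⁻¹ := by
      rw [Real.rpow_sub two_pos, Real.rpow_add two_pos, Real.rpow_natCast, Real.rpow_one, pow_add,
        pow_mul]
      norm_num
      field_simp
    have e3 : (2 : ℝ) ^ (2 * a - n) = 2 ^ a * 2 ^ a * 2 ^ (-(n : ℝ)) := by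
      rw [← Real.rpow_add two_pos, ← Real.rpow_add two_pos]; congr 1; ring
    have e4 : (4 : ℝ) ^ (m + i) = 2 ^ m * 2 ^ m * 4 ^ i := by
      rw [pow_add, ← mul_pow]; norm_num
    rw [e1, e2, e3, e4]
    have := (Nat.factorial_pos (m + 2 * i)).ne'
    have : (2 : ℝ) ^ a ≠ 0 := by positivity
    have : Real.pi ^ ((n : ℝ) / 2) ≠ 0 := by positivity
    have : √Real.pi ≠ 0 := by positivity
    field_simp
  have hK0 : 0 < K := by positivity
  simp_rw [h1, ENNReal.ofReal_mul hK0.le]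
  rw [ENNReal.tsum_mul_left, tsum_Gamma_mul_Gamma_div (by positivity) (by positivity)
    (by rw [ha]; linarith), ← ENNReal.ofReal_mul hK0.le]
  congr 1
  have d1 := Real.Gamma_mul_Gamma_add_half ((a + m) / 2)
  have d2 := Real.Gamma_mul_Gamma_add_half ((n + m - 1 - a) / 2)
  have d3 := Real.Gamma_mul_Gamma_add_half (s - 1 / 2)
  rw [d1, traceEigenvalue, ← ha, hK, mul_comm (Real.Gamma ((n : ℝ) / 2 + m - (a + m) / 2)),
    show (n : ℝ) / 2 + m - ((a + m) / 2 + 1 / 2) = (n + m - 1 - a) / 2 by ring,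
    show (n : ℝ) / 2 + m - (a + m) / 2 = (n + m - 1 - a) / 2 + 1 / 2 by ring, d2,
    show (n + m - 1 - a) / 2 + 1 / 2 - ((a + m) / 2 + 1 / 2) = s - 1 / 2 by rw [ha]; ring]
  rw [sub_add_cancel, show 2 * (s - 1 / 2) = 2 * s - 1 by ring] at d3
  have d3' : Real.Gamma (s - 1 / 2) = Real.Gamma (2 * s - 1) * 2 ^ (1 - (2 * s - 1)) * √Real.pi /
      Real.Gamma s := by rw [← d3]; field_simp
  rw [d3', show 2 * ((a + m) / 2) = a + m by ring,
    show 2 * (((n : ℝ) + m - 1 - a) / 2) = ((n : ℝ) + 2 * s - 2) / 2 + m by rw [ha]; ring]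
  have hG := Real.Gamma_pos_of_pos (show 0 < ((n : ℝ) + 2 * s - 2) / 2 + m by
      have : 0 < (n : ℝ) + 2 * s - 2 := by linarith
      positivity)
  have : √Real.pi ≠ 0 := by positivity
  have e : (2 : ℝ) ^ (2 * a - n) * 2 ^ (1 - (a + m)) * 2 ^ (1 - (2 * s - 1)) =
      2 ^ (1 - 2 * s) * 2 ^ (1 - (((n : ℝ) + 2 * s - 2) / 2 + m)) := by
    rw [← Real.rpow_add two_pos, ← Real.rpow_add two_pos, ← Real.rpow_add two_pos]
    congr 1
    rw [ha]; ring
  generalize Real.Gamma (((n : ℝ) + 2 * s - 2) / 2 + m) = G at hG ⊢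
  generalize (2 : ℝ) ^ (1 - (((n : ℝ) + 2 * s - 2) / 2 + m)) = E₁ at e ⊢
  generalize hE : (2 : ℝ) ^ (1 - (a + m)) = E₂ at e ⊢
  have : E₁ ≠ 0 := by
    rintro rfl
    have : 0 < (2 : ℝ) ^ (2 * a - n) * E₂ * 2 ^ (1 - (2 * s - 1)) := by
      rw [← hE]; positivity
    rw [e, mul_zero] at this
    exact this.false
  field_simp
  linear_combination Real.Gamma (2 * s - 1) * e

theorem traceEigenvalue_pos {n : ℕ} {s : ℝ} (hs : 1 / 2 < s) (hs' : s < n / 2) (m : ℕ) :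
    0 < traceEigenvalue n s m := by
  have := Real.Gamma_pos_of_pos (show 0 < ((n : ℝ) - 2 * s) / 2 + m by
    have : 0 < (n : ℝ) - 2 * s := by linarith
    positivity)
  have := Real.Gamma_pos_of_pos (show 0 < ((n : ℝ) + 2 * s - 2) / 2 + m by
    have : 0 < (n : ℝ) + 2 * s - 2 := by linarith
    positivity)
  have := Real.Gamma_pos_of_pos (show 0 < 2 * s - 1 by linarith)
  have := Real.Gamma_pos_of_pos (show 0 < s by linarith)
  unfold traceEigenvalue
  positivity

theorem traceEigenvalue_succ_lt {n : ℕ} {s : ℝ} (hs : 1 / 2 < s) (hs' : s < n / 2) (m : ℕ) :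
    traceEigenvalue n s (m + 1) < traceEigenvalue n s m := by
  have h1 : 0 < ((n : ℝ) - 2 * s) / 2 + m := by
    have : 0 < (n : ℝ) - 2 * s := by linarith
    positivity
  have h2 : 0 < ((n : ℝ) + 2 * s - 2) / 2 + m := by
    have : 0 < (n : ℝ) + 2 * s - 2 := by linarith
    positivity
  have h3 : traceEigenvalue n s (m + 1) = traceEigenvalue n s m *
      ((((n : ℝ) - 2 * s) / 2 + m) / (((n : ℝ) + 2 * s - 2) / 2 + m)) := by
    unfold traceEigenvalue
    push_cast
    rw [← add_assoc, ← add_assoc, Real.Gamma_add_one h1.ne', Real.Gamma_add_one h2.ne']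
    field_simp
  rw [h3]
  refine mul_lt_of_lt_one_right (traceEigenvalue_pos hs hs' m) ?_
  rw [div_lt_one h2]
  linarith

theorem traceEigenvalue_antitone {n : ℕ} {s : ℝ} (hs : 1 / 2 < s) (hs' : s < n / 2) :
    Antitone (traceEigenvalue n s) :=
  antitone_nat_of_succ_le fun m => (traceEigenvalue_succ_lt hs hs' m).le

theorem traceEigenvalue_zero_sub_one (n : ℕ) (s : ℝ) :
    traceEigenvalue n s 0 - traceEigenvalue n s 1 = stabilityConst n s := by
  rw [traceEigenvalue, traceEigenvalue, stabilityConst, Nat.cast_zero, Nat.cast_one, add_zero,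
    add_zero, show ((n : ℝ) - 2 * s) / 2 + 1 = (n - 2 * s + 2) / 2 by ring,
    show ((n : ℝ) + 2 * s - 2) / 2 + 1 = (n + 2 * s) / 2 by ring]
  ring

/-! ### Moments of the surface measure -/

section Moments

open scoped RealInnerProductSpace

/-- The coefficients of an everywhere convergent power series are determined by its sum. -/
theorem eq_of_hasSum_pow_mul {a b : ℕ → ℝ} {g : ℝ → ℝ}
    (ha : ∀ t : ℝ, HasSum (fun k => t ^ k * a k) (g t))
    (hb : ∀ t : ℝ, HasSum (fun k => t ^ k * b k) (g t)) : a = b := by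
  have h : ∀ {c : ℕ → ℝ}, (∀ t : ℝ, HasSum (fun k => t ^ k * c k) (g t)) →
      HasFPowerSeriesAt g (FormalMultilinearSeries.ofScalars ℝ c) 0 := by
    intro c hc
    rw [hasFPowerSeriesAt_iff]
    refine Filter.Eventually.of_forall fun z => ?_
    simpa [FormalMultilinearSeries.coeff_ofScalars] using hc z
  ext k
  have := congrArg (fun p => FormalMultilinearSeries.coeff p k)
    ((h ha).eq_formalMultilinearSeries (h hb))
  simpa [FormalMultilinearSeries.coeff_ofScalars] using this

variable {n : ℕ}

theorem integrable_exp_neg_norm_sq_add (x : Eucl n) (t : ℝ) :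
    Integrable fun y : Eucl n => Real.exp (-‖y‖ ^ 2 + t * ⟪x, y⟫) := by
  have h := (GaussianFourier.integrable_cexp_neg_mul_sq_norm_add (V := Eucl n) (b := 1) (by simp)
    (t : ℂ) x).re
  convert h using 2 with y
  rw [show (-(1 : ℂ) * (‖y‖ : ℂ) ^ 2 + (t : ℂ) * ((⟪x, y⟫ : ℝ) : ℂ)) =
    ((-‖y‖ ^ 2 + t * ⟪x, y⟫ : ℝ) : ℂ) by push_cast; ring, ← Complex.ofReal_exp]
  rfl

theorem integral_exp_neg_norm_sq_add (x : Eucl n) (t : ℝ) :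
    ∫ y : Eucl n, Real.exp (-‖y‖ ^ 2 + t * ⟪x, y⟫) =
      Real.pi ^ ((n : ℝ) / 2) * Real.exp (t ^ 2 * (‖x‖ ^ 2 / 4)) := by
  have h := GaussianFourier.integral_cexp_neg_mul_sq_norm_add (V := Eucl n) (b := 1) (by simp)
    (t : ℂ) x
  apply Complex.ofReal_injective
  rw [← integral_complex_ofReal]
  convert h using 1
  · refine integral_congr_ae (Filter.Eventually.of_forall fun y => ?_)
    push_cast
    congr 1
    ring
  · rw [Complex.ofReal_mul, Complex.ofReal_cpow Real.pi_pos.le]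
    push_cast
    simp only [div_one, finrank_euclideanSpace, Fintype.card_fin]
    congr 2
    ring

/-- The moments of the Gaussian, read off from its Laplace transform. -/
theorem integral_inner_pow_mul_exp_neg_norm_sq (x : Eucl n) (k : ℕ) :
    ∫ y : Eucl n, ⟪x, y⟫ ^ k * Real.exp (-‖y‖ ^ 2) =
      if Even k then Real.pi ^ ((n : ℝ) / 2) * k.factorial * (‖x‖ ^ 2) ^ (k / 2) /
        (4 ^ (k / 2) * (k / 2).factorial) else 0 := by
  set b : ℕ → ℝ := fun k => if Even k then Real.pi ^ ((n : ℝ) / 2) *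
    ((‖x‖ ^ 2 / 4) ^ (k / 2) / (k / 2).factorial) else 0 with hb
  have h1 : ∀ t : ℝ, HasSum
      (fun k : ℕ => t ^ k * ((∫ y : Eucl n, ⟪x, y⟫ ^ k * Real.exp (-‖y‖ ^ 2)) / k.factorial))
      (∫ y : Eucl n, Real.exp (-‖y‖ ^ 2 + t * ⟪x, y⟫)) := by
    intro t
    have hexp : ∀ u : ℝ, HasSum (fun k : ℕ => u ^ k / (k.factorial : ℝ)) (Real.exp u) := by
      intro u
      rw [Real.exp_eq_exp_ℝ]
      exact NormedSpace.expSeries_div_hasSum_exp u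
    have := hasSum_integral_of_dominated_convergence (μ := (volume : Measure (Eucl n)))
      (F := fun (k : ℕ) y => Real.exp (-‖y‖ ^ 2) * ((t * ⟪x, y⟫) ^ k / k.factorial))
      (f := fun y => Real.exp (-‖y‖ ^ 2 + t * ⟪x, y⟫))
      (fun (k : ℕ) y => Real.exp (-‖y‖ ^ 2) * (|t * ⟪x, y⟫| ^ k / k.factorial))
      (fun k => by fun_prop) ?_ ?_ ?_ ?_
    · convert! this using 2 with k
      rw [mul_div_assoc', ← integral_const_mul, ← integral_div]
      refine integral_congr_ae (Filter.Eventually.of_forall fun y => ?_)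
      simp only [mul_pow]
      ring
    · intro k
      refine Filter.Eventually.of_forall fun y => ?_
      simp [abs_mul]
    · exact Filter.Eventually.of_forall fun y => (hexp _).summable.mul_left _
    · have h2 : ∀ y : Eucl n, ∑' k : ℕ, Real.exp (-‖y‖ ^ 2) * (|t * ⟪x, y⟫| ^ k / k.factorial) =
          Real.exp (-‖y‖ ^ 2) * Real.exp |t * ⟪x, y⟫| := fun y => by
        rw [tsum_mul_left, (hexp _).tsum_eq]
      simp_rw [h2]
      refine ((integrable_exp_neg_norm_sq_add x t).add
        (integrable_exp_neg_norm_sq_add x (-t))).mono' (by fun_prop) ?_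
      refine Filter.Eventually.of_forall fun y => ?_
      rw [Real.norm_of_nonneg (by positivity), Pi.add_apply, Real.exp_add, Real.exp_add, ← mul_add,
        neg_mul t]
      gcongr
      exact Real.exp_abs_le _
    · refine Filter.Eventually.of_forall fun y => ?_
      rw [Real.exp_add]
      exact (hexp _).mul_left _
  have h2 : ∀ t : ℝ, HasSum (fun k => t ^ k * b k)
      (∫ y : Eucl n, Real.exp (-‖y‖ ^ 2 + t * ⟪x, y⟫)) := by
    intro t
    rw [integral_exp_neg_norm_sq_add]
    have hinj : Function.Injective fun i : ℕ => 2 * i := fun i j h => by simpa using h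
    rw [← hinj.hasSum_iff]
    · rw [Real.exp_eq_exp_ℝ]
      have := (NormedSpace.expSeries_div_hasSum_exp (t ^ 2 * (‖x‖ ^ 2 / 4))).mul_left
        (Real.pi ^ ((n : ℝ) / 2))
      convert! this using 2 with i
      simp only [hb, Function.comp_apply, even_two_mul, if_true,
        Nat.mul_div_cancel_left _ two_pos, mul_pow, pow_mul]
      ring
    · intro k hk
      have : ¬ Even k := fun ⟨i, hi⟩ => hk ⟨i, by simp only; omega⟩
      simp [hb, this]
  have h3 := congrFun (eq_of_hasSum_pow_mul h1 h2) k
  have hk : (k.factorial : ℝ) ≠ 0 := by positivity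
  rw [div_eq_iff hk] at h3
  rw [h3, hb]
  dsimp only
  split_ifs
  · rw [div_pow]; field_simp
  · simp

theorem integrable_of_continuous {E : Type*} [NormedAddCommGroup E] {f : Sph n → E}
    (hf : Continuous f) : Integrable f (surfaceMeasure n) :=
  hf.integrable_of_hasCompactSupport (HasCompactSupport.of_compactSpace f)

variable [NeZero n]

/-- Polar coordinates for a product of a function of the direction and a function of the norm. -/
theorem integral_direction_mul_norm (F : Sph n → ℝ) (φ : ℝ → ℝ) (G : Eucl n → ℝ)
    (hG : ∀ (y : Eucl n) (hy : y ≠ 0), G y = F (direction y hy) * φ ‖y‖) :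
    ∫ y, G y = (∫ ω, F ω ∂(surfaceMeasure n)) * ∫ r in Set.Ioi (0 : ℝ), r ^ (n - 1) * φ r := by
  have hd : Module.finrank ℝ (Eucl n) = n := by simp
  have hmp := (volume : Measure (Eucl n)).measurePreserving_homeomorphUnitSphereProd
  rw [hd] at hmp
  calc ∫ y, G y = ∫ y : ({(0 : Eucl n)}ᶜ : Set (Eucl n)), G y ∂(volume.comap Subtype.val) := by
        rw [integral_subtype_comap (measurableSet_singleton _).compl G,
          restrict_compl_singleton]
    _ = ∫ p, F p.1 * φ p.2 ∂((surfaceMeasure n).prod (Measure.volumeIoiPow (n - 1))) := by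
        rw [← hmp.integral_comp (Homeomorph.measurableEmbedding _)]
        refine integral_congr_ae (Filter.Eventually.of_forall fun y => ?_)
        have h1 : (homeomorphUnitSphereProd (Eucl n) y).1 = direction (y : Eucl n) y.2 :=
          Subtype.ext (by simp [direction])
        have h2 : ((homeomorphUnitSphereProd (Eucl n) y).2 : ℝ) = ‖(y : Eucl n)‖ := by simp
        simp only [h1, h2]
        exact hG y y.2
    _ = (∫ ω, F ω ∂(surfaceMeasure n)) *
          ∫ r : Set.Ioi (0 : ℝ), φ r ∂(Measure.volumeIoiPow (n - 1)) :=
        integral_prod_mul F fun r : Set.Ioi (0 : ℝ) => φ r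
    _ = _ := by
        congr 1
        simp only [Measure.volumeIoiPow, ENNReal.ofReal]
        rw [integral_withDensity_eq_integral_smul,
          integral_subtype_comap measurableSet_Ioi
            fun a => Real.toNNReal (a ^ (n - 1)) • φ a]
        · refine setIntegral_congr_fun measurableSet_Ioi fun r hr => ?_
          simp only [NNReal.smul_def, smul_eq_mul]
          rw [Real.coe_toNNReal _ (pow_nonneg (Set.mem_Ioi.mp hr).le _)]
        · exact (measurable_subtype_coe.pow_const _).real_toNNReal

/-- The moments of the surface measure, from those of the Gaussian by polar coordinates. -/
theorem integral_inner_pow (x : Eucl n) (k : ℕ) :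
    ∫ ω : Sph n, ⟪x, (ω : Eucl n)⟫ ^ k ∂(surfaceMeasure n) =
      if Even k then sphereMoment n (k / 2) * (‖x‖ ^ 2) ^ (k / 2) else 0 := by
  have hn : 0 < n := NeZero.pos n
  have h1 := integral_direction_mul_norm (fun ω : Sph n => ⟪x, (ω : Eucl n)⟫ ^ k)
    (fun r => r ^ k * Real.exp (-r ^ 2)) (fun y => ⟪x, y⟫ ^ k * Real.exp (-‖y‖ ^ 2)) (by
      intro y hy
      have : ‖y‖ ≠ 0 := norm_ne_zero_iff.mpr hy
      simp only [direction, inner_smul_right, mul_pow]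
      rw [inv_pow]
      field_simp)
  have h2 : ∫ r in Set.Ioi (0 : ℝ), r ^ (n - 1) * (r ^ k * Real.exp (-r ^ 2)) =
      1 / 2 * Real.Gamma (((k : ℝ) + n) / 2) := by
    have h := integral_rpow_mul_exp_neg_rpow (p := 2) (q := k + n - 1) two_pos (by
      have : (0 : ℝ) < n := by exact_mod_cast hn
      have : (0 : ℝ) ≤ k := by positivity
      linarith)
    rw [show ((k : ℝ) + n - 1 + 1) / 2 = (k + n) / 2 by ring] at h
    rw [← h]
    refine setIntegral_congr_fun measurableSet_Ioi fun r hr => ?_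
    have hr : 0 < r := hr
    rw [show (k : ℝ) + n - 1 = ((n - 1 + k : ℕ) : ℝ) by push_cast [Nat.cast_sub hn]; ring,
      Real.rpow_natCast, pow_add, Real.rpow_two, mul_assoc]
  rw [integral_inner_pow_mul_exp_neg_norm_sq, h2] at h1
  have hG : 0 < Real.Gamma (((k : ℝ) + n) / 2) := Real.Gamma_pos_of_pos (by
    have : (0 : ℝ) < n := by exact_mod_cast hn
    positivity)
  have h3 : ∫ ω : Sph n, ⟪x, (ω : Eucl n)⟫ ^ k ∂(surfaceMeasure n) =
      (if Even k then Real.pi ^ ((n : ℝ) / 2) * k.factorial * (‖x‖ ^ 2) ^ (k / 2) /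
        (4 ^ (k / 2) * (k / 2).factorial) else 0) * (2 / Real.Gamma (((k : ℝ) + n) / 2)) := by
    rw [h1]; field_simp
  rw [h3]
  split_ifs with hk
  · obtain ⟨N, rfl⟩ := hk
    rw [← two_mul, Nat.mul_div_cancel_left _ two_pos, sphereMoment]
    push_cast
    rw [show (2 * (N : ℝ) + n) / 2 = N + n / 2 by ring]
    ring
  · simp

open Polynomial in
/-- The coefficient of `X^m` in `(1 + 2 t X + X²)^N` is a polynomial in `t` of degree at
most `m`. -/
theorem coeff_add_pow (t : ℝ) (N m : ℕ) :
    ((C (2 * t) * X + (1 + X ^ 2)) ^ N : ℝ[X]).coeff m =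
      2 ^ m * N.choose m * t ^ m + ∑ l ∈ Finset.range m,
        (2 ^ l * N.choose l * ((1 + X ^ 2) ^ (N - l) : ℝ[X]).coeff (m - l)) * t ^ l := by
  have h1 : ∀ l, ((C (2 * t) * X) ^ l * (1 + X ^ 2) ^ (N - l) * (N.choose l : ℝ[X])).coeff m =
      if l ≤ m then (2 ^ l * N.choose l * ((1 + X ^ 2) ^ (N - l) : ℝ[X]).coeff (m - l)) * t ^ l
      else 0 := by
    intro l
    have : (C (2 * t) * X) ^ l * (1 + X ^ 2) ^ (N - l) * (N.choose l : ℝ[X]) =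
        C ((2 * t) ^ l * N.choose l) * (X ^ l * (1 + X ^ 2) ^ (N - l)) := by
      simp only [mul_pow, C_mul, C_pow, map_natCast]; ring
    rw [this, coeff_C_mul, coeff_X_pow_mul']
    split_ifs
    · ring
    · simp
  have h2 : ∀ M, ∑ l ∈ Finset.range (M + 1), (if l ≤ m then
      (2 ^ l * N.choose l * ((1 + X ^ 2) ^ (N - l) : ℝ[X]).coeff (m - l)) * t ^ l else 0) =
      ∑ l ∈ Finset.range (M + 1) ∩ Finset.range (m + 1),
        (2 ^ l * N.choose l * ((1 + X ^ 2) ^ (N - l) : ℝ[X]).coeff (m - l)) * t ^ l := by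
    intro M
    rw [← Finset.sum_filter]
    congr 1
    ext l
    simp
  rw [add_pow, finsetSum_coeff, Finset.sum_congr rfl fun l _ => h1 l, h2]
  have h3 : ∑ l ∈ Finset.range (N + 1) ∩ Finset.range (m + 1),
        (2 ^ l * N.choose l * ((1 + X ^ 2) ^ (N - l) : ℝ[X]).coeff (m - l)) * t ^ l =
      ∑ l ∈ Finset.range (m + 1),
        (2 ^ l * N.choose l * ((1 + X ^ 2) ^ (N - l) : ℝ[X]).coeff (m - l)) * t ^ l := by
    refine Finset.sum_subset Finset.inter_subset_right fun l hl hl' => ?_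
    have : N < l := by
      by_contra h
      exact hl' (Finset.mem_inter.mpr ⟨Finset.mem_range.mpr (by omega), hl⟩)
    simp [Nat.choose_eq_zero_of_lt this]
  rw [h3, Finset.sum_range_succ, add_comm]
  congr 1
  rw [Nat.sub_self, coeff_zero_eq_eval_zero]
  simp

/-- The operator with the kernel `(θ · ω)^j` maps `(η · ω)^m` to a multiple of `(η · θ)^m` plus
powers of lower degree. The integral is the coefficient of `s^m` in
`∫ ((θ + s η) · ω)^{j + m} dσ(ω)`, which is a multiple of `|θ + s η|^{j + m}`. -/
theorem exists_integral_inner_pow_mul_inner_pow (n j m : ℕ) [NeZero n] : ∃ b : ℕ → ℝ,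
    ∀ θ η : Eucl n, ‖θ‖ = 1 → ‖η‖ = 1 →
      ∫ ω : Sph n, ⟪θ, (ω : Eucl n)⟫ ^ j * ⟪η, (ω : Eucl n)⟫ ^ m ∂(surfaceMeasure n) =
        powerEigenvalue n m j * ⟪η, θ⟫ ^ m + ∑ l ∈ Finset.range m, b l * ⟪η, θ⟫ ^ l := by
  classical
  set N := (j + m) / 2 with hN
  refine ⟨fun l => if Even (j + m) then sphereMoment n N / (j + m).choose m * (2 ^ l * N.choose l *
    ((1 + Polynomial.X ^ 2) ^ (N - l) : Polynomial ℝ).coeff (m - l)) else 0,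
    fun θ η hθ hη => ?_⟩
  set J : ℕ → ℝ := fun k =>
    ∫ ω : Sph n, ⟪θ, (ω : Eucl n)⟫ ^ (j + m - k) * ⟪η, (ω : Eucl n)⟫ ^ k ∂(surfaceMeasure n)
    with hJ
  have h1 : ∀ s : ℝ, ∑ k ∈ Finset.range (j + m + 1), s ^ k * ((j + m).choose k * J k) =
      if Even (j + m) then sphereMoment n N * (2 * ⟪η, θ⟫ * s + (1 + s ^ 2)) ^ N else 0 := by
    intro s
    have h2 := integral_inner_pow (θ + s • η) (j + m)
    have h3 : ‖θ + s • η‖ ^ 2 = 2 * ⟪η, θ⟫ * s + (1 + s ^ 2) := by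
      rw [norm_add_sq_real, norm_smul, hθ, hη, inner_smul_right, real_inner_comm]
      simp; ring
    rw [h3] at h2
    rw [← h2]
    have h4 : ∀ ω : Sph n, ⟪θ + s • η, (ω : Eucl n)⟫ ^ (j + m) =
        ∑ k ∈ Finset.range (j + m + 1), s ^ k * ((j + m).choose k *
          (⟪θ, (ω : Eucl n)⟫ ^ (j + m - k) * ⟪η, (ω : Eucl n)⟫ ^ k)) := by
      intro ω
      rw [inner_add_left, inner_smul_left, add_comm, add_pow]
      refine Finset.sum_congr rfl fun k _ => ?_
      simp only [conj_trivial, mul_pow]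
      ring
    simp_rw [h4]
    rw [integral_finsetSum _ fun k _ => integrable_of_continuous (by fun_prop)]
    refine Finset.sum_congr rfl fun k _ => ?_
    rw [integral_const_mul, integral_const_mul]
  have h5 : ∑ k ∈ Finset.range (j + m + 1), Polynomial.C ((j + m).choose k * J k) *
        Polynomial.X ^ k =
      if Even (j + m) then Polynomial.C (sphereMoment n N) *
        (Polynomial.C (2 * ⟪η, θ⟫) * Polynomial.X + (1 + Polynomial.X ^ 2)) ^ N else 0 := by
    refine Polynomial.funext fun s => ?_
    have := h1 s
    rw [Polynomial.eval_finsetSum]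
    simp only [Polynomial.eval_mul, Polynomial.eval_C, Polynomial.eval_pow, Polynomial.eval_X]
    rw [Finset.sum_congr rfl fun k _ => mul_comm _ _, this]
    split_ifs <;> simp
  have h6 := congrArg (fun p => Polynomial.coeff p m) h5
  simp only [Polynomial.finsetSum_coeff, Polynomial.coeff_C_mul_X_pow] at h6
  rw [Finset.sum_ite_eq, if_pos (Finset.mem_range.mpr (by omega))] at h6
  have h7 : ((j + m).choose m : ℝ) ≠ 0 := by
    have := Nat.choose_pos (show m ≤ j + m by omega)
    positivity
  have h8 : J m = ∫ ω : Sph n, ⟪θ, (ω : Eucl n)⟫ ^ j * ⟪η, (ω : Eucl n)⟫ ^ m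
      ∂(surfaceMeasure n) := by
    rw [hJ]; simp
  rw [← h8, powerEigenvalue]
  split_ifs at h6 ⊢ with hjm
  · rw [Polynomial.coeff_C_mul, coeff_add_pow] at h6
    rw [← mul_right_inj' h7, h6, ← hN, mul_add, Finset.mul_sum, mul_add, Finset.mul_sum]
    congr 1
    · field_simp
    · refine Finset.sum_congr rfl fun l _ => ?_
      field_simp
  · simp only [Polynomial.coeff_zero, mul_eq_zero, h7, false_or] at h6
    simp [h6]

theorem integral_inner_pow_mul_inner (j : ℕ) (θ η : Eucl n) (hθ : ‖θ‖ = 1) (hη : ‖η‖ = 1) :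
    ∫ ω : Sph n, ⟪θ, (ω : Eucl n)⟫ ^ j * ⟪η, (ω : Eucl n)⟫ ∂(surfaceMeasure n) =
      powerEigenvalue n 1 j * ⟪η, θ⟫ := by
  obtain ⟨b, hb⟩ := exists_integral_inner_pow_mul_inner_pow n j 1
  have h1 := hb θ η hθ hη
  -- the lower order term is a constant; it vanishes by comparison with `-η`
  have h2 := hb θ (-η) hθ (by rwa [norm_neg])
  simp only [pow_one, Finset.sum_range_one, pow_zero, inner_neg_left, mul_neg, integral_neg]
    at h1 h2
  linarith

end Moments

/-! ### Powers of the inner product as kernels on the sphere -/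

section PowerKernels

open scoped InnerProductSpace

variable {n : ℕ}

/-- The class in `L²(S^{n-1})` of a continuous function. -/
noncomputable def continuousToLp (n : ℕ) : C(Sph n, ℂ) →L[ℂ] Lp ℂ 2 (surfaceMeasure n) :=
  ContinuousMap.toLp 2 (surfaceMeasure n) ℂ

theorem coeFn_continuousToLp (f : C(Sph n, ℂ)) :
    continuousToLp n f =ᵐ[surfaceMeasure n] f :=
  ContinuousMap.coeFn_toLp _ f

theorem inner_continuousToLp_left (f : C(Sph n, ℂ)) (h : Lp ℂ 2 (surfaceMeasure n)) :
    ⟪continuousToLp n f, h⟫_ℂ = ∫ ω, (starRingEnd ℂ) (f ω) * h ω ∂(surfaceMeasure n) := by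
  rw [L2.inner_def]
  refine integral_congr_ae ?_
  filter_upwards [coeFn_continuousToLp f] with ω hω
  rw [hω, RCLike.inner_apply, mul_comm]

theorem inner_continuousToLp_right (f : C(Sph n, ℂ)) (h : Lp ℂ 2 (surfaceMeasure n)) :
    ⟪h, continuousToLp n f⟫_ℂ = ∫ ω, (starRingEnd ℂ) (h ω) * f ω ∂(surfaceMeasure n) := by
  rw [L2.inner_def]
  refine integral_congr_ae ?_
  filter_upwards [coeFn_continuousToLp f] with ω hω
  rw [hω, RCLike.inner_apply, mul_comm]

theorem integrable_coeFn (h : Lp ℂ 2 (surfaceMeasure n)) : Integrable h (surfaceMeasure n) :=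
  (Lp.memLp h).integrable one_le_two

theorem integrable_conj_coeFn (h : Lp ℂ 2 (surfaceMeasure n)) :
    Integrable (fun ω => (starRingEnd ℂ) (h ω)) (surfaceMeasure n) :=
  Complex.conjCLE.toContinuousLinearMap.integrable_comp (integrable_coeFn h)

theorem integrable_continuous_mul {K h : Sph n → ℂ} (hK : Continuous K)
    (hh : Integrable h (surfaceMeasure n)) :
    Integrable (fun ω => K ω * h ω) (surfaceMeasure n) := by
  obtain ⟨C, hC⟩ := isCompact_univ.exists_bound_of_continuousOn hK.continuousOn
  exact hh.bdd_mul hK.aestronglyMeasurable (Filter.Eventually.of_forall fun ω => hC ω trivial)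

theorem integrable_kernel_prod {K : Sph n × Sph n → ℂ} (hK : Continuous K)
    (g h : Lp ℂ 2 (surfaceMeasure n)) :
    Integrable (fun p : Sph n × Sph n => (starRingEnd ℂ) (g p.1) * (K p * h p.2))
      ((surfaceMeasure n).prod (surfaceMeasure n)) := by
  obtain ⟨C, hC⟩ := isCompact_univ.exists_bound_of_continuousOn hK.continuousOn
  have h1 := ((integrable_conj_coeFn g).mul_prod (integrable_coeFn h)).bdd_mul
    hK.aestronglyMeasurable (Filter.Eventually.of_forall fun p => hC p trivial)
  refine h1.congr (Filter.Eventually.of_forall fun p => ?_)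
  simp only
  ring

/-- The sesquilinear form on `L²(S^{n-1})` with the kernel `(θ · ω)^j`. -/
noncomputable def powerForm (j : ℕ) (g h : Lp ℂ 2 (surfaceMeasure n)) : ℂ :=
  ∫ θ, (starRingEnd ℂ) (g θ) * ∫ ω : Sph n, ((⟪(θ : Eucl n), (ω : Eucl n)⟫_ℝ : ℝ) : ℂ) ^ j * h ω
    ∂(surfaceMeasure n) ∂(surfaceMeasure n)

/-- The power `(η · ω)^l` of a linear form on the sphere. -/
noncomputable def linearPow (η : Eucl n) (l : ℕ) : C(Sph n, ℂ) :=
  ⟨fun ω => ((⟪η, (ω : Eucl n)⟫_ℝ : ℝ) : ℂ) ^ l, by fun_prop⟩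

theorem linearPow_apply (η : Eucl n) (l : ℕ) (ω : Sph n) :
    linearPow η l ω = ((⟪η, (ω : Eucl n)⟫_ℝ : ℝ) : ℂ) ^ l := rfl

theorem integral_pow_mul_eq_inner (j : ℕ) (θ : Sph n) (h : Lp ℂ 2 (surfaceMeasure n)) :
    ∫ ω : Sph n, ((⟪(θ : Eucl n), (ω : Eucl n)⟫_ℝ : ℝ) : ℂ) ^ j * h ω ∂(surfaceMeasure n) =
      ⟪continuousToLp n (linearPow (θ : Eucl n) j), h⟫_ℂ := by
  rw [inner_continuousToLp_left]
  simp [linearPow_apply]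

theorem powerForm_eq_integral_prod (j : ℕ) (g h : Lp ℂ 2 (surfaceMeasure n)) :
    powerForm j g h = ∫ p : Sph n × Sph n, (starRingEnd ℂ) (g p.1) *
      (((⟪(p.1 : Eucl n), (p.2 : Eucl n)⟫_ℝ : ℝ) : ℂ) ^ j * h p.2)
      ∂((surfaceMeasure n).prod (surfaceMeasure n)) := by
  rw [integral_prod _ (integrable_kernel_prod (by fun_prop) g h), powerForm]
  simp_rw [integral_const_mul]

theorem powerForm_conj_symm (j : ℕ) (g h : Lp ℂ 2 (surfaceMeasure n)) :
    (starRingEnd ℂ) (powerForm j h g) = powerForm j g h := by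
  rw [powerForm_eq_integral_prod, powerForm_eq_integral_prod, ← integral_conj,
    ← integral_prod_swap]
  refine integral_congr_ae (Filter.Eventually.of_forall fun p => ?_)
  simp only [Prod.fst_swap, Prod.snd_swap, map_mul, map_pow, Complex.conj_ofReal, Complex.conj_conj,
    real_inner_comm]
  ring

theorem powerForm_add_right (j : ℕ) (g h k : Lp ℂ 2 (surfaceMeasure n)) :
    powerForm j g (h + k) = powerForm j g h + powerForm j g k := by
  simp only [powerForm_eq_integral_prod]
  rw [← integral_add (integrable_kernel_prod (by fun_prop) g h)
    (integrable_kernel_prod (by fun_prop) g k)]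
  refine integral_congr_ae ?_
  filter_upwards [Measure.quasiMeasurePreserving_snd.ae (Lp.coeFn_add h k)] with p hp
  rw [hp, Pi.add_apply]
  ring

theorem powerForm_smul_right (j : ℕ) (c : ℂ) (g h : Lp ℂ 2 (surfaceMeasure n)) :
    powerForm j g (c • h) = c * powerForm j g h := by
  simp only [powerForm_eq_integral_prod]
  rw [← integral_const_mul]
  refine integral_congr_ae ?_
  filter_upwards [Measure.quasiMeasurePreserving_snd.ae (Lp.coeFn_smul c h)] with p hp
  rw [hp, Pi.smul_apply, smul_eq_mul]
  ring

theorem powerForm_zero_right (j : ℕ) (g : Lp ℂ 2 (surfaceMeasure n)) : powerForm j g 0 = 0 := by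
  simpa using powerForm_smul_right j 0 g 0

theorem powerForm_sum_right {ι : Type*} (j : ℕ) (g : Lp ℂ 2 (surfaceMeasure n)) (t : Finset ι)
    (f : ι → Lp ℂ 2 (surfaceMeasure n)) :
    powerForm j g (∑ i ∈ t, f i) = ∑ i ∈ t, powerForm j g (f i) := by
  classical
  induction t using Finset.induction_on with
  | empty => simp [powerForm_zero_right]
  | insert a t ha ih => rw [Finset.sum_insert ha, powerForm_add_right, ih, Finset.sum_insert ha]

/-- The space of restrictions to the sphere of polynomials of degree less than `m`, as the span of
powers of linear forms. -/
noncomputable def polySpace (n m : ℕ) : Submodule ℂ (Lp ℂ 2 (surfaceMeasure n)) :=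
  Submodule.span ℂ {f | ∃ l < m, ∃ η : Eucl n, ‖η‖ = 1 ∧ f = continuousToLp n (linearPow η l)}

theorem linearPow_mem_polySpace {m l : ℕ} (hl : l < m) {η : Eucl n} (hη : ‖η‖ = 1) :
    continuousToLp n (linearPow η l) ∈ polySpace n m :=
  Submodule.subset_span ⟨l, hl, η, hη, rfl⟩

theorem polySpace_mono : Monotone (polySpace n) := fun _ _ h =>
  Submodule.span_mono fun _ ⟨l, hl, η, hη, hf⟩ => ⟨l, hl.trans_le h, η, hη, hf⟩

theorem polySpace_zero (n : ℕ) : polySpace n 0 = ⊥ := by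
  rw [polySpace, Submodule.span_eq_bot]
  rintro _ ⟨l, hl, -⟩
  exact absurd hl (Nat.not_lt_zero l)

/-- A monomial on the sphere, with the list `p` of its indices. -/
noncomputable def monomialFun (n l : ℕ) (p : Fin l → Fin n) : C(Sph n, ℂ) :=
  ⟨fun ω => ∏ i, (((ω : Eucl n) (p i) : ℝ) : ℂ), by fun_prop⟩

theorem linearPow_eq_sum (η : Eucl n) (l : ℕ) :
    linearPow η l = ∑ p : Fin l → Fin n, (∏ i, ((η (p i) : ℝ) : ℂ)) • monomialFun n l p := by
  ext ω
  rw [linearPow_apply, PiLp.inner_apply]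
  simp only [RCLike.inner_apply, conj_trivial]
  push_cast
  rw [Fintype.sum_pow, ContinuousMap.sum_apply]
  refine Finset.sum_congr rfl fun p _ => ?_
  rw [Finset.prod_mul_distrib, mul_comm]
  rfl

instance (n m : ℕ) : FiniteDimensional ℂ (polySpace n m) := by
  let S := Submodule.span ℂ (Set.range fun q : Σ l : Fin m, (Fin l → Fin n) =>
    continuousToLp n (monomialFun n q.1 q.2))
  have : FiniteDimensional ℂ S := FiniteDimensional.span_of_finite ℂ (Set.finite_range _)
  refine Submodule.finiteDimensional_of_le (S₂ := S) ?_
  rw [polySpace, Submodule.span_le]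
  rintro _ ⟨l, hl, η, -, rfl⟩
  rw [linearPow_eq_sum, map_sum]
  refine S.sum_mem fun p _ => ?_
  rw [map_smul]
  exact S.smul_mem _ (Submodule.subset_span ⟨⟨⟨l, hl⟩, p⟩, rfl⟩)

/-- The component of degree `m` of a function on the sphere in the decomposition into spherical
harmonics, as the difference of two projections to spaces of polynomials. -/
noncomputable def harmonicPart (m : ℕ) (h : Lp ℂ 2 (surfaceMeasure n)) :
    Lp ℂ 2 (surfaceMeasure n) :=
  (polySpace n (m + 1)).starProjection h - (polySpace n m).starProjection h

theorem harmonicPart_mem (m : ℕ) (h : Lp ℂ 2 (surfaceMeasure n)) :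
    harmonicPart m h ∈ polySpace n (m + 1) :=
  Submodule.sub_mem _ (Submodule.starProjection_apply_mem _ _)
    (polySpace_mono (Nat.le_succ m) (Submodule.starProjection_apply_mem _ _))

theorem harmonicPart_mem_orthogonal (m : ℕ) (h : Lp ℂ 2 (surfaceMeasure n)) :
    harmonicPart m h ∈ (polySpace n m)ᗮ := by
  have h1 : harmonicPart m h = (h - (polySpace n m).starProjection h) -
      (h - (polySpace n (m + 1)).starProjection h) := by rw [harmonicPart]; abel
  rw [h1]
  exact Submodule.sub_mem _ (Submodule.sub_starProjection_mem_orthogonal _)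
    (Submodule.orthogonal_le (polySpace_mono (Nat.le_succ m))
      (Submodule.sub_starProjection_mem_orthogonal _))

theorem inner_harmonicPart (m : ℕ) (h : Lp ℂ 2 (surfaceMeasure n)) :
    ⟪h, harmonicPart m h⟫_ℂ = ((‖harmonicPart m h‖ ^ 2 : ℝ) : ℂ) := by
  have h1 : h = harmonicPart m h + (polySpace n m).starProjection h +
      (h - (polySpace n (m + 1)).starProjection h) := by rw [harmonicPart]; abel
  have h2 : ⟪(polySpace n m).starProjection h, harmonicPart m h⟫_ℂ = 0 :=
    harmonicPart_mem_orthogonal m h _ (Submodule.starProjection_apply_mem _ _)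
  have h3 : ⟪h - (polySpace n (m + 1)).starProjection h, harmonicPart m h⟫_ℂ = 0 :=
    Submodule.inner_left_of_mem_orthogonal (harmonicPart_mem m h)
      (Submodule.sub_starProjection_mem_orthogonal _)
  calc ⟪h, harmonicPart m h⟫_ℂ = ⟪harmonicPart m h + (polySpace n m).starProjection h +
      (h - (polySpace n (m + 1)).starProjection h), harmonicPart m h⟫_ℂ := by rw [← h1]
    _ = ⟪harmonicPart m h, harmonicPart m h⟫_ℂ := by
      rw [inner_add_left, inner_add_left, h2, h3, add_zero, add_zero]
    _ = _ := by rw [inner_self_eq_norm_sq_to_K]; simp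

theorem sum_harmonicPart (M : ℕ) (h : Lp ℂ 2 (surfaceMeasure n)) :
    ∑ m ∈ Finset.range M, harmonicPart m h = (polySpace n M).starProjection h := by
  simp only [harmonicPart]
  rw [Finset.sum_range_sub fun m => (polySpace n m).starProjection h]
  simp [polySpace_zero]

theorem sum_norm_harmonicPart_sq (M : ℕ) (h : Lp ℂ 2 (surfaceMeasure n)) :
    ∑ m ∈ Finset.range M, ‖harmonicPart m h‖ ^ 2 = ‖(polySpace n M).starProjection h‖ ^ 2 := by
  induction M with
  | zero => simp [polySpace_zero]
  | succ M ih =>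
    have h1 : (polySpace n (M + 1)).starProjection h =
        (polySpace n M).starProjection h + harmonicPart M h := by rw [harmonicPart]; abel
    rw [Finset.sum_range_succ, ih, h1, norm_add_sq_of_inner_eq_zero]
    exact harmonicPart_mem_orthogonal M h _ (Submodule.starProjection_apply_mem _ _)

/-- Bessel's inequality for the decomposition into spherical harmonics. -/
theorem sum_norm_harmonicPart_sq_le (M : ℕ) (h : Lp ℂ 2 (surfaceMeasure n)) :
    ∑ m ∈ Finset.range M, ‖harmonicPart m h‖ ^ 2 ≤ ‖h‖ ^ 2 := by
  rw [sum_norm_harmonicPart_sq]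
  gcongr
  exact Submodule.norm_starProjection_apply_le _ _

theorem powerForm_eq_zero (j : ℕ) {h : Lp ℂ 2 (surfaceMeasure n)}
    (hh : h ∈ (polySpace n (j + 1))ᗮ) (g : Lp ℂ 2 (surfaceMeasure n)) : powerForm j g h = 0 := by
  rw [powerForm]
  simp_rw [integral_pow_mul_eq_inner]
  have h1 : ∀ θ : Sph n, ⟪continuousToLp n (linearPow (θ : Eucl n) j), h⟫_ℂ = 0 := fun θ =>
    hh _ (linearPow_mem_polySpace (Nat.lt_succ_self j) (by simp))
  simp [h1]

variable [NeZero n]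

theorem powerForm_linearPow (j m : ℕ) : ∃ b : ℕ → ℝ, ∀ η : Eucl n, ‖η‖ = 1 →
    ∀ g : Lp ℂ 2 (surfaceMeasure n), powerForm j g (continuousToLp n (linearPow η m)) =
      ⟪g, (powerEigenvalue n m j : ℂ) • continuousToLp n (linearPow η m) +
        ∑ l ∈ Finset.range m, (b l : ℂ) • continuousToLp n (linearPow η l)⟫_ℂ := by
  obtain ⟨b, hb⟩ := exists_integral_inner_pow_mul_inner_pow n j m
  refine ⟨b, fun η hη g => ?_⟩
  rw [← map_smul, Finset.sum_congr rfl fun l _ => (map_smul (continuousToLp n) (b l : ℂ)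
    (linearPow η l)).symm, ← map_sum, ← map_add, inner_continuousToLp_right, powerForm]
  refine integral_congr_ae (Filter.Eventually.of_forall fun θ => ?_)
  dsimp only
  congr 1
  have h1 : ∫ ω : Sph n, ((⟪(θ : Eucl n), (ω : Eucl n)⟫_ℝ : ℝ) : ℂ) ^ j *
      continuousToLp n (linearPow η m) ω ∂(surfaceMeasure n) =
      ∫ ω : Sph n, ((⟪(θ : Eucl n), (ω : Eucl n)⟫_ℝ ^ j * ⟪η, (ω : Eucl n)⟫_ℝ ^ m : ℝ) : ℂ)
        ∂(surfaceMeasure n) := by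
    refine integral_congr_ae ?_
    filter_upwards [coeFn_continuousToLp (linearPow η m)] with ω hω
    rw [hω, linearPow_apply]
    push_cast
    rfl
  rw [h1, integral_complex_ofReal, hb θ η (by simp) hη]
  simp [linearPow_apply]

/-- The form with the kernel `(θ · ω)^j` acts on polynomials of degree `m` as the scalar
`powerEigenvalue n m j`, up to polynomials of lower degree. -/
theorem exists_powerForm_eq_inner (j m : ℕ) {h : Lp ℂ 2 (surfaceMeasure n)}
    (hh : h ∈ polySpace n (m + 1)) : ∃ r ∈ polySpace n m,
      ∀ g, powerForm j g h = ⟪g, (powerEigenvalue n m j : ℂ) • h + r⟫_ℂ := by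
  induction hh using Submodule.span_induction with
  | mem f hf =>
    obtain ⟨l, hl, η, hη, rfl⟩ := hf
    obtain ⟨b, hb⟩ := powerForm_linearPow (n := n) j l
    refine ⟨((powerEigenvalue n l j : ℂ) - powerEigenvalue n m j) •
      continuousToLp n (linearPow η l) +
        ∑ k ∈ Finset.range l, (b k : ℂ) • continuousToLp n (linearPow η k), ?_, fun g => ?_⟩
    · refine Submodule.add_mem _ ?_ (Submodule.sum_mem _ fun k hk => Submodule.smul_mem _ _
        (linearPow_mem_polySpace ((Finset.mem_range.mp hk).trans_le (Nat.lt_succ_iff.mp hl)) hη))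
      rcases (Nat.lt_succ_iff.mp hl).eq_or_lt with rfl | hlt
      · simp
      · exact Submodule.smul_mem _ _ (linearPow_mem_polySpace hlt hη)
    · rw [hb η hη, ← add_assoc, ← add_smul, add_sub_cancel]
  | zero => exact ⟨0, Submodule.zero_mem _, fun g => by simp [powerForm_zero_right]⟩
  | add x y _ _ hx hy =>
    obtain ⟨r, hr, hr'⟩ := hx
    obtain ⟨q, hq, hq'⟩ := hy
    refine ⟨r + q, Submodule.add_mem _ hr hq, fun g => ?_⟩
    rw [powerForm_add_right, hr', hq', ← inner_add_right]
    congr 1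
    module
  | smul c x _ hx =>
    obtain ⟨r, hr, hr'⟩ := hx
    refine ⟨c • r, Submodule.smul_mem _ _ hr, fun g => ?_⟩
    rw [powerForm_smul_right, hr', ← inner_smul_right]
    congr 1
    module

/-- Since the form with the kernel `(θ · ω)^j` is Hermitian, its triangular action on powers of
linear forms is diagonal on the orthogonal differences of the spaces of polynomials. -/
theorem powerForm_eq_mul_inner (j m : ℕ) {h : Lp ℂ 2 (surfaceMeasure n)}
    (hh : h ∈ polySpace n (m + 1)) (hh' : h ∈ (polySpace n m)ᗮ)
    (g : Lp ℂ 2 (surfaceMeasure n)) :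
    powerForm j g h = powerEigenvalue n m j * ⟪g, h⟫_ℂ := by
  obtain ⟨r, hr, hr'⟩ := exists_powerForm_eq_inner j m hh
  obtain ⟨q, hq, hq'⟩ := exists_powerForm_eq_inner j m (polySpace_mono (Nat.le_succ m) hr)
  -- `⟪r, K h⟫ = ⟪K r, h⟫ = 0` for the operator `K` of the form, as `K r` has degree less than `m`
  have h1 : ⟪r, r⟫_ℂ = 0 := by
    have h2 := hr' r
    rw [← powerForm_conj_symm, hq', inner_add_right, inner_add_right, inner_smul_right,
      inner_smul_right, hh' r hr, ← inner_conj_symm h r, hh' r hr, ← inner_conj_symm h q,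
      hh' q hq] at h2
    simpa using h2.symm
  rw [hr', inner_self_eq_zero.mp h1, add_zero, inner_smul_right]

/-- The form with the kernel `(θ · ω)^j` in terms of the harmonic components, of which only those
of degree at most `j` contribute. -/
theorem powerForm_self (j : ℕ) (h : Lp ℂ 2 (surfaceMeasure n)) :
    powerForm j h h = ((∑ m ∈ Finset.range (j + 1),
      powerEigenvalue n m j * ‖harmonicPart m h‖ ^ 2 : ℝ) : ℂ) := by
  have h1 : powerForm j h h = powerForm j h ((polySpace n (j + 1)).starProjection h) +
      powerForm j h (h - (polySpace n (j + 1)).starProjection h) := by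
    rw [← powerForm_add_right, add_sub_cancel]
  rw [h1, powerForm_eq_zero j (Submodule.sub_starProjection_mem_orthogonal _), add_zero,
    ← sum_harmonicPart, powerForm_sum_right]
  push_cast
  refine Finset.sum_congr rfl fun m _ => ?_
  rw [powerForm_eq_mul_inner j m (harmonicPart_mem m h) (harmonicPart_mem_orthogonal m h),
    inner_harmonicPart]
  push_cast
  rfl

end PowerKernels

/-! ### Fourier transforms of densities on the sphere -/

section Extension

open scoped InnerProductSpace

variable {n : ℕ}

/-- The Fourier transform of the measure `h dσ`, for a function `h` on the sphere. -/
noncomputable def sphereFourier (h : Lp ℂ 2 (surfaceMeasure n)) (ξ : Eucl n) : ℂ :=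
  ∫ ω : Sph n, Complex.exp (-Complex.I * ((⟪(ω : Eucl n), ξ⟫_ℝ : ℝ) : ℂ)) * h ω
    ∂(surfaceMeasure n)

theorem norm_exp_neg_I_mul (t : ℝ) : ‖Complex.exp (-Complex.I * (t : ℂ))‖ = 1 := by
  rw [show -Complex.I * (t : ℂ) = ((-t : ℝ) : ℂ) * Complex.I by push_cast; ring]
  exact Complex.norm_exp_ofReal_mul_I _

theorem integrable_exp_mul (h : Lp ℂ 2 (surfaceMeasure n)) (ξ : Eucl n) :
    Integrable (fun ω : Sph n => Complex.exp (-Complex.I * ((⟪(ω : Eucl n), ξ⟫_ℝ : ℝ) : ℂ)) * h ω)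
      (surfaceMeasure n) :=
  integrable_continuous_mul (by fun_prop) (integrable_coeFn h)

theorem continuous_sphereFourier (h : Lp ℂ 2 (surfaceMeasure n)) :
    Continuous (sphereFourier h) := by
  refine continuous_of_dominated (bound := fun ω => ‖h ω‖)
    (fun ξ => (integrable_exp_mul h ξ).aestronglyMeasurable)
    (fun ξ => Filter.Eventually.of_forall fun ω => ?_) (integrable_coeFn h).norm
    (Filter.Eventually.of_forall fun ω => by fun_prop)
  rw [norm_mul, norm_exp_neg_I_mul, one_mul]

theorem sphereFourier_add (h k : Lp ℂ 2 (surfaceMeasure n)) (ξ : Eucl n) :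
    sphereFourier (h + k) ξ = sphereFourier h ξ + sphereFourier k ξ := by
  rw [sphereFourier, sphereFourier, sphereFourier,
    ← integral_add (integrable_exp_mul h ξ) (integrable_exp_mul k ξ)]
  refine integral_congr_ae ?_
  filter_upwards [Lp.coeFn_add h k] with ω hω
  rw [hω, Pi.add_apply, mul_add]

theorem sphereFourier_smul (c : ℂ) (h : Lp ℂ 2 (surfaceMeasure n)) (ξ : Eucl n) :
    sphereFourier (c • h) ξ = c * sphereFourier h ξ := by
  rw [sphereFourier, sphereFourier, ← integral_const_mul]
  refine integral_congr_ae ?_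
  filter_upwards [Lp.coeFn_smul c h] with ω hω
  rw [hω, Pi.smul_apply, smul_eq_mul]
  ring

theorem norm_sq_sphereFourier (h : Lp ℂ 2 (surfaceMeasure n)) (ξ : Eucl n) :
    ((‖sphereFourier h ξ‖ ^ 2 : ℝ) : ℂ) = ∫ p : Sph n × Sph n,
      Complex.exp (Complex.I * ((⟪(p.1 : Eucl n) - p.2, ξ⟫_ℝ : ℝ) : ℂ)) *
        ((starRingEnd ℂ) (h p.1) * h p.2) ∂((surfaceMeasure n).prod (surfaceMeasure n)) := by
  rw [← Complex.normSq_eq_norm_sq, Complex.normSq_eq_conj_mul_self]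
  simp only [sphereFourier]
  rw [← integral_conj, ← integral_prod_mul]
  refine integral_congr_ae (Filter.Eventually.of_forall fun p => ?_)
  simp only [map_mul, ← Complex.exp_conj, map_neg, Complex.conj_I, Complex.conj_ofReal, neg_neg,
    inner_sub_left, Complex.ofReal_sub, mul_sub]
  rw [sub_eq_add_neg, Complex.exp_add]
  ring_nf

theorem integral_exp_neg_mul_norm_sq_mul {u : ℝ} (hu : 0 < u) (z : Eucl n) :
    ∫ ξ : Eucl n, ((Real.exp (-(‖ξ‖ ^ 2 * u)) : ℝ) : ℂ) *
        Complex.exp (Complex.I * ((⟪z, ξ⟫_ℝ : ℝ) : ℂ)) =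
      (((Real.pi / u) ^ ((n : ℝ) / 2) * Real.exp (-‖z‖ ^ 2 / (4 * u)) : ℝ) : ℂ) := by
  have h := GaussianFourier.integral_cexp_neg_mul_sq_norm_add (V := Eucl n) (b := (u : ℂ))
    (by simpa using hu) Complex.I z
  convert h using 1
  · refine integral_congr_ae (Filter.Eventually.of_forall fun ξ => ?_)
    simp only [Complex.ofReal_exp, ← Complex.exp_add]
    push_cast
    congr 1
    ring
  · rw [Complex.ofReal_mul, Complex.ofReal_cpow (by positivity)]
    push_cast
    simp only [finrank_euclideanSpace, Fintype.card_fin]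
    congr 2
    rw [Complex.I_sq]
    ring

theorem norm_sub_sq_sphere (θ ω : Sph n) :
    ‖(θ : Eucl n) - ω‖ ^ 2 = 2 - 2 * ⟪(θ : Eucl n), (ω : Eucl n)⟫_ℝ := by
  rw [norm_sub_sq_real]; simp; ring

theorem abs_inner_sphere_le (θ ω : Sph n) : |⟪(θ : Eucl n), (ω : Eucl n)⟫_ℝ| ≤ 1 := by
  simpa using abs_real_inner_le_norm (θ : Eucl n) (ω : Eucl n)

theorem integrable_exp_neg_norm_sq_mul {u : ℝ} (hu : 0 < u) :
    Integrable fun ξ : Eucl n => Real.exp (-(‖ξ‖ ^ 2 * u)) := by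
  have h := (GaussianFourier.integrable_cexp_neg_mul_sq_norm_add (V := Eucl n) (b := (u : ℂ))
    (by simpa using hu) 0 0).norm
  refine h.congr (Filter.Eventually.of_forall fun ξ => ?_)
  simp only [zero_mul, add_zero]
  rw [Complex.norm_exp]
  congr 1
  rw [show -(u : ℂ) * (‖ξ‖ : ℂ) ^ 2 = ((-(‖ξ‖ ^ 2 * u) : ℝ) : ℂ) by push_cast; ring]
  exact Complex.ofReal_re _

theorem integrable_gaussian_mul_norm_sq_sphereFourier (h : Lp ℂ 2 (surfaceMeasure n)) {u : ℝ}
    (hu : 0 < u) :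
    Integrable fun ξ : Eucl n => Real.exp (-(‖ξ‖ ^ 2 * u)) * ‖sphereFourier h ξ‖ ^ 2 := by
  have h1 : ∀ ξ, ‖sphereFourier h ξ‖ ≤ ∫ ω, ‖h ω‖ ∂(surfaceMeasure n) := fun ξ => by
    refine (norm_integral_le_integral_norm _).trans_eq ?_
    simp_rw [norm_mul, norm_exp_neg_I_mul, one_mul]
  refine (integrable_exp_neg_norm_sq_mul hu).mul_bdd (c := (∫ ω, ‖h ω‖ ∂(surfaceMeasure n)) ^ 2)
    (by have := continuous_sphereFourier h; fun_prop) (Filter.Eventually.of_forall fun ξ => ?_)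
  rw [norm_pow, norm_norm]
  gcongr
  exact h1 ξ

/-- Integrated against a Gaussian, `|ĥdσ|²` becomes the quadratic form with the heat kernel
`e^{-|θ - ω|² / 4u}` on the sphere. -/
theorem integral_gaussian_mul_norm_sq_sphereFourier (h : Lp ℂ 2 (surfaceMeasure n)) {u : ℝ}
    (hu : 0 < u) :
    ((∫ ξ : Eucl n, Real.exp (-(‖ξ‖ ^ 2 * u)) * ‖sphereFourier h ξ‖ ^ 2 : ℝ) : ℂ) =
      ∫ p : Sph n × Sph n, (((Real.pi / u) ^ ((n : ℝ) / 2) * Real.exp (-(2 * u)⁻¹) : ℝ) : ℂ) *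
        (Complex.exp (((2 * u)⁻¹ * ⟪(p.1 : Eucl n), (p.2 : Eucl n)⟫_ℝ : ℝ) : ℂ) *
          ((starRingEnd ℂ) (h p.1) * h p.2)) ∂((surfaceMeasure n).prod (surfaceMeasure n)) := by
  rw [← integral_complex_ofReal]
  simp_rw [Complex.ofReal_mul, norm_sq_sphereFourier, ← integral_const_mul]
  have hint : Integrable (Function.uncurry fun (ξ : Eucl n) (p : Sph n × Sph n) =>
      ((Real.exp (-(‖ξ‖ ^ 2 * u)) : ℝ) : ℂ) *
        (Complex.exp (Complex.I * ((⟪(p.1 : Eucl n) - p.2, ξ⟫_ℝ : ℝ) : ℂ)) *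
        ((starRingEnd ℂ) (h p.1) * h p.2)))
      ((volume : Measure (Eucl n)).prod ((surfaceMeasure n).prod (surfaceMeasure n))) := by
    have h1 := (integrable_exp_neg_norm_sq_mul (n := n) hu).ofReal (𝕜 := ℂ) |>.mul_prod
      ((integrable_conj_coeFn h).mul_prod (integrable_coeFn h))
    have h2 := h1.bdd_mul (c := 1) (f := fun q : Eucl n × (Sph n × Sph n) =>
      Complex.exp (Complex.I * ((⟪(q.2.1 : Eucl n) - q.2.2, q.1⟫_ℝ : ℝ) : ℂ)))
      (Continuous.aestronglyMeasurable (by fun_prop))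
      (Filter.Eventually.of_forall fun q => by
        rw [mul_comm]; exact (Complex.norm_exp_ofReal_mul_I _).le)
    refine h2.congr (Filter.Eventually.of_forall fun q => ?_)
    simp only [Function.uncurry]
    exact mul_left_comm _ _ _
  rw [integral_integral_swap hint]
  refine integral_congr_ae (Filter.Eventually.of_forall fun p => ?_)
  simp only [← mul_assoc _ _ ((starRingEnd ℂ) (h p.1) * h p.2)]
  rw [integral_mul_const, integral_exp_neg_mul_norm_sq_mul hu, ← Complex.ofReal_mul (2 * u)⁻¹,
    ← Complex.ofReal_exp, ← Complex.ofReal_mul, ← Complex.ofReal_mul, mul_assoc _ (Real.exp _),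
    ← Real.exp_add, norm_sub_sq_sphere]
  congr 4
  field_simp
  ring

/-- The expansion of the kernel `e^{c θ · ω}` in powers of `θ · ω`. -/
theorem hasSum_powerForm (h : Lp ℂ 2 (surfaceMeasure n)) (c : ℝ) :
    HasSum (fun j : ℕ => ((c ^ j / j.factorial : ℝ) : ℂ) * powerForm j h h)
      (∫ p : Sph n × Sph n, Complex.exp ((c * ⟪(p.1 : Eucl n), (p.2 : Eucl n)⟫_ℝ : ℝ) : ℂ) *
          ((starRingEnd ℂ) (h p.1) * h p.2) ∂((surfaceMeasure n).prod (surfaceMeasure n))) := by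
  have hI := (integrable_conj_coeFn h).mul_prod (integrable_coeFn h)
  have hexp : ∀ z : ℂ, HasSum (fun k : ℕ => z ^ k / (k.factorial : ℂ)) (Complex.exp z) := by
    intro u
    rw [Complex.exp_eq_exp_ℂ]
    exact NormedSpace.expSeries_div_hasSum_exp u
  have hsum : Summable fun j : ℕ => |c| ^ j / (j.factorial : ℝ) :=
    Real.summable_pow_div_factorial _
  have := hasSum_integral_of_dominated_convergence
    (μ := (surfaceMeasure n).prod (surfaceMeasure n))
    (F := fun (j : ℕ) p => ((c * ⟪(p.1 : Eucl n), (p.2 : Eucl n)⟫_ℝ : ℝ) : ℂ) ^ j / j.factorial *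
      ((starRingEnd ℂ) (h p.1) * h p.2))
    (f := fun p => Complex.exp ((c * ⟪(p.1 : Eucl n), (p.2 : Eucl n)⟫_ℝ : ℝ) : ℂ) *
          ((starRingEnd ℂ) (h p.1) * h p.2))
    (fun (j : ℕ) p => |c| ^ j / j.factorial * ‖(starRingEnd ℂ) (h p.1) * h p.2‖)
    (fun j => (Continuous.aestronglyMeasurable (by fun_prop)).mul hI.aestronglyMeasurable)
    (fun j => Filter.Eventually.of_forall fun p => ?_)
    (Filter.Eventually.of_forall fun p => hsum.mul_right _) ?_
    (Filter.Eventually.of_forall fun p => (hexp _).mul_right _)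
  · convert! this using 2 with j
    rw [powerForm_eq_integral_prod, ← integral_const_mul]
    refine integral_congr_ae (Filter.Eventually.of_forall fun p => ?_)
    simp only
    push_cast
    rw [mul_pow]
    ring
  · rw [norm_mul, norm_div, norm_pow, Complex.norm_real, Complex.norm_natCast, Real.norm_eq_abs,
      abs_mul]
    gcongr
    exact mul_le_of_le_one_right (abs_nonneg c) (abs_inner_sphere_le _ _)
  · simp_rw [tsum_mul_right]
    exact hI.norm.const_mul _

/-- The Gamma integral after the substitution `v = 1 / u`. -/
theorem lintegral_rpow_mul_exp_neg_inv {q : ℝ} (hq : 0 < q) :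
    ∫⁻ u in Set.Ioi (0 : ℝ), ENNReal.ofReal (u ^ (-q - 1) * Real.exp (-(2 * u)⁻¹)) =
      ENNReal.ofReal (2 ^ q * Real.Gamma q) := by
  have hg : IntegrableOn (fun v : ℝ => v ^ (q - 1) * Real.exp (-(1 / 2 * v))) (Set.Ioi 0) := by
    have := integrableOn_rpow_mul_exp_neg_mul_rpow (p := 1) (s := q - 1) (by linarith) one_pos
      (show (0 : ℝ) < 1 / 2 by norm_num)
    simpa [IntegrableOn] using this
  have h1 := integral_comp_rpow_Ioi (fun v : ℝ => v ^ (q - 1) * Real.exp (-(1 / 2 * v)))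
    (p := -1) (by norm_num)
  have h2 := (integrableOn_Ioi_comp_rpow_iff
    (fun v : ℝ => v ^ (q - 1) * Real.exp (-(1 / 2 * v))) (p := -1) (by norm_num)).mpr hg
  have h3 : ∀ u ∈ Set.Ioi (0 : ℝ), (|(-1 : ℝ)| * u ^ ((-1 : ℝ) - 1)) •
      ((u ^ (-1 : ℝ)) ^ (q - 1) * Real.exp (-(1 / 2 * u ^ (-1 : ℝ)))) =
      u ^ (-q - 1) * Real.exp (-(2 * u)⁻¹) := by
    intro u hu
    have hu : 0 < u := hu
    rw [abs_neg, abs_one, one_mul, smul_eq_mul, ← mul_assoc, ← Real.rpow_mul hu.le,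
      ← Real.rpow_add hu, Real.rpow_neg_one, mul_inv, one_div]
    congr 2
    ring
  rw [setIntegral_congr_fun measurableSet_Ioi h3,
    Real.integral_rpow_mul_exp_neg_mul_Ioi hq (by norm_num)] at h1
  rw [integrableOn_congr_fun h3 measurableSet_Ioi] at h2
  rw [← ofReal_integral_eq_lintegral_ofReal h2, h1, one_div_one_div]
  filter_upwards [ae_restrict_mem measurableSet_Ioi] with u hu
  have : 0 < u := hu
  positivity

variable [NeZero n]

theorem powerEigenvalue_sum_nonneg (j : ℕ) (h : Lp ℂ 2 (surfaceMeasure n)) :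
    0 ≤ ∑ m ∈ Finset.range (j + 1), powerEigenvalue n m j * ‖harmonicPart m h‖ ^ 2 :=
  Finset.sum_nonneg fun m _ => mul_nonneg (powerEigenvalue_nonneg n m j) (sq_nonneg _)

theorem lintegral_gaussian_mul_norm_sq_sphereFourier (h : Lp ℂ 2 (surfaceMeasure n)) {u : ℝ}
    (hu : 0 < u) :
    ∫⁻ ξ : Eucl n, ENNReal.ofReal (Real.exp (-(‖ξ‖ ^ 2 * u)) * ‖sphereFourier h ξ‖ ^ 2) =
      ∑' j : ℕ, ENNReal.ofReal ((Real.pi / u) ^ ((n : ℝ) / 2) * Real.exp (-(2 * u)⁻¹) *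
        ((2 * u)⁻¹ ^ j / j.factorial * ∑ m ∈ Finset.range (j + 1),
          powerEigenvalue n m j * ‖harmonicPart m h‖ ^ 2)) := by
  have h1 := (hasSum_powerForm h (2 * u)⁻¹).mul_left
    (((Real.pi / u) ^ ((n : ℝ) / 2) * Real.exp (-(2 * u)⁻¹) : ℝ) : ℂ)
  rw [← integral_const_mul, ← integral_gaussian_mul_norm_sq_sphereFourier h hu] at h1
  simp_rw [powerForm_self, ← Complex.ofReal_mul] at h1
  rw [Complex.hasSum_ofReal] at h1
  rw [← ofReal_integral_eq_lintegral_ofReal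
    (integrable_gaussian_mul_norm_sq_sphereFourier h hu)
    (Filter.Eventually.of_forall fun ξ => by positivity), ← h1.tsum_eq,
    ENNReal.ofReal_tsum_of_nonneg _ h1.summable]
  intro j
  have := powerEigenvalue_sum_nonneg j h
  positivity

/-- The diagonalisation of the quadratic form `(2π)^{-n} ∫ |ξ|^{-2s} |ĥdσ|² dξ`. -/
theorem lintegral_rpow_norm_mul_norm_sq_sphereFourier {s : ℝ} (hs : 1 / 2 < s)
    (hs' : s < (n : ℝ) / 2) (h : Lp ℂ 2 (surfaceMeasure n)) :
    ENNReal.ofReal ((2 * Real.pi) ^ (-(n : ℝ))) *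
      ∫⁻ ξ : Eucl n, ENNReal.ofReal (‖ξ‖ ^ (-(2 * s)) * ‖sphereFourier h ξ‖ ^ 2) =
      ∑' m : ℕ, ENNReal.ofReal (traceEigenvalue n s m * ‖harmonicPart m h‖ ^ 2) := by
  have hs0 : 0 < s := by linarith
  have hG := Real.Gamma_pos_of_pos hs0
  have hcont := continuous_sphereFourier h
  have hne : ∀ᵐ ξ : Eucl n, ξ ≠ 0 := by simp [ae_iff]
  set p : ℕ → ℝ := fun j => ∑ m ∈ Finset.range (j + 1),
    powerEigenvalue n m j * ‖harmonicPart m h‖ ^ 2 with hp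
  have hp0 : ∀ j, 0 ≤ p j := fun j => powerEigenvalue_sum_nonneg j h
  -- `|ξ|^{-2s}` as a superposition of Gaussians, followed by Tonelli
  have h1 : ∫⁻ ξ : Eucl n, ENNReal.ofReal (‖ξ‖ ^ (-(2 * s)) * ‖sphereFourier h ξ‖ ^ 2) =
      ENNReal.ofReal (Real.Gamma s)⁻¹ * ∫⁻ u in Set.Ioi (0 : ℝ), ENNReal.ofReal (u ^ (s - 1)) *
        ∫⁻ ξ : Eucl n, ENNReal.ofReal (Real.exp (-(‖ξ‖ ^ 2 * u)) * ‖sphereFourier h ξ‖ ^ 2) := by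
    calc _ = ∫⁻ ξ : Eucl n, ∫⁻ u in Set.Ioi (0 : ℝ), ENNReal.ofReal ((Real.Gamma s)⁻¹ *
          (u ^ (s - 1) * (Real.exp (-(‖ξ‖ ^ 2 * u)) * ‖sphereFourier h ξ‖ ^ 2))) := by
          refine lintegral_congr_ae ?_
          filter_upwards [hne] with ξ hξ
          have hξ0 : 0 < ‖ξ‖ := norm_pos_iff.mpr hξ
          have h2 := lintegral_rpow_mul_exp_neg_mul hs0 (show 0 < ‖ξ‖ ^ 2 by positivity)
          have h3 : ‖ξ‖ ^ (-(2 * s)) * ‖sphereFourier h ξ‖ ^ 2 = ((Real.Gamma s)⁻¹ *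
              ‖sphereFourier h ξ‖ ^ 2) * ((‖ξ‖ ^ 2) ^ (-s) * Real.Gamma s) := by
            rw [← Real.rpow_natCast_mul hξ0.le]
            push_cast
            rw [mul_neg]
            field_simp
          rw [h3, ENNReal.ofReal_mul (by positivity), ← h2, ← lintegral_const_mul' _ _ (by simp)]
          refine setLIntegral_congr_fun measurableSet_Ioi fun u hu => ?_
          rw [← ENNReal.ofReal_mul (by positivity)]
          congr 1
          ring
      _ = ∫⁻ u in Set.Ioi (0 : ℝ), ∫⁻ ξ : Eucl n, ENNReal.ofReal ((Real.Gamma s)⁻¹ *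
          (u ^ (s - 1) * (Real.exp (-(‖ξ‖ ^ 2 * u)) * ‖sphereFourier h ξ‖ ^ 2))) :=
          lintegral_lintegral_swap (Measurable.aemeasurable (by
            unfold Function.uncurry
            have h5 : Measurable fun q : Eucl n × ℝ => sphereFourier h q.1 :=
              hcont.measurable.comp measurable_fst
            fun_prop))
      _ = _ := by
          rw [← lintegral_const_mul' _ _ (by simp)]
          refine setLIntegral_congr_fun measurableSet_Ioi fun u hu => ?_
          have hu : 0 < u := hu
          rw [← lintegral_const_mul' _ _ (by simp), ← lintegral_const_mul' _ _ (by simp)]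
          refine lintegral_congr fun ξ => ?_
          rw [← ENNReal.ofReal_mul (by positivity), ← ENNReal.ofReal_mul (by positivity)]
  -- expansion of the heat kernel, and integration in `u`
  have h2 : ENNReal.ofReal ((2 * Real.pi) ^ (-(n : ℝ))) *
      ∫⁻ ξ : Eucl n, ENNReal.ofReal (‖ξ‖ ^ (-(2 * s)) * ‖sphereFourier h ξ‖ ^ 2) =
      ∑' j, ENNReal.ofReal (rieszCoeff n s j * p j) := by
    have h3 : ∀ u ∈ Set.Ioi (0 : ℝ), ENNReal.ofReal (u ^ (s - 1)) *
        ∫⁻ ξ : Eucl n, ENNReal.ofReal (Real.exp (-(‖ξ‖ ^ 2 * u)) * ‖sphereFourier h ξ‖ ^ 2) =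
        ∑' j : ℕ, ENNReal.ofReal (Real.pi ^ ((n : ℝ) / 2) * 2⁻¹ ^ j / j.factorial * p j) *
          ENNReal.ofReal (u ^ (-(((n : ℝ) - 2 * s) / 2 + j) - 1) * Real.exp (-(2 * u)⁻¹)) := by
      intro u hu
      have hu : 0 < u := hu
      rw [lintegral_gaussian_mul_norm_sq_sphereFourier h hu, ← ENNReal.tsum_mul_left]
      refine tsum_congr fun j => ?_
      have := hp0 j
      rw [← ENNReal.ofReal_mul (by positivity), ← ENNReal.ofReal_mul (by positivity)]
      congr 1
      have e1 : u ^ (-(((n : ℝ) - 2 * s) / 2 + j) - 1) =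
          u ^ (s - 1) * (u ^ ((n : ℝ) / 2))⁻¹ * (u ^ j)⁻¹ := by
        rw [← Real.rpow_natCast u j, ← Real.rpow_neg hu.le, ← Real.rpow_neg hu.le,
          ← Real.rpow_add hu, ← Real.rpow_add hu]
        congr 1
        ring
      rw [e1, Real.div_rpow Real.pi_pos.le hu.le, mul_inv, mul_pow, inv_pow u]
      simp only [hp]
      field_simp
    rw [h1, setLIntegral_congr_fun measurableSet_Ioi h3, lintegral_tsum (fun j => by fun_prop),
      ← ENNReal.tsum_mul_left, ← ENNReal.tsum_mul_left]
    refine tsum_congr fun j => ?_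
    have := hp0 j
    have ha : 0 < ((n : ℝ) - 2 * s) / 2 + j := by
      have : 0 < (n : ℝ) - 2 * s := by linarith
      positivity
    rw [lintegral_const_mul' _ _ (by simp), lintegral_rpow_mul_exp_neg_inv ha,
      ← ENNReal.ofReal_mul (by positivity), ← ENNReal.ofReal_mul (by positivity),
      ← ENNReal.ofReal_mul (by positivity), rieszCoeff, Real.rpow_add two_pos, Real.rpow_natCast]
    congr 1
    have : (2 : ℝ)⁻¹ ^ j * 2 ^ j = 1 := by rw [← mul_pow]; norm_num
    linear_combination ((2 * Real.pi) ^ (-(n : ℝ)) * (Real.Gamma s)⁻¹ * Real.pi ^ ((n : ℝ) / 2) /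
      j.factorial * p j * 2 ^ (((n : ℝ) - 2 * s) / 2) *
        Real.Gamma (((n : ℝ) - 2 * s) / 2 + j)) * this
  have h4 : ∀ j, ENNReal.ofReal (rieszCoeff n s j * p j) = ∑' m,
      ENNReal.ofReal (rieszCoeff n s j * powerEigenvalue n m j) *
        ENNReal.ofReal (‖harmonicPart m h‖ ^ 2) := by
    intro j
    have hr := rieszCoeff_nonneg hs0 hs' j
    rw [tsum_eq_sum (s := Finset.range (j + 1))]
    · rw [hp, Finset.mul_sum, ENNReal.ofReal_sum_of_nonneg]
      · refine Finset.sum_congr rfl fun m _ => ?_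
        have := powerEigenvalue_nonneg n m j
        rw [← ENNReal.ofReal_mul (by positivity), mul_assoc]
      · intro m _
        have := powerEigenvalue_nonneg n m j
        positivity
    · intro m hm
      rw [powerEigenvalue_eq_zero_of_lt (by simpa using hm)]
      simp
  rw [h2]
  simp_rw [h4]
  rw [ENNReal.tsum_comm]
  refine tsum_congr fun m => ?_
  rw [ENNReal.tsum_mul_right, tsum_rieszCoeff_mul_powerEigenvalue hs hs',
    ENNReal.ofReal_mul (traceEigenvalue_pos hs hs' m).le]

end Extension

/-! ### The extension operator and its spectrum -/

section ExtensionOperator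

open scoped InnerProductSpace

variable {n : ℕ}

theorem ofReal_norm_sq_eq_lintegral {α : Type*} [MeasurableSpace α] {μ : Measure α}
    (f : Lp ℂ 2 μ) : ENNReal.ofReal (‖f‖ ^ 2) = ∫⁻ x, ENNReal.ofReal (‖f x‖ ^ 2) ∂μ := by
  have h1 : ‖f‖ ^ 2 = ∫ x, ‖f x‖ ^ 2 ∂μ := by
    rw [← real_inner_self_eq_norm_sq, L2.inner_def]
    simp_rw [real_inner_self_eq_norm_sq]
  rw [h1, ofReal_integral_eq_lintegral_ofReal]
  · exact (memLp_two_iff_integrable_sq_norm (Lp.memLp f).1).mp (Lp.memLp f)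
  · exact Filter.Eventually.of_forall fun x => sq_nonneg _

/-- The function `(2π)^{-n/2} |ξ|^{-s} ĥdσ(ξ)`. -/
noncomputable def extensionFun (s : ℝ) (h : Lp ℂ 2 (surfaceMeasure n)) (ξ : Eucl n) : ℂ :=
  (((2 * Real.pi) ^ (-(n : ℝ) / 2) * ‖ξ‖ ^ (-s) : ℝ) : ℂ) * sphereFourier h ξ

theorem measurable_extensionFun (s : ℝ) (h : Lp ℂ 2 (surfaceMeasure n)) :
    Measurable (extensionFun s h) := by
  have := (continuous_sphereFourier h).measurable
  unfold extensionFun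
  fun_prop

theorem norm_extensionFun_sq (s : ℝ) (h : Lp ℂ 2 (surfaceMeasure n)) (ξ : Eucl n) :
    ‖extensionFun s h ξ‖ ^ 2 =
      (2 * Real.pi) ^ (-(n : ℝ)) * (‖ξ‖ ^ (-(2 * s)) * ‖sphereFourier h ξ‖ ^ 2) := by
  rw [extensionFun, norm_mul, Complex.norm_real, Real.norm_of_nonneg (by positivity), mul_pow,
    mul_pow, ← Real.rpow_mul_natCast (by positivity), ← Real.rpow_mul_natCast (by positivity)]
  push_cast
  ring_nf

theorem harmonicPart_eq_zero {k m : ℕ} (hm : m < k) {h : Lp ℂ 2 (surfaceMeasure n)}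
    (hh : h ∈ (polySpace n k)ᗮ) : harmonicPart m h = 0 := by
  rw [harmonicPart, (Submodule.starProjection_apply_eq_zero_iff _).mpr
    (Submodule.orthogonal_le (polySpace_mono hm) hh),
    (Submodule.starProjection_apply_eq_zero_iff _).mpr
    (Submodule.orthogonal_le (polySpace_mono hm.le) hh), sub_zero]

theorem tsum_traceEigenvalue_eq (s : ℝ) {k : ℕ} {h : Lp ℂ 2 (surfaceMeasure n)}
    (hh : h ∈ (polySpace n k)ᗮ) (hh' : h ∈ polySpace n (k + 1)) :
    ∑' m : ℕ, ENNReal.ofReal (traceEigenvalue n s m * ‖harmonicPart m h‖ ^ 2) =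
      ENNReal.ofReal (traceEigenvalue n s k * ‖h‖ ^ 2) := by
  rw [tsum_eq_single k]
  · rw [harmonicPart, (Submodule.starProjection_apply_eq_zero_iff _).mpr hh,
      Submodule.starProjection_eq_self_iff.mpr hh', sub_zero]
  · intro m hm
    rcases hm.lt_or_gt with hm | hm
    · simp [harmonicPart_eq_zero hm hh]
    · have h1 : ∀ l, k < l → (polySpace n l).starProjection h = h := fun l hl =>
        Submodule.starProjection_eq_self_iff.mpr (polySpace_mono hl hh')
      simp [harmonicPart, h1 m hm, h1 (m + 1) (by omega)]

/-- The constant functions on the sphere. -/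
noncomputable def constantSpace (n : ℕ) : Submodule ℂ (Lp ℂ 2 (surfaceMeasure n)) :=
  Submodule.span ℂ {continuousToLp n 1}

/-- The restriction to the sphere of a linear form with complex coefficients. -/
noncomputable def linearForm (n : ℕ) : (Fin n → ℂ) →ₗ[ℂ] C(Sph n, ℂ) where
  toFun y := ⟨fun ω => ∑ i, y i * (((ω : Eucl n) i : ℝ) : ℂ), by fun_prop⟩
  map_add' y z := by
    ext ω
    simp [add_mul, Finset.sum_add_distrib]
  map_smul' c y := by
    ext ω
    simp [Finset.mul_sum, mul_assoc]

theorem linearForm_apply (n : ℕ) (y : Fin n → ℂ) (ω : Sph n) :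
    linearForm n y ω = ∑ i, y i * (((ω : Eucl n) i : ℝ) : ℂ) := rfl

/-- The linear forms on the sphere, that is, the spherical harmonics of degree `1`. -/
noncomputable def linearSpace (n : ℕ) : Submodule ℂ (Lp ℂ 2 (surfaceMeasure n)) :=
  LinearMap.range ((continuousToLp n).toLinearMap ∘ₗ linearForm n)

theorem linearPow_one_eq (η : Eucl n) :
    linearPow η 1 = linearForm n fun i => ((η i : ℝ) : ℂ) := by
  ext ω
  rw [linearPow_apply, linearForm_apply, PiLp.inner_apply]
  simp [mul_comm]

theorem linearPow_zero_eq (η : Eucl n) : linearPow η 0 = 1 := by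
  ext ω
  simp [linearPow_apply]

theorem norm_single_one (i : Fin n) : ‖EuclideanSpace.single i (1 : ℝ)‖ = 1 := by simp

theorem tsum_traceEigenvalue_le {s : ℝ} (hs : 1 / 2 < s) (hs' : s < (n : ℝ) / 2) {k : ℕ}
    {h : Lp ℂ 2 (surfaceMeasure n)} (hh : h ∈ (polySpace n k)ᗮ) :
    ∑' m : ℕ, ENNReal.ofReal (traceEigenvalue n s m * ‖harmonicPart m h‖ ^ 2) ≤
      ENNReal.ofReal (traceEigenvalue n s k * ‖h‖ ^ 2) := by
  refine ENNReal.tsum_le_of_sum_range_le fun M => ?_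
  have hpos := fun m => (traceEigenvalue_pos hs hs' m).le
  rw [← ENNReal.ofReal_sum_of_nonneg fun m _ => mul_nonneg (hpos m) (sq_nonneg _)]
  refine ENNReal.ofReal_le_ofReal ?_
  calc _ ≤ ∑ m ∈ Finset.range M, traceEigenvalue n s k * ‖harmonicPart m h‖ ^ 2 := by
        refine Finset.sum_le_sum fun m _ => ?_
        rcases lt_or_ge m k with hm | hm
        · simp [harmonicPart_eq_zero hm hh]
        · exact mul_le_mul_of_nonneg_right (traceEigenvalue_antitone hs hs' hm) (sq_nonneg _)
    _ ≤ _ := by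
        rw [← Finset.mul_sum]
        exact mul_le_mul_of_nonneg_left (sum_norm_harmonicPart_sq_le M h) (hpos k)

theorem linearSpace_le : linearSpace n ≤ polySpace n 2 := by
  rintro _ ⟨y, rfl⟩
  have h1 : linearForm n y =
      ∑ i, y i • linearPow (EuclideanSpace.single i (1 : ℝ)) 1 := by
    ext ω
    rw [linearForm_apply, ContinuousMap.sum_apply]
    refine Finset.sum_congr rfl fun i _ => ?_
    simp [linearPow_apply, EuclideanSpace.inner_single_left]
  simp only [LinearMap.comp_apply, ContinuousLinearMap.coe_coe]
  rw [h1, map_sum]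
  refine Submodule.sum_mem _ fun i _ => ?_
  rw [map_smul]
  exact Submodule.smul_mem _ _ (linearPow_mem_polySpace one_lt_two (norm_single_one _))

theorem polySpace_two_le : polySpace n 2 ≤ constantSpace n ⊔ linearSpace n := by
  rw [polySpace, Submodule.span_le]
  rintro _ ⟨l, hl, η, -, rfl⟩
  interval_cases l
  · rw [linearPow_zero_eq]
    exact Submodule.mem_sup_left (Submodule.mem_span_singleton_self _)
  · rw [linearPow_one_eq]
    exact Submodule.mem_sup_right ⟨_, rfl⟩

variable [NeZero n]

theorem lintegral_norm_extensionFun_sq {s : ℝ} (hs : 1 / 2 < s) (hs' : s < (n : ℝ) / 2)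
    (h : Lp ℂ 2 (surfaceMeasure n)) :
    ∫⁻ ξ, ENNReal.ofReal (‖extensionFun s h ξ‖ ^ 2) =
      ∑' m : ℕ, ENNReal.ofReal (traceEigenvalue n s m * ‖harmonicPart m h‖ ^ 2) := by
  rw [← lintegral_rpow_norm_mul_norm_sq_sphereFourier hs hs',
    ← lintegral_const_mul' _ _ (by simp)]
  refine lintegral_congr fun ξ => ?_
  rw [norm_extensionFun_sq, ENNReal.ofReal_mul (by positivity)]

theorem memLp_extensionFun {s : ℝ} (hs : 1 / 2 < s) (hs' : s < (n : ℝ) / 2)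
    (h : Lp ℂ 2 (surfaceMeasure n)) : MemLp (extensionFun s h) 2 volume := by
  have hm := measurable_extensionFun s h
  rw [memLp_two_iff_integrable_sq_norm hm.aestronglyMeasurable]
  refine ⟨by fun_prop, ?_⟩
  rw [hasFiniteIntegral_iff_ofReal (Filter.Eventually.of_forall fun ξ => sq_nonneg _),
    lintegral_norm_extensionFun_sq hs hs']
  refine (tsum_traceEigenvalue_le hs hs' (k := 0) ?_).trans_lt ENNReal.ofReal_lt_top
  simp [polySpace_zero]

theorem ofReal_norm_toLp_extensionFun_sq {s : ℝ} (hs : 1 / 2 < s) (hs' : s < (n : ℝ) / 2)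
    (h : Lp ℂ 2 (surfaceMeasure n)) :
    ENNReal.ofReal (‖(memLp_extensionFun hs hs' h).toLp‖ ^ 2) =
      ∑' m : ℕ, ENNReal.ofReal (traceEigenvalue n s m * ‖harmonicPart m h‖ ^ 2) := by
  rw [ofReal_norm_sq_eq_lintegral, ← lintegral_norm_extensionFun_sq hs hs']
  refine lintegral_congr_ae ?_
  filter_upwards [(memLp_extensionFun hs hs' h).coeFn_toLp] with ξ hξ
  rw [hξ]

theorem norm_toLp_extensionFun_sq_le {s : ℝ} (hs : 1 / 2 < s) (hs' : s < (n : ℝ) / 2) {k : ℕ}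
    {h : Lp ℂ 2 (surfaceMeasure n)} (hh : h ∈ (polySpace n k)ᗮ) :
    ‖(memLp_extensionFun hs hs' h).toLp‖ ^ 2 ≤ traceEigenvalue n s k * ‖h‖ ^ 2 := by
  have hpos := (traceEigenvalue_pos hs hs' k).le
  rw [← ENNReal.ofReal_le_ofReal_iff (by positivity), ofReal_norm_toLp_extensionFun_sq hs hs']
  exact tsum_traceEigenvalue_le hs hs' hh

theorem norm_toLp_extensionFun_sq_eq {s : ℝ} (hs : 1 / 2 < s) (hs' : s < (n : ℝ) / 2) {k : ℕ}
    {h : Lp ℂ 2 (surfaceMeasure n)} (hh : h ∈ (polySpace n k)ᗮ) (hh' : h ∈ polySpace n (k + 1)) :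
    ‖(memLp_extensionFun hs hs' h).toLp‖ ^ 2 = traceEigenvalue n s k * ‖h‖ ^ 2 := by
  have hpos := (traceEigenvalue_pos hs hs' k).le
  rw [← ENNReal.ofReal_eq_ofReal_iff (sq_nonneg _) (by positivity),
    ofReal_norm_toLp_extensionFun_sq hs hs']
  exact tsum_traceEigenvalue_eq s hh hh'

/-- The operator `h ↦ (2π)^{-n/2} |ξ|^{-s} ĥdσ` from `L²(S^{n-1})` to `L²(ℝⁿ)`. Under the
identification of `Ḣ^s(ℝⁿ)` with `L²(ℝⁿ)` it is the adjoint of the restriction to the sphere. -/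
noncomputable def extensionOp {s : ℝ} (hs : 1 / 2 < s) (hs' : s < (n : ℝ) / 2) :
    Lp ℂ 2 (surfaceMeasure n) →L[ℂ] Lp ℂ 2 (volume : Measure (Eucl n)) :=
  LinearMap.mkContinuous
    { toFun := fun h => (memLp_extensionFun hs hs' h).toLp
      map_add' := fun h k => by
        rw [← MemLp.toLp_add]
        refine MemLp.toLp_congr _ _ (Filter.Eventually.of_forall fun ξ => ?_)
        simp only [extensionFun, Pi.add_apply, sphereFourier_add, mul_add]
      map_smul' := fun c h => by
        rw [RingHom.id_apply, ← MemLp.toLp_const_smul]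
        refine MemLp.toLp_congr _ _ (Filter.Eventually.of_forall fun ξ => ?_)
        simp only [extensionFun, Pi.smul_apply, sphereFourier_smul, smul_eq_mul]
        ring }
    √(traceEigenvalue n s 0) fun h => by
      refine le_of_sq_le_sq ?_ (by positivity)
      rw [mul_pow, Real.sq_sqrt (traceEigenvalue_pos hs hs' 0).le]
      exact norm_toLp_extensionFun_sq_le hs hs' (by simp [polySpace_zero])

theorem extensionOp_apply {s : ℝ} (hs : 1 / 2 < s) (hs' : s < (n : ℝ) / 2)
    (h : Lp ℂ 2 (surfaceMeasure n)) :
    extensionOp hs hs' h = (memLp_extensionFun hs hs' h).toLp := rfl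

theorem constantSpace_eq : constantSpace n = polySpace n 1 := by
  refine le_antisymm ?_ ?_
  · rw [constantSpace, Submodule.span_le, Set.singleton_subset_iff,
      ← linearPow_zero_eq (EuclideanSpace.single (0 : Fin n) (1 : ℝ))]
    exact linearPow_mem_polySpace one_pos (norm_single_one _)
  · rw [polySpace, Submodule.span_le]
    rintro _ ⟨l, hl, η, -, rfl⟩
    rw [Nat.lt_one_iff.mp hl, linearPow_zero_eq]
    exact Submodule.mem_span_singleton_self _

theorem integral_coord_sphere (i : Fin n) :
    ∫ ω : Sph n, (((ω : Eucl n) i : ℝ) : ℂ) ∂(surfaceMeasure n) = 0 := by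
  have h := integral_inner_pow (EuclideanSpace.single i (1 : ℝ)) 1
  simp only [pow_one, EuclideanSpace.inner_single_left, map_one, one_mul, Nat.not_even_one,
    if_false] at h
  rw [integral_complex_ofReal, h, Complex.ofReal_zero]

theorem linearSpace_le_orthogonal : linearSpace n ≤ (constantSpace n)ᗮ := by
  rintro _ ⟨y, rfl⟩
  rw [constantSpace, Submodule.mem_orthogonal_singleton_iff_inner_right]
  simp only [LinearMap.comp_apply, ContinuousLinearMap.coe_coe]
  rw [inner_continuousToLp_right]
  have h1 : ∫ ω, (starRingEnd ℂ) (continuousToLp n 1 ω) * linearForm n y ω ∂(surfaceMeasure n) =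
      ∫ ω : Sph n, ∑ i, y i * (((ω : Eucl n) i : ℝ) : ℂ) ∂(surfaceMeasure n) := by
    refine integral_congr_ae ?_
    filter_upwards [coeFn_continuousToLp (n := n) 1] with ω hω
    rw [hω, linearForm_apply]
    simp
  rw [h1, integral_finsetSum _ fun i _ => integrable_of_continuous (by fun_prop)]
  simp_rw [integral_const_mul, integral_coord_sphere]
  simp

theorem constantSpace_ne_bot : constantSpace n ≠ ⊥ := by
  rw [constantSpace, Ne, Submodule.span_singleton_eq_bot]
  intro h
  have h1 : (1 : C(Sph n, ℂ)) = 0 :=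
    ContinuousMap.toLp_injective (p := 2) (𝕜 := ℂ) (surfaceMeasure n) (h.trans (map_zero _).symm)
  have h2 := congrArg
    (fun f : C(Sph n, ℂ) => f ⟨EuclideanSpace.single 0 (1 : ℝ), by simp⟩) h1
  simp at h2

theorem linearSpace_ne_bot : linearSpace n ≠ ⊥ := by
  rw [linearSpace, Ne, LinearMap.range_eq_bot]
  intro h
  have h1 := LinearMap.congr_fun h (Pi.single 0 1)
  have h2 : linearForm n (Pi.single 0 1) = 0 :=
    ContinuousMap.toLp_injective (p := 2) (𝕜 := ℂ) (surfaceMeasure n) (h1.trans (map_zero _).symm)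
  have h3 := congrArg
    (fun f : C(Sph n, ℂ) => f ⟨EuclideanSpace.single 0 (1 : ℝ), by simp⟩) h2
  simp [linearForm_apply, Pi.single_apply] at h3

instance : FiniteDimensional ℂ (constantSpace n) := by
  rw [constantSpace_eq]; infer_instance

instance : FiniteDimensional ℂ (linearSpace n) := by
  rw [linearSpace]; infer_instance

theorem hasTopLevels_extensionOp {s : ℝ} (hs : 1 / 2 < s) (hs' : s < (n : ℝ) / 2) :
    HasTopLevels (extensionOp hs hs') (constantSpace n) (linearSpace n)
      (traceEigenvalue n s 0) (traceEigenvalue n s 1) (traceEigenvalue n s 2) where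
  le_zero h := norm_toLp_extensionFun_sq_le hs hs' (by simp [polySpace_zero])
  eq_zero h hh := norm_toLp_extensionFun_sq_eq hs hs' (by simp [polySpace_zero])
    (constantSpace_eq (n := n) ▸ hh)
  le_one h hh := norm_toLp_extensionFun_sq_le hs hs' (constantSpace_eq (n := n) ▸ hh)
  eq_one h hh := norm_toLp_extensionFun_sq_eq hs hs'
    (constantSpace_eq (n := n) ▸ linearSpace_le_orthogonal hh) (linearSpace_le hh)
  le_two h hh := norm_toLp_extensionFun_sq_le hs hs' (Submodule.orthogonal_le polySpace_two_le hh)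
  le_orthogonal := linearSpace_le_orthogonal
  nonneg := (traceEigenvalue_pos hs hs' 2).le
  two_lt := traceEigenvalue_succ_lt hs hs' 1
  one_lt := traceEigenvalue_succ_lt hs hs' 0

end ExtensionOperator

/-! ### The homogeneous Sobolev space and the restriction operator -/

section SobolevSpace

open scoped InnerProductSpace

variable {n : ℕ}

theorem ae_ne_zero [NeZero n] : ∀ᵐ ξ : Eucl n, ξ ≠ 0 := by simp [ae_iff]

/-- For `s < n / 2` the weight `|ξ|^{-s}` is square integrable near the origin. -/
theorem memLp_indicator_ball_rpow_norm [NeZero n] {s : ℝ} (hs' : s < (n : ℝ) / 2) :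
    MemLp ((Metric.ball (0 : Eucl n) 1).indicator fun ξ => ‖ξ‖ ^ (-s)) 2 volume := by
  have hmeas : Measurable fun ξ : Eucl n => ‖ξ‖ ^ (-s) := by fun_prop
  rw [memLp_indicator_iff_restrict measurableSet_ball,
    memLp_two_iff_integrable_sq hmeas.aestronglyMeasurable]
  have h1 : ∀ ξ : Eucl n, (‖ξ‖ ^ (-s)) ^ 2 = ‖ξ‖ ^ (-(2 * s)) := fun ξ => by
    rw [← Real.rpow_mul_natCast (norm_nonneg _)]
    push_cast
    ring_nf
  simp_rw [h1]
  refine (integrableOn_fun_norm_addHaar (volume : Measure (Eucl n))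
    (f := fun r : ℝ => r ^ (-(2 * s))) (r := 1)).mpr ?_
  have hn : 0 < n := NeZero.pos n
  have h2 : IntegrableOn (fun r : ℝ => r ^ ((n : ℝ) - 1 - 2 * s)) (Set.Ioo 0 1) :=
    (intervalIntegral.integrableOn_Ioo_rpow_iff one_pos).mpr (by linarith)
  refine h2.congr_fun (fun r hr => ?_) measurableSet_Ioo
  simp only [finrank_euclideanSpace, Fintype.card_fin, smul_eq_mul]
  rw [← Real.rpow_natCast, ← Real.rpow_add hr.1, Nat.cast_sub hn]
  congr 1
  push_cast
  ring

/-- A function that is integrable on the unit ball and square integrable outside of it is the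
Fourier transform of a tempered distribution. -/
theorem exists_hasFourier {F : Eucl n → ℂ}
    (h1 : Integrable ((Metric.ball (0 : Eucl n) 1).indicator F))
    (h2 : MemLp ((Metric.ball (0 : Eucl n) 1)ᶜ.indicator F) 2 volume) :
    ∃ f : 𝓢'(Eucl n, ℂ), HasFourier f F := by
  set F₁ := (Metric.ball (0 : Eucl n) 1).indicator F with hF₁
  set F₂ := (Metric.ball (0 : Eucl n) 1)ᶜ.indicator F with hF₂
  have hF : F = F₁ + F₂ := (Set.indicator_self_add_compl _ _).symm
  have h1' : MemLp F₁ 1 volume := memLp_one_iff_integrable.mpr h1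
  have i1 : ∀ φ : 𝓢(Eucl n, ℂ), Integrable fun ξ => φ ξ * F₁ ξ := fun φ => by
    obtain ⟨C, hC⟩ := φ.decay 0 0
    refine h1.bdd_mul φ.continuous.aestronglyMeasurable (c := C)
      (Filter.Eventually.of_forall fun ξ => ?_)
    simpa using hC.2 ξ
  have i2 : ∀ φ : 𝓢(Eucl n, ℂ), Integrable fun ξ => φ ξ * F₂ ξ := fun φ =>
    (φ.memLp 2).integrable_mul h2
  set g : 𝓢'(Eucl n, ℂ) := Lp.toTemperedDistribution (h1'.toLp F₁) +
    Lp.toTemperedDistribution (h2.toLp F₂) with hg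
  have hgφ : ∀ φ : 𝓢(Eucl n, ℂ), g φ = ∫ ξ, φ ξ * F ξ := by
    intro φ
    have e : g φ = Lp.toTemperedDistribution (h1'.toLp F₁) φ +
      Lp.toTemperedDistribution (h2.toLp F₂) φ := rfl
    rw [e, Lp.toTemperedDistribution_apply, Lp.toTemperedDistribution_apply, hF]
    simp_rw [Pi.add_apply, mul_add]
    rw [integral_add (i1 φ) (i2 φ)]
    congr 1
    · refine integral_congr_ae ?_
      filter_upwards [h1'.coeFn_toLp] with ξ hξ
      rw [hξ, smul_eq_mul]
    · refine integral_congr_ae ?_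
      filter_upwards [h2.coeFn_toLp] with ξ hξ
      rw [hξ, smul_eq_mul]
  refine ⟨PointwiseConvergenceCLM.precomp ℂ
    (SchwartzMap.compCLMOfContinuousLinearEquiv ℂ (dilation n).symm) (𝓕⁻ g), ?_, fun φ => ⟨?_, ?_⟩⟩
  · rw [hF]
    exact h1.locallyIntegrable.add (h2.locallyIntegrable one_le_two)
  · rw [hF]
    simp_rw [Pi.add_apply, mul_add]
    exact (i1 φ).add (i2 φ)
  · rw [← hgφ]
    have : 𝓕⁻ (SchwartzMap.compCLMOfContinuousLinearEquiv ℂ (dilation n).symm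
        (schwartzFourier n φ)) = φ := by
      have h3 : SchwartzMap.compCLMOfContinuousLinearEquiv ℂ (dilation n).symm
          (schwartzFourier n φ) = 𝓕 φ := by
        ext ξ
        simp [schwartzFourier]
      rw [h3, FourierTransform.fourierInv_fourier_eq]
    conv_rhs => rw [← this]
    rfl

theorem exists_homSobolev_fourier {s : ℝ} {f : 𝓢'(Eucl n, ℂ)} {F : Eucl n → ℂ}
    (hF : HasFourier f F) (hF' : MemLp (fun ξ => ((‖ξ‖ ^ s : ℝ) : ℂ) * F ξ) 2 volume) :
    ∃ g : HomSobolev n s, HomSobolev.toDistribution g = f ∧ HomSobolev.fourier g =ᵐ[volume] F := by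
  let g : HomSobolev n s := ⟨f, F, hF, hF'⟩
  exact ⟨g, rfl, (HomSobolev.hasFourier g).unique hF⟩

theorem coeFn_toL2 {s : ℝ} (f : HomSobolev n s) :
    HomSobolev.toL2 f =ᵐ[volume] fun ξ => (((2 * Real.pi) ^ (-(n : ℝ) / 2) * ‖ξ‖ ^ s : ℝ) : ℂ) *
      HomSobolev.fourier f ξ := by
  have h1 : HomSobolev.toL2 f = (((2 * Real.pi) ^ (-(n : ℝ) / 2) : ℝ) : ℂ) •
    (HomSobolev.memLp f).toLp _ := rfl
  rw [h1]
  filter_upwards [Lp.coeFn_smul (((2 * Real.pi) ^ (-(n : ℝ) / 2) : ℝ) : ℂ)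
    ((HomSobolev.memLp f).toLp _), (HomSobolev.memLp f).coeFn_toLp] with ξ hξ hξ'
  rw [hξ, Pi.smul_apply, hξ', smul_eq_mul, Complex.ofReal_mul, mul_assoc]

/-- Every `G ∈ L²(ℝⁿ)` is of the form `(2π)^{-n/2} |ξ|^s f̂`: near the origin `|ξ|^{-s} G` is
integrable, and away from it square integrable. -/
theorem toL2_surjective [NeZero n] {s : ℝ} (hs : 0 ≤ s) (hs' : s < (n : ℝ) / 2) :
    Function.Surjective
      (HomSobolev.toL2 : HomSobolev n s →ₗ[ℂ] Lp ℂ 2 (volume : Measure (Eucl n))) := by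
  intro G
  set c : ℝ := (2 * Real.pi) ^ (-(n : ℝ) / 2) with hc
  have hc0 : 0 < c := by positivity
  set F : Eucl n → ℂ := fun ξ => ((c⁻¹ : ℝ) : ℂ) * (((‖ξ‖ ^ (-s) : ℝ) : ℂ) * G ξ) with hF
  have hG := Lp.memLp G
  have h1 : Integrable ((Metric.ball (0 : Eucl n) 1).indicator F) := by
    have h := ((memLp_indicator_ball_rpow_norm (n := n) hs').ofReal (K := ℂ)).integrable_mul hG
    refine (h.const_mul ((c⁻¹ : ℝ) : ℂ)).congr (Filter.Eventually.of_forall fun ξ => ?_)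
    by_cases hξ : ξ ∈ Metric.ball (0 : Eucl n) 1
    · simp [hF, Set.indicator_of_mem hξ]
    · simp [hF, Set.indicator_of_notMem hξ]
  have h2 : MemLp ((Metric.ball (0 : Eucl n) 1)ᶜ.indicator F) 2 volume := by
    refine (hG.const_mul ((c⁻¹ : ℝ) : ℂ)).mono ?_ (Filter.Eventually.of_forall fun ξ => ?_)
    · refine AEStronglyMeasurable.indicator ?_ measurableSet_ball.compl
      refine AEStronglyMeasurable.const_mul (AEStronglyMeasurable.mul ?_ hG.1) _
      exact (Measurable.aestronglyMeasurable (by fun_prop))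
    · by_cases hξ : ξ ∈ (Metric.ball (0 : Eucl n) 1)ᶜ
      · rw [Set.indicator_of_mem hξ, hF, norm_mul, norm_mul, norm_mul]
        have h3 : 1 ≤ ‖ξ‖ := by simpa using hξ
        have h4 : ‖ξ‖ ^ (-s) ≤ 1 := Real.rpow_le_one_of_one_le_of_nonpos h3 (by linarith)
        rw [Complex.norm_real (‖ξ‖ ^ (-s)), Real.norm_of_nonneg (by positivity)]
        gcongr
        exact mul_le_of_le_one_left (norm_nonneg _) h4
      · rw [Set.indicator_of_notMem hξ, norm_zero]
        positivity
  obtain ⟨f, hf⟩ := exists_hasFourier h1 h2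
  have h5 : (fun ξ => ((‖ξ‖ ^ s : ℝ) : ℂ) * F ξ) =ᵐ[volume] fun ξ => ((c⁻¹ : ℝ) : ℂ) * G ξ := by
    filter_upwards [ae_ne_zero] with ξ hξ
    have h6 : ‖ξ‖ ^ s * ‖ξ‖ ^ (-s) = 1 := by
      rw [← Real.rpow_add (norm_pos_iff.mpr hξ), add_neg_cancel, Real.rpow_zero]
    have h7 : ((‖ξ‖ ^ s : ℝ) : ℂ) * ((‖ξ‖ ^ (-s) : ℝ) : ℂ) = 1 := by exact_mod_cast h6
    rw [hF]
    linear_combination (((c⁻¹ : ℝ) : ℂ) * G ξ) * h7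
  obtain ⟨g, -, hg⟩ := exists_homSobolev_fourier hf
    ((memLp_congr_ae h5).mpr (hG.const_mul ((c⁻¹ : ℝ) : ℂ)))
  refine ⟨g, Lp.ext ?_⟩
  filter_upwards [coeFn_toL2 g, hg, h5] with ξ h6 h7 h8
  rw [h6, h7, Complex.ofReal_mul, mul_assoc, h8, ← mul_assoc, ← Complex.ofReal_mul,
    mul_inv_cancel₀ hc0.ne', Complex.ofReal_one, one_mul]

/-- The Plancherel isometry `f ↦ (2π)^{-n/2} |ξ|^s f̂` of `Ḣ^s(ℝⁿ)` onto `L²(ℝⁿ)`. -/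
noncomputable def sobolevIsometry [NeZero n] {s : ℝ} (hs : 0 ≤ s) (hs' : s < (n : ℝ) / 2) :
    HomSobolev n s ≃ₗᵢ[ℂ] Lp ℂ 2 (volume : Measure (Eucl n)) :=
  LinearIsometryEquiv.ofSurjective ⟨HomSobolev.toL2, fun f => (HomSobolev.norm_eq f).symm⟩
    (toL2_surjective hs hs')

theorem sobolevIsometry_apply [NeZero n] {s : ℝ} (hs : 0 ≤ s) (hs' : s < (n : ℝ) / 2)
    (f : HomSobolev n s) : sobolevIsometry hs hs' f = HomSobolev.toL2 f := rfl

theorem integrable_fourier_kernel_prod (φ ψ : 𝓢(Eucl n, ℂ)) :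
    Integrable (Function.uncurry fun ξ x : Eucl n =>
      φ x * Complex.exp (-Complex.I * ((⟪x, ξ⟫_ℝ : ℝ) : ℂ)) * ψ ξ)
      ((volume : Measure (Eucl n)).prod volume) := by
  have h := (ψ.integrable (μ := volume)).mul_prod (φ.integrable (μ := volume))
  have h2 := h.bdd_mul (c := 1) (f := fun q : Eucl n × Eucl n =>
    Complex.exp (-Complex.I * ((⟪q.2, q.1⟫_ℝ : ℝ) : ℂ)))
    (Continuous.aestronglyMeasurable (by fun_prop))
    (Filter.Eventually.of_forall fun q => (norm_exp_neg_I_mul _).le)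
  refine h2.congr (Filter.Eventually.of_forall fun q => ?_)
  simp only [Function.uncurry]
  ring

theorem hasFourier_schwartz (φ : 𝓢(Eucl n, ℂ)) :
    HasFourier (φ : 𝓢'(Eucl n, ℂ)) (schwartzFourier n φ) := by
  have hi : ∀ ψ : 𝓢(Eucl n, ℂ), Integrable fun ξ => ψ ξ * schwartzFourier n φ ξ := fun ψ =>
    (ψ.memLp 2).integrable_mul ((schwartzFourier n φ).memLp 2)
  refine ⟨(schwartzFourier n φ).integrable.locallyIntegrable, fun ψ => ⟨hi ψ, ?_⟩⟩
  rw [SchwartzMap.coe_apply]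
  simp_rw [smul_eq_mul, schwartzFourier_apply, ← integral_mul_const, ← integral_const_mul]
  rw [integral_integral_swap (integrable_fourier_kernel_prod ψ φ)]
  refine integral_congr_ae (Filter.Eventually.of_forall fun x => ?_)
  refine integral_congr_ae (Filter.Eventually.of_forall fun ξ => ?_)
  simp only [real_inner_comm x ξ]
  ring

/-- Fourier inversion on Schwartz functions. -/
theorem integral_exp_mul_schwartzFourier (φ : 𝓢(Eucl n, ℂ)) (x : Eucl n) :
    ∫ ξ : Eucl n, Complex.exp (Complex.I * ((⟪x, ξ⟫_ℝ : ℝ) : ℂ)) * schwartzFourier n φ ξ =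
      ((2 * Real.pi) ^ n : ℝ) * φ x := by
  have h1 : φ x = ∫ y : Eucl n, Complex.exp (2 * Real.pi * (⟪y, x⟫_ℝ : ℝ) * Complex.I) •
      (𝓕 φ) y := by
    have h3 : (𝓕⁻ (𝓕 φ : 𝓢(Eucl n, ℂ)) : 𝓢(Eucl n, ℂ)) = φ :=
      FourierTransform.fourierInv_fourier_eq φ
    conv_lhs => rw [← h3]
    rw [SchwartzMap.fourierInv_coe, Real.fourierInv_eq']
    push_cast
    rfl
  have h2 := Measure.integral_comp_smul_of_nonneg (volume : Measure (Eucl n))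
    (fun y : Eucl n => Complex.exp (2 * Real.pi * (⟪y, x⟫_ℝ : ℝ) * Complex.I) • (𝓕 φ) y)
    ((2 * Real.pi)⁻¹) (hR := by positivity)
  rw [← h1] at h2
  simp only [finrank_euclideanSpace, Fintype.card_fin, inv_pow, inv_inv] at h2
  rw [Complex.real_smul] at h2
  rw [← h2]
  refine integral_congr_ae (Filter.Eventually.of_forall fun ξ => ?_)
  simp only [smul_eq_mul, inner_smul_left]
  congr 1
  · congr 1
    rw [real_inner_comm]
    have : (Real.pi : ℂ) ≠ 0 := by exact_mod_cast Real.pi_ne_zero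
    simp
    field_simp

/-- The Fourier transform of densities on the sphere is dual to the restriction. -/
theorem integral_conj_sphereFourier_mul (h : Lp ℂ 2 (surfaceMeasure n)) (φ : 𝓢(Eucl n, ℂ)) :
    ∫ ξ, (starRingEnd ℂ) (sphereFourier h ξ) * schwartzFourier n φ ξ =
      ((2 * Real.pi) ^ n : ℝ) * ∫ ω : Sph n, (starRingEnd ℂ) (h ω) * φ (ω : Eucl n)
        ∂(surfaceMeasure n) := by
  have h1 : ∀ ξ, (starRingEnd ℂ) (sphereFourier h ξ) * schwartzFourier n φ ξ =
      ∫ ω : Sph n, (starRingEnd ℂ) (h ω) * (Complex.exp (Complex.I *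
        ((⟪(ω : Eucl n), ξ⟫_ℝ : ℝ) : ℂ)) * schwartzFourier n φ ξ) ∂(surfaceMeasure n) := by
    intro ξ
    rw [sphereFourier, ← integral_conj, ← integral_mul_const]
    refine integral_congr_ae (Filter.Eventually.of_forall fun ω => ?_)
    simp only [map_mul, ← Complex.exp_conj, map_neg, Complex.conj_I, Complex.conj_ofReal, neg_neg]
    ring
  have hint : Integrable (Function.uncurry fun (ξ : Eucl n) (ω : Sph n) =>
      (starRingEnd ℂ) (h ω) * (Complex.exp (Complex.I *
        ((⟪(ω : Eucl n), ξ⟫_ℝ : ℝ) : ℂ)) * schwartzFourier n φ ξ))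
      ((volume : Measure (Eucl n)).prod (surfaceMeasure n)) := by
    have h2 := ((schwartzFourier n φ).integrable (μ := volume)).mul_prod (integrable_conj_coeFn h)
    have h3 := h2.bdd_mul (c := 1) (f := fun q : Eucl n × Sph n =>
      Complex.exp (Complex.I * ((⟪(q.2 : Eucl n), q.1⟫_ℝ : ℝ) : ℂ)))
      (Continuous.aestronglyMeasurable (by fun_prop))
      (Filter.Eventually.of_forall fun q => by
        rw [mul_comm]; exact (Complex.norm_exp_ofReal_mul_I _).le)
    refine h3.congr (Filter.Eventually.of_forall fun q => ?_)
    simp only [Function.uncurry]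
    ring
  simp_rw [h1]
  rw [integral_integral_swap hint]
  simp_rw [integral_const_mul, integral_exp_mul_schwartzFourier]
  rw [← integral_const_mul]
  refine integral_congr_ae (Filter.Eventually.of_forall fun ω => ?_)
  simp only
  ring

variable [NeZero n] {s : ℝ}

/-- The restriction to the sphere, as the composition of the Plancherel isometry with the adjoint of
the extension operator. -/
noncomputable def restrictionOp (hs : 1 / 2 < s) (hs' : s < (n : ℝ) / 2) :
    HomSobolev n s →L[ℂ] Lp ℂ 2 (surfaceMeasure n) :=
  (extensionOp hs hs').adjoint ∘L
    (sobolevIsometry (show 0 ≤ s by linarith) hs').toContinuousLinearEquiv.toContinuousLinearMap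

theorem restrictionOp_apply (hs : 1 / 2 < s) (hs' : s < (n : ℝ) / 2) (f : HomSobolev n s) :
    restrictionOp hs hs' f =
      (extensionOp hs hs').adjoint (sobolevIsometry (show 0 ≤ s by linarith) hs' f) := rfl

theorem isRestriction_restrictionOp (hs : 1 / 2 < s) (hs' : s < (n : ℝ) / 2) :
    IsRestriction (restrictionOp (n := n) hs hs') := by
  intro φ f hf
  have hfour : HomSobolev.fourier f =ᵐ[volume] schwartzFourier n φ :=
    (HomSobolev.hasFourier f).unique (hf ▸ hasFourier_schwartz φ)
  set φS : C(Sph n, ℂ) := ⟨fun ω => φ (ω : Eucl n), φ.continuous.comp continuous_subtype_val⟩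
  have key : restrictionOp hs hs' f = continuousToLp n φS := by
    refine ext_inner_left ℂ fun h => ?_
    rw [restrictionOp_apply, ContinuousLinearMap.adjoint_inner_right, inner_continuousToLp_right,
      L2.inner_def, sobolevIsometry_apply]
    have h1 : ∫ ξ, ⟪extensionOp hs hs' h ξ, HomSobolev.toL2 f ξ⟫_ℂ =
        ∫ ξ, (((2 * Real.pi) ^ n : ℝ) : ℂ)⁻¹ *
          ((starRingEnd ℂ) (sphereFourier h ξ) * schwartzFourier n φ ξ) := by
      refine integral_congr_ae ?_
      filter_upwards [(memLp_extensionFun hs hs' h).coeFn_toLp, coeFn_toL2 f, hfour, ae_ne_zero]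
        with ξ e1 e2 e3 e4
      rw [extensionOp_apply, e1, e2, e3, RCLike.inner_apply, extensionFun, map_mul,
        Complex.conj_ofReal]
      have e5 : ((2 * Real.pi) ^ (-(n : ℝ) / 2) * ‖ξ‖ ^ s) *
          ((2 * Real.pi) ^ (-(n : ℝ) / 2) * ‖ξ‖ ^ (-s)) = ((2 * Real.pi) ^ n)⁻¹ := by
        have e6 : ‖ξ‖ ^ s * ‖ξ‖ ^ (-s) = 1 := by
          rw [← Real.rpow_add (norm_pos_iff.mpr e4), add_neg_cancel, Real.rpow_zero]
        have e7 : (2 * Real.pi) ^ (-(n : ℝ) / 2) * (2 * Real.pi) ^ (-(n : ℝ) / 2) =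
            ((2 * Real.pi) ^ n)⁻¹ := by
          rw [← Real.rpow_add (by positivity), add_halves, Real.rpow_neg (by positivity),
            Real.rpow_natCast]
        rw [← e7]
        linear_combination ((2 * Real.pi) ^ (-(n : ℝ) / 2) * (2 * Real.pi) ^ (-(n : ℝ) / 2)) * e6
      have e8 := congrArg (fun x : ℝ => (x : ℂ)) e5
      simp only [Complex.ofReal_mul, Complex.ofReal_inv] at e8 ⊢
      linear_combination ((starRingEnd ℂ) (sphereFourier h ξ) * schwartzFourier n φ ξ) * e8
    rw [h1, integral_const_mul, integral_conj_sphereFourier_mul, ← mul_assoc, inv_mul_cancel₀,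
      one_mul]
    · rfl
    · have : (0 : ℝ) < (2 * Real.pi) ^ n := by positivity
      exact_mod_cast this.ne'
  rw [key]
  exact coeFn_continuousToLp φS

/-- The Schwartz functions are dense in `Ḣ^s(ℝⁿ)`, in the form that the image of their span in
`L²(ℝⁿ)` has a trivial orthogonal complement. -/
theorem eq_zero_of_forall_inner_schwartz (hs : 0 < s) (G : Lp ℂ 2 (volume : Measure (Eucl n)))
    (hG : ∀ (φ : 𝓢(Eucl n, ℂ)) (f : HomSobolev n s),
      HomSobolev.toDistribution f = (φ : 𝓢'(Eucl n, ℂ)) → ⟪G, HomSobolev.toL2 f⟫_ℂ = 0) :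
    G = 0 := by
  set w : Eucl n → ℂ := fun ξ => (((2 * Real.pi) ^ (-(n : ℝ) / 2) * ‖ξ‖ ^ s : ℝ) : ℂ) with hw
  have hcont : Continuous fun ξ : Eucl n => ‖ξ‖ ^ s :=
    continuous_norm.rpow_const fun _ => Or.inr hs.le
  have hwc : Continuous w := by fun_prop
  have hconj : MemLp (fun ξ => (starRingEnd ℂ) (G ξ)) 2 volume := (Lp.memLp G).star
  have hloc : LocallyIntegrable (fun ξ => w ξ * (starRingEnd ℂ) (G ξ)) volume := by
    have := (hconj.locallyIntegrable one_le_two).locallyIntegrableOn Set.univ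
    rw [← locallyIntegrableOn_univ]
    exact this.continuousOn_mul hwc.continuousOn isOpen_univ.isLocallyClosed
  have h0 := ae_eq_zero_of_integral_contDiff_smul_eq_zero hloc fun g hg hc => by
    have hg₁ : HasCompactSupport (Complex.ofRealCLM ∘ g) := hc.comp_left rfl
    have hg₂ : ContDiff ℝ (⊤ : ℕ∞) (Complex.ofRealCLM ∘ g) := by fun_prop
    set ψ : 𝓢(Eucl n, ℂ) := hg₁.toSchwartzMap hg₂
    obtain ⟨φ, hφ⟩ := schwartzFourier_surjective n ψ
    have hψ : ∀ ξ, ψ ξ = (g ξ : ℂ) := fun ξ => rfl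
    have hm : MemLp (fun ξ => ((‖ξ‖ ^ s : ℝ) : ℂ) * ψ ξ) 2 volume := by
      refine Continuous.memLp_of_hasCompactSupport (by have := ψ.continuous; fun_prop) ?_
      exact HasCompactSupport.mul_left hg₁
    obtain ⟨f, hf, hf'⟩ := exists_homSobolev_fourier (hφ ▸ hasFourier_schwartz φ) hm
    have h1 := hG φ f hf
    rw [L2.inner_def] at h1
    rw [← h1]
    refine integral_congr_ae ?_
    filter_upwards [coeFn_toL2 f, hf'] with ξ e1 e2
    rw [e1, e2, hψ, RCLike.inner_apply, Complex.real_smul, hw]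
    ring
  refine Lp.ext ?_
  filter_upwards [h0, ae_ne_zero, Lp.coeFn_zero ℂ 2 (volume : Measure (Eucl n))] with ξ e1 e2 e3
  have e4 : (0 : ℝ) < (2 * Real.pi) ^ (-(n : ℝ) / 2) * ‖ξ‖ ^ s := by
    have := norm_pos_iff.mpr e2
    positivity
  have e5 : w ξ ≠ 0 := by
    exact Complex.ofReal_ne_zero.mpr e4.ne'
  rw [e3]
  simpa [e5] using e1

theorem IsRestriction.unique (hs : 0 < s) (hs' : s < (n : ℝ) / 2)
    {R R' : HomSobolev n s →L[ℂ] Lp ℂ 2 (surfaceMeasure n)} (hR : IsRestriction R)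
    (hR' : IsRestriction R') : R = R' := by
  set U := sobolevIsometry (n := n) hs.le hs'
  set A := (R - R') ∘L U.symm.toContinuousLinearEquiv.toContinuousLinearMap with hA
  have h1 : ∀ h, A.adjoint h = 0 := fun h => by
    refine eq_zero_of_forall_inner_schwartz hs _ fun φ f hf => ?_
    have h2 : R f = R' f := Lp.ext ((hR φ f hf).trans (hR' φ f hf).symm)
    have h3 : A (HomSobolev.toL2 f) = R f - R' f := by
      have : U.symm (HomSobolev.toL2 f) = f := U.symm_apply_apply f
      rw [← congrArg R this, ← congrArg R' this]
      rfl
    rw [ContinuousLinearMap.adjoint_inner_left, h3, h2, sub_self, inner_zero_right]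
  ext1 f
  have h4 : A (U f) = R f - R' f := by
    have : U.symm (U f) = f := U.symm_apply_apply f
    conv_rhs => rw [← this]
    rfl
  have h5 : A (U f) = 0 := by
    refine ext_inner_left ℂ fun h => ?_
    rw [← ContinuousLinearMap.adjoint_inner_left, h1, inner_zero_left, inner_zero_right]
  exact sub_eq_zero.mp (h4.symm.trans h5)

end SobolevSpace

/-! ### Bessel functions as Fourier transforms of spherical harmonics -/

section BesselExpansion

open scoped InnerProductSpace

variable {n : ℕ}

/-- The power series of `ĝdσ` along the ray in the direction `θ`. -/
theorem hasSum_sphereFourier (g : C(Sph n, ℂ)) (θ : Sph n) (r : ℝ) :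
    HasSum (fun j : ℕ => (-Complex.I * r) ^ j / (j.factorial : ℂ) *
        ∫ ω : Sph n, ((⟪(θ : Eucl n), (ω : Eucl n)⟫_ℝ ^ j : ℝ) : ℂ) * g ω ∂(surfaceMeasure n))
      (sphereFourier (continuousToLp n g) (r • (θ : Eucl n))) := by
  have hexp : ∀ z : ℂ, HasSum (fun k : ℕ => z ^ k / (k.factorial : ℂ)) (Complex.exp z) := by
    intro u
    rw [Complex.exp_eq_exp_ℂ]
    exact NormedSpace.expSeries_div_hasSum_exp u
  have hsum : Summable fun j : ℕ => |r| ^ j / (j.factorial : ℝ) :=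
    Real.summable_pow_div_factorial _
  have hg : Integrable (fun ω : Sph n => ‖g ω‖) (surfaceMeasure n) :=
    integrable_of_continuous (by fun_prop)
  have hval : sphereFourier (continuousToLp n g) (r • (θ : Eucl n)) =
      ∫ ω : Sph n, Complex.exp (-Complex.I * r * ((⟪(θ : Eucl n), (ω : Eucl n)⟫_ℝ : ℝ) : ℂ)) * g ω
        ∂(surfaceMeasure n) := by
    rw [sphereFourier]
    refine integral_congr_ae ?_
    filter_upwards [coeFn_continuousToLp g] with ω hω
    rw [hω, inner_smul_right, real_inner_comm, Complex.ofReal_mul, mul_assoc (-Complex.I)]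
  rw [hval]
  have := hasSum_integral_of_dominated_convergence (μ := surfaceMeasure n)
    (F := fun (j : ℕ) (ω : Sph n) =>
      (-Complex.I * r * ((⟪(θ : Eucl n), (ω : Eucl n)⟫_ℝ : ℝ) : ℂ)) ^ j / j.factorial * g ω)
    (f := fun ω : Sph n =>
      Complex.exp (-Complex.I * r * ((⟪(θ : Eucl n), (ω : Eucl n)⟫_ℝ : ℝ) : ℂ)) * g ω)
    (fun (j : ℕ) (ω : Sph n) => |r| ^ j / j.factorial * ‖g ω‖)
    (fun j => Continuous.aestronglyMeasurable (by fun_prop))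
    (fun j => Filter.Eventually.of_forall fun ω => ?_)
    (Filter.Eventually.of_forall fun ω => hsum.mul_right _) ?_
    (Filter.Eventually.of_forall fun ω => (hexp _).mul_right _)
  · convert! this using 2 with j
    rw [← integral_const_mul]
    refine integral_congr_ae (Filter.Eventually.of_forall fun ω => ?_)
    simp only
    push_cast
    rw [mul_pow _ (((⟪(θ : Eucl n), (ω : Eucl n)⟫_ℝ : ℝ) : ℂ))]
    ring
  · rw [norm_mul, norm_div, norm_pow, Complex.norm_natCast, norm_mul, norm_mul, norm_neg,
      Complex.norm_I, one_mul, Complex.norm_real, Complex.norm_real, Real.norm_eq_abs,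
      Real.norm_eq_abs]
    gcongr
    exact mul_le_of_le_one_right (abs_nonneg r) (abs_inner_sphere_le θ ω)
  · simp_rw [tsum_mul_right]
    exact hg.const_mul _

/-- The terms of the power series of `Ŷdσ`, for `Y` a spherical harmonic of degree `m`, against
those of the Bessel function. -/
theorem pow_mul_powerEigenvalue_eq (n m i : ℕ) {r : ℝ} (hr : 0 < r) :
    r ^ (m + 2 * i) / ((m + 2 * i).factorial : ℝ) * powerEigenvalue n m (m + 2 * i) =
      (2 * Real.pi) ^ ((n : ℝ) / 2) * r ^ (1 - (n : ℝ) / 2) *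
        (1 / ((i.factorial : ℝ) * Real.Gamma ((i : ℝ) + ((n : ℝ) / 2 - 1 + m) + 1)) *
          (r / 2) ^ (2 * (i : ℝ) + ((n : ℝ) / 2 - 1 + m))) := by
  have h1 : (r / 2) ^ (2 * (i : ℝ) + ((n : ℝ) / 2 - 1 + m)) =
      (r / 2) ^ (m + 2 * i) * (r ^ ((n : ℝ) / 2 - 1) / 2 ^ ((n : ℝ) / 2 - 1)) := by
    rw [← Real.div_rpow hr.le two_pos.le, ← Real.rpow_natCast, ← Real.rpow_add (by positivity)]
    congr 1
    push_cast
    ring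
  have h2 : r ^ (1 - (n : ℝ) / 2) * r ^ ((n : ℝ) / 2 - 1) = 1 := by
    rw [← Real.rpow_add hr, sub_add_sub_cancel', sub_self, Real.rpow_zero]
  have h3 : (2 * Real.pi) ^ ((n : ℝ) / 2) =
      2 * 2 ^ ((n : ℝ) / 2 - 1) * Real.pi ^ ((n : ℝ) / 2) := by
    rw [Real.mul_rpow two_pos.le Real.pi_pos.le, Real.rpow_sub_one two_ne_zero]
    ring
  have h4 : (i : ℝ) + ((n : ℝ) / 2 - 1 + m) + 1 = m + i + n / 2 := by ring
  have h5 : (4 : ℝ) ^ (m + i) = 2 ^ m * 2 ^ (m + 2 * i) := by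
    rw [show (4 : ℝ) = 2 ^ 2 by norm_num, ← pow_mul, ← pow_add]
    congr 1
    ring
  have h6 := (Nat.factorial_pos (m + 2 * i)).ne'
  have h7 : (2 : ℝ) ^ ((n : ℝ) / 2 - 1) ≠ 0 := by positivity
  rw [powerEigenvalue_add_two_mul, h1, h3, h4, h5, div_pow]
  calc _ = 2 * Real.pi ^ ((n : ℝ) / 2) * (r ^ (m + 2 * i) / 2 ^ (m + 2 * i)) /
        (i.factorial * Real.Gamma (m + i + n / 2)) := by field_simp
    _ = 2 * Real.pi ^ ((n : ℝ) / 2) * (r ^ (m + 2 * i) / 2 ^ (m + 2 * i)) /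
        (i.factorial * Real.Gamma (m + i + n / 2)) *
          (r ^ (1 - (n : ℝ) / 2) * r ^ ((n : ℝ) / 2 - 1)) := by rw [h2, mul_one]
    _ = _ := by field_simp

/-- The Bochner-Hecke formula: if the moments of `g` in the direction `θ` are those of a spherical
harmonic of degree `m` with the value `a` at `θ`, then
`ĝdσ(r θ) = (-i)^m (2π)^{n/2} r^{1-n/2} J_{n/2-1+m}(r) a`. -/
theorem sphereFourier_eq_besselJ (m : ℕ) (g : C(Sph n, ℂ)) (θ : Sph n) (a : ℂ)
    (hg : ∀ j : ℕ, ∫ ω : Sph n, ((⟪(θ : Eucl n), (ω : Eucl n)⟫_ℝ ^ j : ℝ) : ℂ) * g ω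
      ∂(surfaceMeasure n) = (powerEigenvalue n m j : ℂ) * a) {r : ℝ} (hr : 0 < r) :
    sphereFourier (continuousToLp n g) (r • (θ : Eucl n)) =
      (-Complex.I) ^ m * (((2 * Real.pi) ^ ((n : ℝ) / 2) * r ^ (1 - (n : ℝ) / 2) : ℝ) : ℂ) *
        (besselJ ((n : ℝ) / 2 - 1 + m) r : ℂ) * a := by
  have h1 := hasSum_sphereFourier g θ r
  simp_rw [hg] at h1
  have hinj : Function.Injective fun i : ℕ => m + 2 * i := fun i j h => by
    simp only at h
    omega
  rw [← hinj.hasSum_iff] at h1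
  · rw [← h1.tsum_eq, besselJ, Complex.ofReal_tsum, ← tsum_mul_left, ← tsum_mul_right]
    refine tsum_congr fun i => ?_
    have h2 := congrArg (fun x : ℝ => (x : ℂ)) (pow_mul_powerEigenvalue_eq n m i hr)
    have h3 : (-Complex.I) ^ (2 * i) = (-1) ^ i := by
      rw [pow_mul, neg_sq, Complex.I_sq]
    simp only [Function.comp_apply, mul_pow, pow_add (-Complex.I), h3]
    push_cast at h2 ⊢
    linear_combination ((-Complex.I) ^ m * (-1) ^ i * a) * h2
  · intro j hj
    have h2 : powerEigenvalue n m j = 0 := by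
      by_cases hjm : j < m
      · exact powerEigenvalue_eq_zero_of_lt hjm
      · rw [powerEigenvalue, if_neg]
        rintro ⟨k, hk⟩
        exact hj ⟨k - m, by simp only; omega⟩
    rw [h2]
    simp

variable [NeZero n]

theorem sphereFourier_one (θ : Sph n) {r : ℝ} (hr : 0 < r) :
    sphereFourier (continuousToLp n 1) (r • (θ : Eucl n)) =
      (((2 * Real.pi) ^ ((n : ℝ) / 2) * r ^ (1 - (n : ℝ) / 2) : ℝ) : ℂ) *
        (besselJ (((n : ℝ) - 2) / 2) r : ℂ) := by
  have h1 := sphereFourier_eq_besselJ 0 (1 : C(Sph n, ℂ)) θ 1 (fun j => ?_) hr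
  · rw [h1, show (n : ℝ) / 2 - 1 + (0 : ℕ) = (n - 2) / 2 by push_cast; ring]
    simp
  · simp only [ContinuousMap.one_apply, mul_one]
    rw [integral_complex_ofReal, integral_inner_pow, norm_eq_of_mem_sphere]
    congr 1
    rw [powerEigenvalue, add_zero]
    simp

theorem integral_inner_pow_mul_linearForm (y : Fin n → ℂ) (θ : Sph n) (j : ℕ) :
    ∫ ω : Sph n, ((⟪(θ : Eucl n), (ω : Eucl n)⟫_ℝ ^ j : ℝ) : ℂ) * linearForm n y ω
      ∂(surfaceMeasure n) = (powerEigenvalue n 1 j : ℂ) * linearForm n y θ := by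
  have h1 : ∀ i : Fin n, ∫ ω : Sph n, ⟪(θ : Eucl n), (ω : Eucl n)⟫_ℝ ^ j * (ω : Eucl n) i
      ∂(surfaceMeasure n) = powerEigenvalue n 1 j * (θ : Eucl n) i := fun i => by
    have := integral_inner_pow_mul_inner j (θ : Eucl n) (EuclideanSpace.single i (1 : ℝ))
      (norm_eq_of_mem_sphere θ) (by simp)
    simpa [EuclideanSpace.inner_single_left] using this
  simp_rw [linearForm_apply, Finset.mul_sum]
  rw [integral_finsetSum _ fun i _ => integrable_of_continuous (by fun_prop)]
  refine Finset.sum_congr rfl fun i _ => ?_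
  calc _ = ∫ ω : Sph n, y i * ((⟪(θ : Eucl n), (ω : Eucl n)⟫_ℝ ^ j * (ω : Eucl n) i : ℝ) : ℂ)
        ∂(surfaceMeasure n) := by
        refine integral_congr_ae (Filter.Eventually.of_forall fun ω => ?_)
        push_cast
        ring
    _ = _ := by
        rw [integral_const_mul, integral_complex_ofReal, h1]
        push_cast
        ring

theorem sphereFourier_linearForm (y : Fin n → ℂ) (θ : Sph n) {r : ℝ} (hr : 0 < r) :
    sphereFourier (continuousToLp n (linearForm n y)) (r • (θ : Eucl n)) =
      -Complex.I * (((2 * Real.pi) ^ ((n : ℝ) / 2) * r ^ (1 - (n : ℝ) / 2) : ℝ) : ℂ) *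
        (besselJ ((n : ℝ) / 2) r : ℂ) * linearForm n y θ := by
  have h1 := sphereFourier_eq_besselJ 1 (linearForm n y) θ _
    (integral_inner_pow_mul_linearForm y θ) hr
  rw [h1, show (n : ℝ) / 2 - 1 + (1 : ℕ) = n / 2 by push_cast; ring, pow_one]

end BesselExpansion

/-! ### The cases of equality -/

section EqualityCases

variable {n : ℕ}

/-- The spherical harmonics of degree one are the linear forms. -/
theorem mem_sphericalHarmonics_one {Y : Sph n → ℂ} :
    Y ∈ sphericalHarmonics n 1 ↔ ∃ y : Fin n → ℂ, Y = linearForm n y := by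
  constructor
  · rintro ⟨p, hp, -, hY⟩
    refine ⟨fun i => p.coeff (Finsupp.single i 1), funext fun θ => ?_⟩
    have h1 : p = ∑ i, MvPolynomial.C (p.coeff (Finsupp.single i 1)) * MvPolynomial.X i := by
      ext d
      simp only [MvPolynomial.coeff_sum, MvPolynomial.coeff_C_mul, MvPolynomial.coeff_X, mul_ite,
        mul_one, mul_zero]
      by_cases hd : p.coeff d = 0
      · rw [hd, eq_comm]
        refine Finset.sum_eq_zero fun i _ => ?_
        split_ifs with h
        · rw [h, hd]
        · rfl
      · have h2 : d.degree = 1 := by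
          have := hp hd
          rwa [Finsupp.degree_eq_weight_one]
        obtain ⟨i, rfl⟩ := (Finsupp.sum_eq_one_iff d).mp h2
        rw [Finset.sum_eq_single i]
        · simp
        · intro j _ hj
          rw [if_neg]
          exact fun h => hj ((Finsupp.single_left_injective one_ne_zero) h)
        · simp
    rw [hY, linearForm_apply]
    conv_lhs => rw [h1]
    simp
  · rintro ⟨y, rfl⟩
    refine ⟨∑ i, MvPolynomial.C (y i) * MvPolynomial.X i, ?_, ?_, fun θ => ?_⟩
    · exact MvPolynomial.IsHomogeneous.sum _ _ _ fun i _ => by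
        simpa using (MvPolynomial.isHomogeneous_C (Fin n) (y i)).mul
          (MvPolynomial.isHomogeneous_X ℂ i)
    · refine Finset.sum_eq_zero fun i _ => ?_
      simp [MvPolynomial.pderiv_X, Pi.single_apply, apply_ite]
    · rw [linearForm_apply]
      simp

variable [NeZero n] {s : ℝ}

/-- The distribution `f` corresponds to the extension of the function
`(2π)^{-n/2} (c + i Y)` on the sphere, for `Y(θ) = ∑ yᵢ θᵢ`, if and only if its Fourier transform
is given by the Bessel functions of orders `(n-2)/2` and `n/2`. -/
theorem toL2_eq_extensionOp_iff (hs : 1 / 2 < s) (hs' : s < (n : ℝ) / 2) (f : HomSobolev n s)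
    (c : ℂ) (y : Fin n → ℂ) :
    HomSobolev.toL2 f = extensionOp hs hs' ((((2 * Real.pi) ^ (-(n : ℝ) / 2) : ℝ) : ℂ) •
        (c • continuousToLp n 1 + Complex.I • continuousToLp n (linearForm n y))) ↔
      ∀ᵐ ξ : Eucl n, ∀ hξ : ξ ≠ 0,
        ((‖ξ‖ ^ (((n : ℝ) - 2) / 2 + 2 * s) : ℝ) : ℂ) * HomSobolev.fourier f ξ =
          c * (besselJ (((n : ℝ) - 2) / 2) ‖ξ‖ : ℂ) +
            linearForm n y (direction ξ hξ) * (besselJ ((n : ℝ) / 2) ‖ξ‖ : ℂ) := by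
  set K : ℝ := (2 * Real.pi) ^ (-(n : ℝ) / 2) with hK
  have hK0 : 0 < K := by positivity
  set h := (K : ℂ) • (c • continuousToLp n 1 + Complex.I • continuousToLp n (linearForm n y))
  have hpoint : ∀ (ξ : Eucl n) (hξ : ξ ≠ 0),
      ((K * ‖ξ‖ ^ s : ℝ) : ℂ) * HomSobolev.fourier f ξ = extensionFun s h ξ ↔
        ((‖ξ‖ ^ (((n : ℝ) - 2) / 2 + 2 * s) : ℝ) : ℂ) * HomSobolev.fourier f ξ =
          c * (besselJ (((n : ℝ) - 2) / 2) ‖ξ‖ : ℂ) +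
            linearForm n y (direction ξ hξ) * (besselJ ((n : ℝ) / 2) ‖ξ‖ : ℂ) := by
    intro ξ hξ
    have hr : 0 < ‖ξ‖ := norm_pos_iff.mpr hξ
    have h1 : ξ = ‖ξ‖ • (direction ξ hξ : Eucl n) := by
      rw [direction, smul_smul, mul_inv_cancel₀ hr.ne', one_smul]
    have h2 : sphereFourier h ξ = ((‖ξ‖ ^ (1 - (n : ℝ) / 2) : ℝ) : ℂ) *
        (c * (besselJ (((n : ℝ) - 2) / 2) ‖ξ‖ : ℂ) +
          linearForm n y (direction ξ hξ) * (besselJ ((n : ℝ) / 2) ‖ξ‖ : ℂ)) := by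
      have h3 := sphereFourier_one (direction ξ hξ) hr
      have h4 := sphereFourier_linearForm y (direction ξ hξ) hr
      rw [← h1] at h3 h4
      have h5 : (K : ℂ) * (((2 * Real.pi) ^ ((n : ℝ) / 2) : ℝ) : ℂ) = 1 := by
        rw [← Complex.ofReal_mul, hK, ← Real.rpow_add (by positivity), neg_div, neg_add_cancel,
          Real.rpow_zero, Complex.ofReal_one]
      rw [sphereFourier_smul, sphereFourier_add, sphereFourier_smul, sphereFourier_smul, h3, h4]
      simp only [Complex.ofReal_mul]
      linear_combination (((‖ξ‖ ^ (1 - (n : ℝ) / 2) : ℝ) : ℂ) *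
        (c * (besselJ (((n : ℝ) - 2) / 2) ‖ξ‖ : ℂ) +
          linearForm n y (direction ξ hξ) * (besselJ ((n : ℝ) / 2) ‖ξ‖ : ℂ))) * h5 -
        ((K : ℂ) * (((2 * Real.pi) ^ ((n : ℝ) / 2) : ℝ) : ℂ) *
          ((‖ξ‖ ^ (1 - (n : ℝ) / 2) : ℝ) : ℂ) * linearForm n y (direction ξ hξ) *
            (besselJ ((n : ℝ) / 2) ‖ξ‖ : ℂ)) * Complex.I_sq
    have h6 : K * ‖ξ‖ ^ s = K * (‖ξ‖ ^ (-s) * ‖ξ‖ ^ (1 - (n : ℝ) / 2)) *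
        ‖ξ‖ ^ (((n : ℝ) - 2) / 2 + 2 * s) := by
      rw [mul_assoc, ← Real.rpow_add hr, ← Real.rpow_add hr]
      congr 2
      ring
    have h7 : ((K * (‖ξ‖ ^ (-s) * ‖ξ‖ ^ (1 - (n : ℝ) / 2)) : ℝ) : ℂ) ≠ 0 :=
      Complex.ofReal_ne_zero.mpr (by positivity)
    rw [extensionFun, h2, h6, ← hK, Complex.ofReal_mul (K * _), mul_assoc,
      show ((K * ‖ξ‖ ^ (-s) : ℝ) : ℂ) * (((‖ξ‖ ^ (1 - (n : ℝ) / 2) : ℝ) : ℂ) *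
        (c * (besselJ (((n : ℝ) - 2) / 2) ‖ξ‖ : ℂ) +
          linearForm n y (direction ξ hξ) * (besselJ ((n : ℝ) / 2) ‖ξ‖ : ℂ))) =
        ((K * (‖ξ‖ ^ (-s) * ‖ξ‖ ^ (1 - (n : ℝ) / 2)) : ℝ) : ℂ) *
        (c * (besselJ (((n : ℝ) - 2) / 2) ‖ξ‖ : ℂ) +
          linearForm n y (direction ξ hξ) * (besselJ ((n : ℝ) / 2) ‖ξ‖ : ℂ)) by
        simp only [Complex.ofReal_mul]; ring]
    exact mul_right_inj' h7
  have hT := (memLp_extensionFun hs hs' h).coeFn_toLp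
  constructor
  · intro heq
    rw [extensionOp_apply] at heq
    filter_upwards [coeFn_toL2 f, hT] with ξ e1 e2 hξ
    rw [← hpoint ξ hξ, ← e2, ← heq, e1]
  · intro hae
    rw [extensionOp_apply]
    refine Lp.ext ?_
    filter_upwards [coeFn_toL2 f, hT, hae, ae_ne_zero] with ξ e1 e2 e3 hξ
    rw [e1, e2]
    exact (hpoint ξ hξ).mpr (e3 hξ)

theorem exists_mem_constantSpace_linearSpace_iff (hs : 1 / 2 < s) (hs' : s < (n : ℝ) / 2)
    (f : HomSobolev n s) :
    (∃ p₀ ∈ constantSpace n, ∃ p₁ ∈ linearSpace n,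
        HomSobolev.toL2 f = extensionOp hs hs' (p₀ + p₁)) ↔
      ∃ c : ℂ, ∃ Y ∈ sphericalHarmonics n 1, ∀ᵐ ξ : Eucl n, ∀ hξ : ξ ≠ 0,
        ((‖ξ‖ ^ (((n : ℝ) - 2) / 2 + 2 * s) : ℝ) : ℂ) * HomSobolev.fourier f ξ =
          c * (besselJ (((n : ℝ) - 2) / 2) ‖ξ‖ : ℂ) +
            Y (direction ξ hξ) * (besselJ ((n : ℝ) / 2) ‖ξ‖ : ℂ) := by
  have hK : (((2 * Real.pi) ^ (-(n : ℝ) / 2) : ℝ) : ℂ) ≠ 0 :=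
    Complex.ofReal_ne_zero.mpr (by positivity)
  set K : ℂ := (((2 * Real.pi) ^ (-(n : ℝ) / 2) : ℝ) : ℂ) with hKdef
  constructor
  · rintro ⟨p₀, hp₀, p₁, ⟨y, rfl⟩, hf⟩
    obtain ⟨c, rfl⟩ := Submodule.mem_span_singleton.mp hp₀
    refine ⟨K⁻¹ * c, linearForm n ((K⁻¹ * -Complex.I) • y),
      mem_sphericalHarmonics_one.mpr ⟨_, rfl⟩, ?_⟩
    rw [← toL2_eq_extensionOp_iff hs hs', hf]
    congr 1
    rw [map_smul, map_smul, smul_add, smul_smul, smul_smul, smul_smul, mul_inv_cancel_left₀ hK,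
      ← hKdef, show K * Complex.I * (K⁻¹ * -Complex.I) = 1 by
        field_simp
        simp, one_smul]
    rfl
  · rintro ⟨c, Y, hY, hf⟩
    obtain ⟨y, rfl⟩ := mem_sphericalHarmonics_one.mp hY
    refine ⟨(K * c) • continuousToLp n 1,
      Submodule.smul_mem _ _ (Submodule.mem_span_singleton_self _),
      (K * Complex.I) • continuousToLp n (linearForm n y),
      Submodule.smul_mem _ _ ⟨y, rfl⟩, ?_⟩
    rw [(toL2_eq_extensionOp_iff hs hs' f c y).mpr hf, smul_add, smul_smul, smul_smul]

end EqualityCases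

end SphereTrace

theorem corollary1p2 (n : ℕ) [NeZero n] (s : ℝ) (hs₁ : 1 / 2 < s) (hs₂ : s < (n : ℝ) / 2) :
    (∃! R : HomSobolev n s →L[ℂ] Lp ℂ 2 (surfaceMeasure n),
      IsRestriction R) ∧
    ∀ R : HomSobolev n s →L[ℂ] Lp ℂ 2 (surfaceMeasure n),
      IsRestriction R →
      (extremisers R).Nonempty ∧
      (∀ f : HomSobolev n s,
        ‖R‖ ^ 2 * ‖f‖ ^ 2 - ‖R f‖ ^ 2 ≥
          stabilityConst n s *
            ⨅ g : extremisers R, ‖f - (g : HomSobolev n s)‖ ^ 2) ∧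
      (∀ C : ℝ,
        (∀ f : HomSobolev n s,
          ‖R‖ ^ 2 * ‖f‖ ^ 2 - ‖R f‖ ^ 2 ≥
            C * ⨅ g : extremisers R,
              ‖f - (g : HomSobolev n s)‖ ^ 2) →
        C ≤ stabilityConst n s) ∧
      (∀ f : HomSobolev n s,
        ‖R‖ ^ 2 * ‖f‖ ^ 2 - ‖R f‖ ^ 2 =
            stabilityConst n s *
              ⨅ g : extremisers R,
                ‖f - (g : HomSobolev n s)‖ ^ 2 ↔
          ∃ c : ℂ, ∃ Y ∈ sphericalHarmonics n 1,
            ∀ᵐ ξ : Eucl n, ∀ hξ : ξ ≠ 0,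
              ((‖ξ‖ ^ (((n : ℝ) - 2) / 2 + 2 * s) : ℝ) : ℂ) *
                  HomSobolev.fourier f ξ =
                c * (besselJ (((n : ℝ) - 2) / 2) ‖ξ‖ : ℂ) +
                  Y (direction ξ hξ) *
                    (besselJ ((n : ℝ) / 2) ‖ξ‖ : ℂ)) := by
  have hs₀ : 0 < s := by linarith
  have huniq : ∀ R : HomSobolev n s →L[ℂ] Lp ℂ 2 (surfaceMeasure n), IsRestriction R →
      R = restrictionOp hs₁ hs₂ := fun R hR =>
    hR.unique hs₀ hs₂ (isRestriction_restrictionOp hs₁ hs₂)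
  refine ⟨⟨restrictionOp hs₁ hs₂, isRestriction_restrictionOp hs₁ hs₂, huniq⟩, fun R hR => ?_⟩
  have hR' : ∀ f, R f = (extensionOp hs₁ hs₂).adjoint (sobolevIsometry hs₀.le hs₂ f) := fun f => by
    rw [huniq R hR, restrictionOp_apply]
  obtain ⟨h1, h2, h3, h4⟩ := (hasTopLevels_extensionOp (n := n) hs₁ hs₂).stability
    constantSpace_ne_bot linearSpace_ne_bot (sobolevIsometry hs₀.le hs₂) hR'
  rw [traceEigenvalue_zero_sub_one] at h2 h3 h4
  refine ⟨h1, h2, h3, fun f => (h4 f).trans ?_⟩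
  simp_rw [sobolevIsometry_apply]
  exact exists_mem_constantSpace_linearSpace_iff hs₁ hs₂ f
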